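/- Setting. Let $\Gamma\subset\mathbb R^3$ be a closed (compact, without boundary) embedded surface of class $C^2$ with unit normal field $\mathbf n$ (for instance the outward one), extended off $\Gamma$ by $\mathbf n(x)=\mathbf n(p(x))$, where $p(x)\in\Gamma$ is a point of $\Gamma$ closest to $x$ (unique near $\Gamma$). Let $\Omega\supset\Gamma$ be a polyhedral domain and let $\mathcal T_h$ be a conforming triangulation of $\Omega$ into closed tetrahedra; $h_T=\operatorname{diam}T$. Let $\mathcal T_h^\Gamma=\{T\in\mathcal T_h: T\cap\Gamma\neq\emptyset\}$, $h=\max_{T\in\mathcal T_h^\Gamma}h_T$, $\Omega_h^\Gamma=\operatorname{int}\bigcup_{T\in\mathcal T_h^\Gamma}T$, and $\omega(T)=\{T'\in\mathcal T_h^\Gamma: T'\cap T\ne\emptyset\}$; norms over $\omega(T)$ are taken over the union of its elements. Call $\mathcal T_h$ admissible with parameters $\sigma,\kappa,L$ if * (shape regularity) every $T\in\mathcal T_h$ contains a ball of radius at least $h_T/\sigma$; * (quasi-uniformity) $h\le\kappa h_T$ for every $T\in\mathcal T_h^\Gamma$; * (resolution of $\Gamma$) for every $T\in\mathcal T_h^\Gamma$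 the set $T\cap\Gamma$ is simply connected, and $\partial T\cap\Gamma$ has length at most $L\,h_T$. For an integer $k\ge1$ let $Q_h$ be the space of continuous functions $q$ on $\Omega_h^\Gamma$ that are polynomials of degree at most $k$ on each $T\in\mathcal T_h^\Gamma$ and satisfy $\int_\Gamma q\,ds=0$. For $c>0$ let $\mathcal T^\Gamma_{\rm reg}=\mathcal T^\Gamma_{\rm reg}(c)=\{T\in\mathcal T_h^\Gamma: |\Gamma\cap T|\ge c\,h_T^2\}$ be the set of regular elements. For $c_p>0$ put $$\|q\|_{1,h}^2=\sum_{T\in\mathcal T_h^\Gamma}h_T\|\nabla q\|_{L^2(T)}^2,\qquad \|q\|_{1,\rm reg}^2=\sum_{T\in\mathcal T_{\rm reg}^\Gamma}h_T\|\nabla q\|_{L^2(T)}^2,\qquad s_h(q,q)=c_p h\int_{\Omega_h^\Gamma}(\mathbf n\cdot\nabla q)^2\,dx .$$ For a constant $C>0$ consider the following estimate. (E) For every $T\in\mathcal T_h^\Gamma$ there is $T'\in\omega(T)\cap\mathcal T_{\rm reg}^\Gamma(c)$ such that for all $q\in Q_h$ $$\|\nabla q\|_{L^2(T)}\le C\big(\|\nabla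 q\|_{L^2(T')}+\|\mathbf n\cdot\nabla q\|_{L^2(\omega(T))}+h_T\|\nabla q\|_{L^2(\omega(T))}\big).$$ Claim. For all $\sigma,\kappa$ there is a threshold $c_0>0$, depending only on $\sigma,\kappa$, such that for all $\Gamma,\mathbf n,k,L$ as above the following hold. 1. There is $C>0$ (depending on $\sigma,\kappa,\Gamma,\mathbf n,k,L$) such that for every $\Omega$ there is $h_0>0$ such that (E) holds for every $0<c\le c_0$ and every admissible mesh of $\Omega$ with $h\le h_0$. 2. Without restriction on $h$: for every $\Omega$ there are $c_1,C>0$ such that (E) holds for every $0<c\le c_1$ and every admissible mesh of $\Omega$. 3. For every $c_p>0$ there is $C>0$ such that for every $\Omega$ there is $h_0>0$ such that, for every $0<c\le c_0$ and every admissible mesh of $\Omega$ with $h\le h_0$, $$\|q\|_{1,h}^2\le C\big(\|q\|_{1,\rm reg}^2+s_h(q,q)\big)\qquad\text{for all }q\in Q_h .$$ -/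

import Mathlib

open MeasureTheory Set
open scoped MeasureTheory

noncomputable section

namespace TraceFEM

/-- Three-dimensional Euclidean space. -/
abbrev E3 : Type := EuclideanSpace ℝ (Fin 3)

/-! ### The surface and its normal -/

/-- `Γ` is a closed (compact, without boundary) embedded surface of class `C²` in `ℝ³`, and `n` is a
unit normal field on it: near each of its points `Γ` is a regular level set, and `n` is the
normalized gradient of the level set function.  The outward normal of a closed surface is such
a field; both orientations are allowed. -/
structure IsClosedSurface (Γ : Set E3) (n : E3 → E3) : Prop where
  isCompact : IsCompact Γ
  nonempty : Γ.Nonempty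
  exists_levelSet : ∀ x ∈ Γ, ∃ (U : Set E3) (φ : E3 → ℝ), IsOpen U ∧ x ∈ U ∧
    ContDiffOn ℝ 2 φ U ∧ (∀ y ∈ U, gradient φ y ≠ 0) ∧ Γ ∩ U = {y ∈ U | φ y = 0} ∧
    ∀ y ∈ Γ ∩ U, n y = ‖gradient φ y‖⁻¹ • gradient φ y

/-- A point of `Γ` closest to `x`; it is unique for `x` in a neighborhood of a closed surface. -/
def closestPoint (Γ : Set E3) (x : E3) : E3 :=
  Classical.epsilon fun p => p ∈ Γ ∧ dist x p = Metric.infDist x Γ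

/-- The normal field of `Γ`, extended off `Γ` as a constant along normals. -/
def normalExt (Γ : Set E3) (n : E3 → E3) (x : E3) : E3 := n (closestPoint Γ x)

/-- Surface area. -/
def area : Measure E3 := μHE[2]

/-- Length. -/
def length : Measure E3 := μHE[1]

/-! ### Tetrahedral meshes -/

/-- A conforming mesh, as a geometric simplicial complex. -/
abbrev Mesh : Type := Geometry.SimplicialComplex ℝ E3

/-- The closed tetrahedron with vertex set `T`. -/
def tet (T : Finset E3) : Set E3 := convexHull ℝ (T : Set E3)

/-- The diameter `h_T`. -/
def hT (T : Finset E3) : ℝ := Metric.diam (tet T)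

/-- The tetrahedra (given by their vertex sets) of a mesh. -/
def tets (K : Mesh) : Set (Finset E3) := {T ∈ K.faces | T.card = 4}

/-- `K` is a (finite, conforming) tetrahedral triangulation of `Ω`. -/
structure IsTriangulation (K : Mesh) (Ω : Set E3) : Prop where
  finite : K.faces.Finite
  pure : ∀ s ∈ K.faces, ∃ T ∈ tets K, s ⊆ T
  covers : ⋃ T ∈ tets K, tet T = closure Ω

/-- Shape regularity: each tetrahedron contains a ball of radius at least `h_T / σ`. -/
def ShapeRegular (σ : ℝ) (K : Mesh) : Prop :=
  ∀ T ∈ tets K, ∃ (x : E3) (r : ℝ), 0 < r ∧ hT T ≤ σ * r ∧ Metric.closedBall x r ⊆ tet T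

/-- The active mesh: the tetrahedra that meet `Γ`. -/
def cutTets (Γ : Set E3) (K : Mesh) : Set (Finset E3) := {T ∈ tets K | (tet T ∩ Γ).Nonempty}

/-- The mesh size `h`: the largest diameter of a tetrahedron of the active mesh. -/
def meshSize (Γ : Set E3) (K : Mesh) : ℝ := sSup (hT '' cutTets Γ K)

/-- Quasi-uniformity of the active mesh. -/
def QuasiUniform (κ : ℝ) (Γ : Set E3) (K : Mesh) : Prop :=
  ∀ T ∈ cutTets Γ K, meshSize Γ K ≤ κ * hT T

/-- The mesh resolves `Γ`: each cut `T ∩ Γ` is simply connected and the part of `Γ` on the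
boundary of `T` has length at most `L h_T`. -/
def Resolves (L : ℝ) (Γ : Set E3) (K : Mesh) : Prop :=
  ∀ T ∈ cutTets Γ K, IsSimplyConnected (tet T ∩ Γ) ∧
    length (frontier (tet T) ∩ Γ) ≤ ENNReal.ofReal (L * hT T)

/-- The standing assumptions on a background mesh of `Ω`. -/
structure IsAdmissible (σ κ L : ℝ) (Γ Ω : Set E3) (K : Mesh) : Prop where
  triangulation : IsTriangulation K Ω
  shapeRegular : ShapeRegular σ K
  quasiUniform : QuasiUniform κ Γ K
  resolves : Resolves L Γ K

/-- The neighbors `ω(T)` of `T` in the active mesh (`T` is one of them). -/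
def nbrs (Γ : Set E3) (K : Mesh) (T : Finset E3) : Set (Finset E3) :=
  {T' ∈ cutTets Γ K | (tet T' ∩ tet T).Nonempty}

/-- The region covered by a set of tetrahedra. -/
def region (S : Set (Finset E3)) : Set E3 := ⋃ T ∈ S, tet T

/-- The regular elements with threshold `c`: those with `|T ∩ Γ| ≥ c h_T²`. -/
def regTets (c : ℝ) (Γ : Set E3) (K : Mesh) : Set (Finset E3) :=
  {T ∈ cutTets Γ K | ENNReal.ofReal (c * hT T ^ 2) ≤ area (tet T ∩ Γ)}

/-- The domain `Ω_h^Γ`. -/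
def activeDomain (Γ : Set E3) (K : Mesh) : Set E3 := interior (region (cutTets Γ K))

/-! ### The finite element space, norms and the stabilization form -/

/-- The pressure space `Q_h`: continuous functions on `Ω_h^Γ` that are polynomials of degree at most
`k` on each tetrahedron of the active mesh and have mean zero on `Γ`.  (Values outside `Ω_h^Γ` are
irrelevant.) -/
def pressureSpace (k : ℕ) (Γ : Set E3) (K : Mesh) : Set (E3 → ℝ) :=
  {q | ContinuousOn q (activeDomain Γ K) ∧
    (∀ T ∈ cutTets Γ K, ∃ p : MvPolynomial (Fin 3) ℝ, p.totalDegree ≤ k ∧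
      ∀ x ∈ interior (tet T), q x = MvPolynomial.eval (fun i => x i) p) ∧
    ∫ x in Γ, q x ∂area = 0}

/-- The `L²` norm over a set with respect to the volume. -/
def l2norm {F : Type*} [NormedAddCommGroup F] (S : Set E3) (f : E3 → F) : ℝ :=
  √(∫ x in S, ‖f x‖ ^ 2)

/-- The normal derivative `n · ∇q`, with the extended normal. -/
def normalDeriv (Γ : Set E3) (n : E3 → E3) (q : E3 → ℝ) (x : E3) : ℝ :=
  inner ℝ (normalExt Γ n x) (gradient q x)

/-- The normal volume stabilization `s_h(p, q)` with parameter `ρ_p = c_p h`. -/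
def stab (cp : ℝ) (Γ : Set E3) (n : E3 → E3) (K : Mesh) (p q : E3 → ℝ) : ℝ :=
  (cp * meshSize Γ K) * ∫ x in activeDomain Γ K, normalDeriv Γ n p x * normalDeriv Γ n q x

/-- The norm `‖q‖_{1,h}`. -/
def norm1h (Γ : Set E3) (K : Mesh) (q : E3 → ℝ) : ℝ :=
  √(∑ᶠ T ∈ cutTets Γ K, hT T * l2norm (tet T) (gradient q) ^ 2)

/-- The seminorm `‖q‖_{1,reg}`, for the threshold `c`. -/
def norm1reg (c : ℝ) (Γ : Set E3) (K : Mesh) (q : E3 → ℝ) : ℝ :=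
  √(∑ᶠ T ∈ regTets c Γ K, hT T * l2norm (tet T) (gradient q) ^ 2)

/-- The neighborhood estimate for gradients, with constant `C` and regularity threshold `c`:
each active `T` has a regular neighbor `T'`, chosen independently of `q`, with
`‖∇q‖_{L²(T)} ≤ C (‖∇q‖_{L²(T')} + ‖n·∇q‖_{L²(ω(T))} + h_T ‖∇q‖_{L²(ω(T))})` for all `q ∈ Q_h`. -/
def NeighborEstimate (k : ℕ) (Γ : Set E3) (n : E3 → E3) (K : Mesh) (c C : ℝ) : Prop :=
  ∀ T ∈ cutTets Γ K, ∃ T' ∈ nbrs Γ K T ∩ regTets c Γ K, ∀ q ∈ pressureSpace k Γ K,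
    l2norm (tet T) (gradient q) ≤
      C * (l2norm (tet T') (gradient q) + l2norm (region (nbrs Γ K T)) (normalDeriv Γ n q)
        + hT T * l2norm (region (nbrs Γ K T)) (gradient q))

end TraceFEM

end

/-! ### A lower bound for area by orthogonal projection. -/

namespace TraceFEM

/-! At the scale `h` of the mesh a `C²` surface is a plane up to a relative error `τ = O(h)`. The
heart of the proof is a statement on meshes and almost flat surfaces, `exists_hasVerticalNeighbor`:
every active `T` has an active neighbor `T'` that carries a fixed multiple of `h²` of the area of
`Γ`, and a ball of radius `δ h` in `T'` can be translated along `± n` into `T` without leaving the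
active neighbors of `T`.

Given this, let `f'` and `f` be the polynomials of `q` on `T'` and `T`, and `a` the translation
vector. On the ball, `f (· + a) - f'` is a difference of values of `q` along a segment in the normal
direction, so its `L²` norm is at most `h` times that of the directional derivative. An inverse and
an extension inequality for polynomials then bound `∇f` by `∇f'` and this derivative
(`exists_eLpNorm_gradient_le`). Replacing the fixed direction by the extended normal costs `O(h)
‖∇q‖`, the last term of the estimate.

The geometry is as follows. If `T` reaches a distance comparable to `h` on both sides of `Γ`, take
`T' = T`. Otherwise `T` barely reaches one side, say the lower one. The face `S` of `T` that carries
its lowest point is then almost horizontal, and an element containing `S` is cut as soon as it has a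
point on or above `Γ`. A short vertical column that starts in `T` near the barycenter of `S` stays
among elements containing `S`, because barycentric coordinates vary slowly, and it reaches `Γ`
through active ones. There are boundedly many of these, so one of them contains much of `Γ`.

The difficulty is that below `Γ` the column might cross inactive elements before it reaches the ball
in `T'`. To exclude this, many small discs are placed along a parabola: by the pigeonhole principle
one element is selected for three of them and hence contains a fat, almost horizontal triangle with
vertices on `Γ` (`exists_fat_triangle`). A plane separating `T'` from another element met above the
triangle forces that element to rise above `Γ`, so it is active (`Column.mem_cut_above`).

On coarse meshes `h_T` is bounded below, the last term of the estimate dominates the left side, and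
only a regular neighbor is needed (`exists_mem_nbrs_regTets`). The global estimate follows by
squaring, summing with bounded overlap and absorbing the last term for small `h` (`norm1h_sq_le`).
-/

theorem area_mono_of_projection {n₀ z : E3} (hn : ‖n₀‖ = 1) {ρ : ℝ} (hρ : 0 ≤ ρ) {S : Set E3}
    (hS : ∀ u : E3, inner ℝ n₀ u = 0 → ‖u‖ ≤ ρ → ∃ t : ℝ, z + u + t • n₀ ∈ S) :
    ENNReal.ofReal (ρ ^ 2) ≤ area S := by
  let F : Submodule ℝ E3 := (ℝ ∙ n₀)ᗮ
  have hn0 : n₀ ≠ 0 := by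
    intro h
    simp [h] at hn
  have : Fact (Module.finrank ℝ E3 = 2 + 1) := ⟨by simp⟩
  have hF : Module.finrank ℝ F = 2 := Submodule.finrank_orthogonal_span_singleton hn0
  let f : E3 → F := fun x => F.orthogonalProjectionOnto (x - z)
  -- The projection along `n₀` does not increase two-dimensional Hausdorff measure, and its image of
  -- `S` covers a disc of radius `ρ`. The factor `π` of the disc is discarded.
  have hf : LipschitzWith 1 f := by
    refine LipschitzWith.of_dist_le_mul fun x y => ?_
    have : f x - f y = F.orthogonalProjectionOnto (x - y) := by
      simp only [f, ← map_sub]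
      congr 1
      abel
    rw [dist_eq_norm, this, dist_eq_norm, NNReal.coe_one]
    exact (F.orthogonalProjectionOnto.le_opNorm _).trans
      (mul_le_mul_of_nonneg_right F.orthogonalProjectionOnto_norm_le (norm_nonneg _))
  have hsub : Metric.closedBall (0 : F) ρ ⊆ f '' S := by
    intro u hu
    have hu1 : inner ℝ n₀ (u : E3) = 0 := Submodule.mem_orthogonal_singleton_iff_inner_right.1 u.2
    obtain ⟨t, ht⟩ := hS u hu1 (by simpa using hu)
    refine ⟨_, ht, ?_⟩
    have h1 : z + (u : E3) + t • n₀ - z = u + t • n₀ := by abel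
    have h2 : F.orthogonalProjectionOnto n₀ = 0 :=
      Submodule.orthogonalProjectionOnto_orthogonalComplement_singleton_eq_zero n₀
    simp only [f, h1, map_add, map_smul, h2, smul_zero, add_zero]
    exact Submodule.orthogonalProjectionOnto_mem_subspace_eq_self u
  have hle : (μHE[2] : Measure F) (f '' S) ≤ area S := by
    have := hf.hausdorffMeasure_image_le (d := ((2 : ℕ) : ℝ)) (by norm_num) S
    simp only [area, Measure.euclideanHausdorffMeasure_def, Measure.smul_apply]
    gcongr
    simpa using this
  have hvol : (μHE[2] : Measure F) = volume := by
    have := InnerProductSpace.euclideanHausdorffMeasure_eq_volume (V := F)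
    rwa [hF] at this
  have : Nontrivial F := Module.nontrivial_of_finrank_pos (R := ℝ) (by omega)
  calc ENNReal.ofReal (ρ ^ 2) ≤ volume (Metric.closedBall (0 : F) ρ) := by
        rw [InnerProductSpace.volume_closedBall_of_dim_even (k := 1) (by omega), hF,
          ENNReal.ofReal_pow hρ]
        refine le_mul_of_one_le_right (by positivity) ?_
        rw [ENNReal.one_le_ofReal]
        simp
        linarith [Real.pi_gt_three]
    _ ≤ _ := by rw [← hvol]; exact (measure_mono hsub).trans hle

end TraceFEM

namespace TraceFEM

/-! ### Tetrahedra -/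

theorem convex_tet (T : Finset E3) : Convex ℝ (tet T) := convex_convexHull ℝ _

theorem isCompact_tet (T : Finset E3) : IsCompact (tet T) :=
  T.finite_toSet.isCompact_convexHull (𝕜 := ℝ)

theorem subset_tet (T : Finset E3) : (T : Set E3) ⊆ tet T := subset_convexHull ℝ _

theorem norm_sub_le_hT {T : Finset E3} {x y : E3} (hx : x ∈ tet T) (hy : y ∈ tet T) :
    ‖x - y‖ ≤ hT T := by
  rw [← dist_eq_norm]
  exact Metric.dist_le_diam_of_mem (isCompact_tet T).isBounded hx hy

theorem hT_nonneg (T : Finset E3) : 0 ≤ hT T := Metric.diam_nonneg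

section Mesh

variable {K : Mesh} {σ : ℝ}

theorem ShapeRegular.hT_pos (hK : ShapeRegular σ K) {T : Finset E3} (hT' : T ∈ tets K) :
    0 < hT T := by
  obtain ⟨x, r, hr, -, hb⟩ := hK T hT'
  obtain ⟨e, he⟩ := exists_norm_eq E3 (c := r) hr.le
  have h1 : x + e ∈ tet T := hb (by simp [he])
  have h2 : x ∈ tet T := hb (by simp [hr.le])
  have := norm_sub_le_hT h1 h2
  simp only [add_sub_cancel_left] at this
  linarith

/-- The homothety with center `x` and ratio `c` maps a convex set containing `x` into itself. -/
theorem closedBall_subset_of_convex {S : Set E3} (hS : Convex ℝ S) {x y : E3} {r c : ℝ}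
    (hx : x ∈ S) (hb : Metric.closedBall y r ⊆ S) (hc0 : 0 < c) (hc1 : c ≤ 1) :
    Metric.closedBall (x + c • (y - x)) (c * r) ⊆ S := by
  intro p hp
  rw [mem_closedBall_iff_norm] at hp
  have h1 : y + c⁻¹ • (p - (x + c • (y - x))) ∈ S := by
    apply hb
    rw [mem_closedBall_iff_norm, add_sub_cancel_left, norm_smul, norm_inv, Real.norm_of_nonneg hc0.le,
      inv_mul_le_iff₀ hc0]
    exact hp
  have h2 := hS hx h1 (sub_nonneg.2 hc1) hc0.le (by ring)
  convert h2 using 1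
  rw [smul_add, smul_smul, mul_inv_cancel₀ hc0.ne']
  module

/-- Shrinking the inscribed ball towards `x` makes shape regularity available near every point of
`T` and at every scale below `h_T`. -/
theorem ShapeRegular.exists_closedBall (hK : ShapeRegular σ K) (hσ : 0 < σ) {T : Finset E3}
    (hT' : T ∈ tets K) {x : E3} (hx : x ∈ tet T) {t : ℝ} (ht0 : 0 < t) (ht : t ≤ hT T) :
    ∃ z, ‖z - x‖ ≤ t ∧ Metric.closedBall z (t / σ) ⊆ tet T := by
  obtain ⟨y, r, hr, hle, hb⟩ := hK T hT'
  have hpos := hK.hT_pos hT'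
  have hc : 0 < t / hT T := by positivity
  refine ⟨x + (t / hT T) • (y - x), ?_, ?_⟩
  · rw [add_sub_cancel_left, norm_smul, Real.norm_of_nonneg hc.le, div_mul_eq_mul_div,
      div_le_iff₀ hpos]
    exact mul_le_mul_of_nonneg_left
      (norm_sub_le_hT (hb (Metric.mem_closedBall_self hr.le)) hx) ht0.le
  · refine (Metric.closedBall_subset_closedBall ?_).trans
      (closedBall_subset_of_convex (convex_tet T) hx hb hc ((div_le_one hpos).2 ht))
    rw [div_mul_eq_mul_div, div_le_div_iff₀ hσ hpos]
    calc t * hT T ≤ t * (σ * r) := by gcongr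
      _ = _ := by ring

theorem ShapeRegular.interior_nonempty (hK : ShapeRegular σ K) {T : Finset E3} (hT' : T ∈ tets K) :
    (interior (tet T)).Nonempty := by
  obtain ⟨y, r, hr, -, hb⟩ := hK T hT'
  exact ⟨y, mem_interior_iff_mem_nhds.2
    (Filter.mem_of_superset (Metric.closedBall_mem_nhds y hr) hb)⟩

/-! ### Barycentric coordinates -/

open scoped Classical in
/-- The barycentric coordinate of the tetrahedron `T` at the vertex `v` (zero if `v ∉ T`). -/
noncomputable def bary (T : Finset E3) (v : E3) : E3 →ᵃ[ℝ] ℝ :=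
  Classical.epsilon fun L => ∀ w ∈ T, L w = if w = v then 1 else 0

open scoped Classical in
theorem bary_apply {T : Finset E3} (hT' : T ∈ tets K) (v : E3) {w : E3} (hw : w ∈ T) :
    bary T v w = if w = v then 1 else 0 := by
  have hex : ∃ L : E3 →ᵃ[ℝ] ℝ, ∀ w ∈ T, L w = if w = v then 1 else 0 := by
    by_cases hv : v ∈ T
    · have hind := K.indep hT'.1
      have htop : affineSpan ℝ (range ((↑) : T → E3)) = ⊤ := by
        apply hind.affineSpan_eq_top_iff_card_eq_finrank_add_one.2
        simp [hT'.2]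
      let B : AffineBasis T ℝ E3 := ⟨_, hind, htop⟩
      refine ⟨B.coord ⟨v, hv⟩, fun w hw => ?_⟩
      have : B.coord ⟨v, hv⟩ (B ⟨w, hw⟩) = if (⟨v, hv⟩ : T) = ⟨w, hw⟩ then 1 else 0 :=
        B.coord_apply _ _
      simp only [Subtype.mk.injEq] at this
      rw [show w = B ⟨w, hw⟩ from rfl, this]
      simp only [eq_comm]
      rfl
    · refine ⟨0, fun w hw => ?_⟩
      rw [if_neg (by rintro rfl; exact hv hw)]
      rfl
  exact Classical.epsilon_spec hex w hw

theorem bary_self {T : Finset E3} (hT' : T ∈ tets K) {v : E3} (hv : v ∈ T) : bary T v v = 1 := by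
  rw [bary_apply hT' v hv, if_pos rfl]

theorem affine_convex_induction {S : Set E3} (f : E3 →ᵃ[ℝ] ℝ) {D : Set ℝ} (hD : Convex ℝ D)
    (h : ∀ x ∈ S, f x ∈ D) {x : E3} (hx : x ∈ convexHull ℝ S) : f x ∈ D :=
  convexHull_min h (hD.affine_preimage f) hx

theorem bary_mem_Icc {T : Finset E3} (hT' : T ∈ tets K) (v : E3) {x : E3} (hx : x ∈ tet T) :
    bary T v x ∈ Icc (0 : ℝ) 1 := by
  refine affine_convex_induction _ (convex_Icc 0 1) (fun w hw => ?_) hx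
  rw [bary_apply hT' v hw]
  split_ifs <;> simp

theorem bary_eq_zero {T : Finset E3} (hT' : T ∈ tets K) {v : E3} (hv : v ∉ T) {x : E3}
    (hx : x ∈ tet T) : bary T v x = 0 := by
  refine affine_convex_induction _ (convex_singleton (0 : ℝ)) (fun w hw => ?_) hx
  rw [bary_apply hT' v hw, if_neg (by rintro rfl; exact hv hw)]
  rfl

theorem mem_of_bary_pos {T : Finset E3} (hT' : T ∈ tets K) {v x : E3} (hx : x ∈ tet T)
    (h : 0 < bary T v x) : v ∈ T := by
  by_contra hv
  exact h.ne' (bary_eq_zero hT' hv hx)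

theorem mem_convexHull_inter {T₁ T₂ : Finset E3} (h₁ : T₁ ∈ tets K) (h₂ : T₂ ∈ tets K) {x : E3}
    (hx₁ : x ∈ tet T₁) (hx₂ : x ∈ tet T₂) : x ∈ convexHull ℝ (T₁ ∩ T₂ : Set E3) :=
  K.inter_subset_convexHull h₁.1 h₂.1 ⟨hx₁, hx₂⟩

/-- Conformity puts `x` in the hull of the common vertices, where both affine functions take the
same values. This allows a barycentric coordinate to be followed from one element to the next. -/
theorem bary_eq_bary {T₁ T₂ : Finset E3} (h₁ : T₁ ∈ tets K) (h₂ : T₂ ∈ tets K) (v : E3) {x : E3}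
    (hx₁ : x ∈ tet T₁) (hx₂ : x ∈ tet T₂) : bary T₁ v x = bary T₂ v x := by
  have := affine_convex_induction (bary T₁ v - bary T₂ v) (convex_singleton (0 : ℝ))
    (fun w hw => ?_) (mem_convexHull_inter h₁ h₂ hx₁ hx₂)
  · exact sub_eq_zero.1 this
  · simp [bary_apply h₁ v hw.1, bary_apply h₂ v hw.2]

theorem affine_sub (f : E3 →ᵃ[ℝ] ℝ) (x y : E3) : f x - f y = f.linear (x - y) := by
  simpa using (f.linearMap_vsub x y).symm

/-- The coordinate varies by at most `1` across a diameter `2 r` of the inscribed ball, which bounds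
the slope of this affine function everywhere. -/
theorem ShapeRegular.abs_bary_sub_le (hK : ShapeRegular σ K) {T : Finset E3} (hT' : T ∈ tets K)
    (v x y : E3) : |bary T v x - bary T v y| ≤ σ / (2 * hT T) * ‖x - y‖ := by
  obtain ⟨z, r, hr, hle, hb⟩ := hK T hT'
  have hpos := hK.hT_pos hT'
  have hmain : |bary T v x - bary T v y| ≤ 1 / (2 * r) * ‖x - y‖ := by
    rw [affine_sub]
    rcases eq_or_ne (x - y) 0 with h0 | h0
    · simp [h0]
    have hn : 0 < ‖x - y‖ := norm_pos_iff.2 h0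
    set e : E3 := (r / ‖x - y‖) • (x - y) with he
    have hen : ‖e‖ = r := by
      rw [he, norm_smul, Real.norm_of_nonneg (by positivity)]
      field_simp
    have h1 := bary_mem_Icc hT' v (hb (show z + e ∈ Metric.closedBall z r by simp [hen]))
    have h2 := bary_mem_Icc hT' v (hb (show z - e ∈ Metric.closedBall z r by simp [hen]))
    have h3 := affine_sub (bary T v) (z + e) (z - e)
    have h4 : (z + e) - (z - e) = (2 * r / ‖x - y‖) • (x - y) := by
      rw [he]; module
    rw [h4, map_smul, smul_eq_mul] at h3
    have h5 : |2 * r / ‖x - y‖ * (bary T v).linear (x - y)| ≤ 1 := by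
      rw [← h3, abs_le]
      constructor <;> linarith [h1.1, h1.2, h2.1, h2.2]
    rw [abs_mul, abs_of_pos (by positivity), div_mul_eq_mul_div, div_le_one hn] at h5
    rw [div_mul_eq_mul_div, le_div_iff₀ (by positivity)]
    linarith
  refine hmain.trans (mul_le_mul_of_nonneg_right ?_ (norm_nonneg _))
  rw [div_le_div_iff₀ (by positivity) (by positivity)]
  linarith

/-- Along the edge from `v` to `w` the coordinate at `v` drops from `1` to `0` with bounded slope,
so no edge is short. -/
theorem ShapeRegular.le_norm_sub_vertices (hK : ShapeRegular σ K) {T : Finset E3} (hT' : T ∈ tets K)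
    {v w : E3} (hv : v ∈ T) (hw : w ∈ T) (hvw : v ≠ w) : 2 * hT T ≤ σ * ‖v - w‖ := by
  have h := hK.abs_bary_sub_le hT' v v w
  have hpos := hK.hT_pos hT'
  rw [bary_self hT' hv, bary_apply hT' v hw, if_neg hvw.symm, sub_zero, abs_one,
    div_mul_eq_mul_div, le_div_iff₀ (by positivity)] at h
  linarith

/-- The barycenter of a finite set of points. -/
noncomputable def barycenter (S : Finset E3) : E3 := (S.card : ℝ)⁻¹ • ∑ v ∈ S, v

theorem barycenter_mem {S : Finset E3} (hS : S.Nonempty) : barycenter S ∈ tet S := by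
  have hc : (0 : ℝ) < S.card := by exact_mod_cast hS.card_pos
  rw [barycenter, Finset.smul_sum]
  refine (convex_tet S).sum_mem (fun _ _ => by positivity) ?_ (fun v hv => subset_tet S hv)
  simp [hc.ne']

theorem affine_barycenter {S : Finset E3} (hS : S.Nonempty) (f : E3 →ᵃ[ℝ] ℝ) :
    f (barycenter S) = (S.card : ℝ)⁻¹ * ∑ v ∈ S, f v := by
  have hc : (0 : ℝ) < S.card := by exact_mod_cast hS.card_pos
  have h : ∀ x, f x = f.linear x + f 0 := fun x => by
    have := affine_sub f x 0
    rw [sub_zero] at this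
    linarith
  rw [h, Finset.sum_congr rfl fun v _ => h v, Finset.sum_add_distrib, barycenter, map_smul, map_sum,
    smul_eq_mul, Finset.sum_const, nsmul_eq_mul]
  field_simp

theorem bary_barycenter {T : Finset E3} (hT' : T ∈ tets K) {S : Finset E3} (hST : S ⊆ T) {v : E3}
    (hv : v ∈ S) : 1 / 4 ≤ bary T v (barycenter S) := by
  classical
  have hc : (0 : ℝ) < S.card := by exact_mod_cast Finset.card_pos.2 ⟨v, hv⟩
  rw [affine_barycenter ⟨v, hv⟩, Finset.sum_congr rfl fun w hw => bary_apply hT' v (hST hw)]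
  rw [Finset.sum_ite_eq' S v, if_pos hv, mul_one, one_div]
  have : (S.card : ℝ) ≤ 4 := by
    have := Finset.card_le_card hST
    rw [hT'.2] at this
    exact_mod_cast this
  gcongr

theorem tet_mono {S T : Finset E3} (h : S ⊆ T) : tet S ⊆ tet T :=
  convexHull_mono (by exact_mod_cast h)

/-! ### Interiors of different tetrahedra -/

/-- For a vertex `v` of `T₁` outside `T₂`, the coordinate of `T₁` at `v` vanishes on the
intersection of the two tetrahedra. It increases strictly towards `v`, so the intersection of the
interiors, which is open, is empty. -/
theorem disjoint_interior_tet {T₁ T₂ : Finset E3} (h₁ : T₁ ∈ tets K) (h₂ : T₂ ∈ tets K)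
    (hne : T₁ ≠ T₂) : Disjoint (interior (tet T₁)) (interior (tet T₂)) := by
  rw [Set.disjoint_left]
  intro x hx₁ hx₂
  obtain ⟨v, hv₁, hv₂⟩ : ∃ v ∈ T₁, v ∉ T₂ := by
    by_contra! h
    exact hne (Finset.eq_of_subset_of_card_le h (by rw [h₁.2, h₂.2]))
  have hnear : ∀ᶠ c : ℝ in nhdsWithin 0 (Ioi 0), AffineMap.lineMap x v c ∈
      interior (tet T₁) ∩ interior (tet T₂) := by
    have hcont : Filter.Tendsto (fun c : ℝ => AffineMap.lineMap x v c) (nhdsWithin 0 (Ioi 0))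
        (nhds x) := by
      have : Continuous (fun c : ℝ => AffineMap.lineMap (k := ℝ) x v c) :=
        AffineMap.lineMap_continuous
      simpa using (this.tendsto 0).mono_left nhdsWithin_le_nhds
    exact hcont ((isOpen_interior.inter isOpen_interior).mem_nhds ⟨hx₁, hx₂⟩)
  obtain ⟨c, hc, hc0⟩ := (hnear.and self_mem_nhdsWithin).exists
  have hL : ∀ y, y ∈ interior (tet T₁) ∩ interior (tet T₂) → bary T₁ v y = 0 := fun y hy => by
    rw [bary_eq_bary h₁ h₂ v (interior_subset hy.1) (interior_subset hy.2)]
    exact bary_eq_zero h₂ hv₂ (interior_subset hy.2)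
  have h3 := hL _ hc
  rw [AffineMap.apply_lineMap, hL x ⟨hx₁, hx₂⟩, bary_self h₁ hv₁, AffineMap.lineMap_apply] at h3
  simp at h3
  exact (ne_of_gt hc0) h3

/-- Hahn–Banach for the disjoint interiors, extended to the closed tetrahedra by density. The strict
inequality is kept on the interior of `T₂`. -/
theorem ShapeRegular.exists_separation (hK : ShapeRegular σ K) {T₁ T₂ : Finset E3}
    (h₁ : T₁ ∈ tets K) (h₂ : T₂ ∈ tets K) (hne : T₁ ≠ T₂) :
    ∃ (f : E3 →L[ℝ] ℝ) (α : ℝ), (∀ x ∈ tet T₁, f x ≤ α) ∧ (∀ x ∈ tet T₂, α ≤ f x) ∧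
      (∀ x ∈ interior (tet T₂), α < f x) := by
  obtain ⟨f, α, hf₂, hf₁⟩ := geometric_hahn_banach_open_open (convex_tet T₂).interior
    isOpen_interior (convex_tet T₁).interior isOpen_interior (disjoint_interior_tet h₂ h₁ hne.symm)
  have hcl : ∀ {T}, T ∈ tets K → tet T ⊆ closure (interior (tet T)) := fun {T} hT => by
    rw [(convex_tet T).closure_interior_eq_closure_of_nonempty_interior (hK.interior_nonempty hT)]
    exact subset_closure
  refine ⟨-f, -α, fun x hx => ?_, fun x hx => ?_, fun x hx => ?_⟩
  · have : x ∈ {y | α ≤ f y} := closure_minimal (fun y hy => (hf₁ y hy).le)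
      (isClosed_le continuous_const f.continuous) (hcl h₁ hx)
    simpa using this
  · have : x ∈ {y | f y ≤ α} := closure_minimal (fun y hy => (hf₂ y hy).le)
      (isClosed_le f.continuous continuous_const) (hcl h₂ hx)
    simpa using this
  · simpa using hf₂ x hx

/-- Packing: the inscribed balls of different elements are disjoint, so their volumes add up to at
most that of the enclosing ball. -/
theorem ShapeRegular.card_mul_le (hK : ShapeRegular σ K) (hσ : 0 < σ) {F : Finset (Finset E3)}
    (hF : ∀ T ∈ F, T ∈ tets K) {g : ℝ} (hg : 0 < g) (hFg : ∀ T ∈ F, g ≤ hT T) {b : E3} {ρ : ℝ}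
    (hρ : 0 ≤ ρ) (hFb : ∀ T ∈ F, tet T ⊆ Metric.closedBall b ρ) :
    (F.card : ℝ) * (g / σ) ^ 3 ≤ ρ ^ 3 := by
  have hball : ∀ T ∈ F, ∃ z, Metric.ball z (g / σ) ⊆ interior (tet T) := fun T hT => by
    obtain ⟨y, r, hr, hle, hb⟩ := hK T (hF T hT)
    refine ⟨y, interior_maximal (Metric.ball_subset_closedBall.trans
      ((Metric.closedBall_subset_closedBall ?_).trans hb)) Metric.isOpen_ball⟩
    rw [div_le_iff₀ hσ]
    linarith [hFg T hT]
  choose! z hz using hball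
  have h1 : ∑ T ∈ F, volume (Metric.ball (z T) (g / σ)) ≤ volume (Metric.closedBall b ρ) := by
    rw [← measure_biUnion_finset]
    · refine measure_mono (iUnion₂_subset fun T hT => ?_)
      exact (hz T hT).trans (interior_subset.trans (hFb T hT))
    · intro T₁ h₁ T₂ h₂ hne
      exact (disjoint_interior_tet (hF _ h₁) (hF _ h₂) hne).mono (hz _ h₁) (hz _ h₂)
    · exact fun _ _ => measurableSet_ball
  have hpos : volume (Metric.ball (0 : E3) 1) ≠ 0 := (Metric.measure_ball_pos _ _ one_pos).ne'
  have hfin : volume (Metric.ball (0 : E3) 1) ≠ ⊤ := measure_ball_lt_top.ne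
  simp only [Measure.addHaar_ball_of_pos volume _ (div_pos hg hσ), Finset.sum_const, nsmul_eq_mul,
    Measure.addHaar_closedBall volume _ hρ, finrank_euclideanSpace, Fintype.card_fin] at h1
  rw [← mul_assoc, ENNReal.mul_le_mul_iff_left hpos hfin, ← ENNReal.ofReal_natCast,
    ← ENNReal.ofReal_mul (by positivity), ENNReal.ofReal_le_ofReal_iff (by positivity)] at h1
  exact h1

/-! ### Continuous induction along paths -/

/-- The coordinates at the vertices of `S` decrease along `γ` at rate at most `A * m`, hence remain
positive up to time `l`: each new element still contains `S`. The slope bound is known only in `G`,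
and `hstep` keeps the new elements in `G`, so both facts have to be propagated together. -/
theorem exists_mem_star_of_path (hfin : K.faces.Finite) {G : Set (Finset E3)} (hG : G ⊆ tets K)
    {A : ℝ} (hA : ∀ T ∈ G, ∀ v x y, |bary T v x - bary T v y| ≤ A * ‖x - y‖)
    (hA0 : 0 ≤ A) {S : Finset E3} {γ : ℝ → E3} {l m c : ℝ}
    (hγ : ∀ r ∈ Icc 0 l, ∀ t ∈ Icc 0 l, ‖γ r - γ t‖ ≤ m * |r - t|)
    (hcov : ∀ t ∈ Icc 0 l, ∃ T ∈ tets K, γ t ∈ tet T)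
    (h0 : ∃ T ∈ G, γ 0 ∈ tet T ∧ ∀ v ∈ S, c ≤ bary T v (γ 0)) (hm : 0 ≤ m) (hc : A * (m * l) < c)
    (hstep : ∀ t ∈ Ico 0 l, ∀ T₁ ∈ G, γ t ∈ tet T₁ → ∀ T₂ ∈ tets K, S ⊆ T₂ → γ t ∈ tet T₂ →
      T₂ ∈ G) :
    ∀ t ∈ Icc 0 l, ∃ T ∈ G, γ t ∈ tet T := by
  have hcont : ContinuousOn γ (Icc 0 l) := by
    refine (LipschitzOnWith.of_dist_le_mul (K := m.toNNReal) fun r hr t ht => ?_).continuousOn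
    rw [dist_eq_norm, Real.coe_toNNReal _ hm, Real.dist_eq]
    exact hγ r hr t ht
  have hGfin : G.Finite := hfin.subset fun T hT => (hG hT).1
  have htfin : (tets K).Finite := hfin.subset fun T hT => hT.1
  let s : Set ℝ := {t | ∃ T ∈ G, γ t ∈ tet T ∧ ∀ v ∈ S, c - A * (m * t) ≤ bary T v (γ t)}
  have hs : IsClosed (s ∩ Icc 0 l) := by
    have : s ∩ Icc 0 l = ⋃ T ∈ G, (Icc 0 l ∩ γ ⁻¹' (tet T)) ∩
        ⋂ v ∈ S, {t ∈ Icc 0 l | c - A * (m * t) ≤ bary T v (γ t)} ∩ Icc 0 l := by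
      ext t
      simp only [s, mem_inter_iff, mem_ofPred_eq, mem_iUnion, mem_iInter, mem_preimage, exists_prop]
      constructor
      · rintro ⟨⟨T, hT, h1, h2⟩, ht⟩
        exact ⟨T, hT, ⟨ht, h1⟩, fun v hv => ⟨⟨ht, h2 v hv⟩, ht⟩⟩
      · rintro ⟨T, hT, ⟨ht, h1⟩, h2⟩
        exact ⟨⟨T, hT, h1, fun v hv => (h2 v hv).1.2⟩, ht⟩
    rw [this]
    refine hGfin.isClosed_biUnion fun T hT => IsClosed.inter ?_ ?_
    · exact hcont.preimage_isClosed_of_isClosed isClosed_Icc (isCompact_tet T).isClosed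
    · refine isClosed_biInter fun v hv => IsClosed.inter ?_ isClosed_Icc
      refine isClosed_Icc.isClosed_le (by fun_prop) ?_
      exact (bary T v).continuous_of_finiteDimensional.comp_continuousOn hcont
  rcases lt_or_ge l 0 with hl | hl
  · intro t ht
    exact absurd (ht.1.trans ht.2) (not_le.2 hl)
  have key : Icc 0 l ⊆ s := by
    refine hs.Icc_subset_of_forall_mem_nhdsWithin ?_ ?_
    · obtain ⟨T, hT, h1, h2⟩ := h0
      exact ⟨T, hT, h1, fun v hv => by simpa using h2 v hv⟩
    · rintro t ⟨⟨T₁, hT₁, h1, h2⟩, ht⟩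
      have hIcc : Icc 0 l ∈ nhdsWithin t (Ioi t) :=
        Filter.mem_of_superset (Ioc_mem_nhdsGT ht.2) fun r hr =>
          ⟨ht.1.trans hr.1.le, hr.2⟩
      -- Finitely many closed elements: those met just after time `t` already contain `γ t`, where
      -- their coordinates agree with those of `T₁`.
      have hne : ∀ᶠ r in nhdsWithin t (Ioi t), ∀ T ∈ tets K, γ r ∈ tet T → γ t ∈ tet T := by
        rw [Filter.eventually_all_finite htfin]
        intro T hT
        by_cases hmem : γ t ∈ tet T
        · exact Filter.Eventually.of_forall fun _ _ => hmem
        · have h3 : Filter.Tendsto γ (nhdsWithin t (Ioi t)) (nhds (γ t)) :=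
            ((hcont t ⟨ht.1, ht.2.le⟩).mono_of_mem_nhdsWithin hIcc)
          filter_upwards [h3 ((isCompact_tet T).isClosed.isOpen_compl.mem_nhds hmem)] with r hr hr'
          exact absurd hr' hr
      filter_upwards [hne, hIcc, self_mem_nhdsWithin] with r hr hrI hrt
      obtain ⟨T₂, hT₂, hrT⟩ := hcov r hrI
      have htT := hr T₂ hT₂ hrT
      have htI : t ∈ Icc 0 l := ⟨ht.1, ht.2.le⟩
      have hlow : ∀ v ∈ S, c - A * (m * t) ≤ bary T₂ v (γ t) := fun v hv => by
        rw [bary_eq_bary hT₂ (hG hT₁) v htT h1]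
        exact h2 v hv
      have hsub : S ⊆ T₂ := fun v hv => by
        refine mem_of_bary_pos hT₂ htT (lt_of_lt_of_le ?_ (hlow v hv))
        have : A * (m * t) ≤ A * (m * l) := by gcongr; exact ht.2.le
        linarith
      have hG₂ := hstep t ht T₁ hT₁ h1 T₂ hT₂ hsub htT
      refine ⟨T₂, hG₂, hrT, fun v hv => ?_⟩
      have h4 := hA T₂ hG₂ v (γ r) (γ t)
      have h5 := hγ r hrI t htI
      rw [abs_of_pos (sub_pos.2 hrt)] at h5
      have h6 : A * ‖γ r - γ t‖ ≤ A * (m * (r - t)) := by gcongr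
      have h7 := (abs_le.1 h4).1
      have h8 := hlow v hv
      nlinarith
  exact fun t ht => by
    obtain ⟨T, hT, h1, -⟩ := key ht
    exact ⟨T, hT, h1⟩

end Mesh

end TraceFEM

namespace TraceFEM

/-! ### Local structure of the surface -/

/-- Near the points of `s`, with uniform constants `ρ₀` and `M`, the set `Γ` is the zero set of a
function whose increments agree with those of `x ↦ ⟪n x₀, x⟫` up to a small relative error. -/
def UniformlyFlat (Γ : Set E3) (n : E3 → E3) (s : Set E3) (ρ₀ M : ℝ) : Prop :=
  ∀ x₀ ∈ Γ ∩ s, ‖n x₀‖ = 1 ∧ (∀ y ∈ Γ ∩ Metric.ball x₀ ρ₀, ‖n y - n x₀‖ ≤ M * ‖y - x₀‖) ∧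
    ∃ ψ : E3 → ℝ, (∀ y ∈ Metric.ball x₀ ρ₀, y ∈ Γ ↔ ψ y = 0) ∧
      ∀ ρ ≤ ρ₀, ∀ x ∈ Metric.ball x₀ ρ, ∀ y ∈ Metric.ball x₀ ρ,
        |ψ x - ψ y - inner ℝ (n x₀) (x - y)| ≤ M * ρ * ‖x - y‖

theorem UniformlyFlat.mono {Γ : Set E3} {n : E3 → E3} {s : Set E3} {ρ₀ ρ₁ M M' : ℝ}
    (h : UniformlyFlat Γ n s ρ₀ M) (hρ : ρ₁ ≤ ρ₀) (hM : M ≤ M') : UniformlyFlat Γ n s ρ₁ M' := by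
  intro x₀ hx₀
  obtain ⟨h1, h2, ψ, h3, h4⟩ := h x₀ hx₀
  have hb : Metric.ball x₀ ρ₁ ⊆ Metric.ball x₀ ρ₀ := Metric.ball_subset_ball hρ
  refine ⟨h1, fun y hy => (h2 y ⟨hy.1, hb hy.2⟩).trans (by gcongr), ψ, fun y hy => h3 y (hb hy),
    fun ρ hρ' x hx y hy => (h4 ρ (hρ'.trans hρ) x hx y hy).trans ?_⟩
  have : 0 ≤ ρ := (Metric.pos_of_mem_ball hx).le
  gcongr

theorem norm_normalize_sub_le {a b : E3} (ha : a ≠ 0) (hb : b ≠ 0) :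
    ‖‖a‖⁻¹ • a - ‖b‖⁻¹ • b‖ ≤ 2 * ‖b‖⁻¹ * ‖a - b‖ := by
  have ha' := norm_pos_iff.2 ha
  have hb' := norm_pos_iff.2 hb
  have h1 : ‖a‖⁻¹ • a - ‖b‖⁻¹ • b = ‖b‖⁻¹ • (a - b) + (‖a‖⁻¹ - ‖b‖⁻¹) • a := by module
  rw [h1]
  refine (norm_add_le _ _).trans ?_
  rw [norm_smul, norm_smul, norm_inv, norm_norm]
  have h2 : ‖‖a‖⁻¹ - ‖b‖⁻¹‖ * ‖a‖ = ‖b‖⁻¹ * |‖b‖ - ‖a‖| := by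
    rw [Real.norm_eq_abs, inv_sub_inv ha'.ne' hb'.ne', abs_div, abs_of_pos (mul_pos ha' hb')]
    field_simp
  rw [h2]
  have h3 : |‖b‖ - ‖a‖| ≤ ‖a - b‖ := by
    rw [norm_sub_rev]
    exact abs_norm_sub_norm_le b a
  have : ‖b‖⁻¹ * |‖b‖ - ‖a‖| ≤ ‖b‖⁻¹ * ‖a - b‖ := by gcongr
  linarith

theorem gradient_sub_norm (φ : E3 → ℝ) (x y : E3) :
    ‖gradient φ x - gradient φ y‖ = ‖fderiv ℝ φ x - fderiv ℝ φ y‖ := by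
  rw [gradient, gradient, ← map_sub, LinearIsometryEquiv.norm_map]

theorem inner_gradient_left (φ : E3 → ℝ) (x v : E3) : inner ℝ (gradient φ x) v = fderiv ℝ φ x v := by
  simp [gradient]

/-- The derivative of a `C²` level set function is Lipschitz near `x` and its gradient is bounded
below there. Dividing by the gradient norm at `x₀` gives the required function, by the mean value
inequality on a ball. -/
theorem IsClosedSurface.exists_uniformlyFlat_nhds {Γ : Set E3} {n : E3 → E3}
    (h : IsClosedSurface Γ n) {x : E3} (hx : x ∈ Γ) :
    ∃ s ∈ nhds x, ∃ ρ₀ M : ℝ, 0 < ρ₀ ∧ 0 < M ∧ UniformlyFlat Γ n s ρ₀ M := by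
  obtain ⟨U, φ, hU, hxU, hφ, hne, hΓ, hn⟩ := h.exists_levelSet x hx
  have hφx : ContDiffAt ℝ 2 φ x := hφ.contDiffAt (hU.mem_nhds hxU)
  have hfd : ContDiffAt ℝ 1 (fderiv ℝ φ) x := hφx.fderiv_right (by norm_num)
  obtain ⟨L, t, ht, hL⟩ := hfd.exists_lipschitzOnWith
  have hgx : 0 < ‖gradient φ x‖ := norm_pos_iff.2 (hne x hxU)
  have hgcont : ContinuousAt (fun y => ‖gradient φ y‖) x := by
    have : ContinuousAt (gradient φ) x :=
      ((InnerProductSpace.toDual ℝ E3).symm.continuous.continuousAt).comp hfd.continuousAt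
    exact this.norm
  have hlow : ∀ᶠ y in nhds x, ‖gradient φ x‖ / 2 < ‖gradient φ y‖ :=
    hgcont.eventually (lt_mem_nhds (half_lt_self hgx))
  set m := ‖gradient φ x‖ / 2 with hm
  have hm0 : 0 < m := by positivity
  obtain ⟨r, hr, hball⟩ := Metric.mem_nhds_iff.1
    (Filter.inter_mem (Filter.inter_mem (hU.mem_nhds hxU) ht) hlow)
  have hsub : ∀ x₀ ∈ Metric.ball x (r / 2), Metric.ball x₀ (r / 2) ⊆ Metric.ball x r :=
    fun x₀ hx₀ => Metric.ball_subset_ball' (by rw [Metric.mem_ball] at hx₀; linarith)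
  refine ⟨Metric.ball x (r / 2), Metric.ball_mem_nhds _ (half_pos hr), r / 2,
    2 * m⁻¹ * (L + 1), half_pos hr, by positivity, ?_⟩
  rintro x₀ ⟨hx₀Γ, hx₀⟩
  have hx₀r : x₀ ∈ Metric.ball x r := hsub x₀ hx₀ (Metric.mem_ball_self (half_pos hr))
  have hg₀ : m < ‖gradient φ x₀‖ := (hball hx₀r).2
  have hg₀' : 0 < ‖gradient φ x₀‖ := hm0.trans hg₀
  have hinv : ‖gradient φ x₀‖⁻¹ ≤ m⁻¹ := inv_anti₀ hm0 hg₀.le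
  have hlip : ∀ y ∈ Metric.ball x r, ∀ z ∈ Metric.ball x r,
      ‖fderiv ℝ φ y - fderiv ℝ φ z‖ ≤ L * ‖y - z‖ := fun y hy z hz => by
    have := hL.dist_le_mul y (hball hy).1.2 z (hball hz).1.2
    rwa [dist_eq_norm, dist_eq_norm] at this
  have hn₀ : n x₀ = ‖gradient φ x₀‖⁻¹ • gradient φ x₀ := hn x₀ ⟨hx₀Γ, (hball hx₀r).1.1⟩
  refine ⟨?_, ?_, fun y => ‖gradient φ x₀‖⁻¹ * φ y, ?_, ?_⟩
  · rw [hn₀, norm_smul, norm_inv, norm_norm, inv_mul_cancel₀ hg₀'.ne']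
  · rintro y ⟨hyΓ, hy⟩
    have hyr := hsub x₀ hx₀ hy
    rw [hn y ⟨hyΓ, (hball hyr).1.1⟩, hn₀]
    refine (norm_normalize_sub_le (norm_pos_iff.1 (hm0.trans (hball hyr).2))
      (norm_pos_iff.1 hg₀')).trans ?_
    rw [gradient_sub_norm]
    calc 2 * ‖gradient φ x₀‖⁻¹ * ‖fderiv ℝ φ y - fderiv ℝ φ x₀‖
        ≤ 2 * m⁻¹ * (L * ‖y - x₀‖) := by
          gcongr
          exact hlip y hyr x₀ hx₀r
      _ ≤ 2 * m⁻¹ * ((L + 1) * ‖y - x₀‖) := by gcongr; linarith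
      _ = _ := by ring
  · intro y hy
    have hyU := (hball (hsub x₀ hx₀ hy)).1.1
    have : y ∈ Γ ∩ U ↔ y ∈ {y ∈ U | φ y = 0} := by rw [hΓ]
    simp only [mem_inter_iff, hyU, and_true, mem_ofPred_eq, true_and] at this
    rw [this, mul_eq_zero_iff_left (inv_ne_zero hg₀'.ne')]
  · intro ρ hρ y hy z hz
    have hρ0 := Metric.pos_of_mem_ball hy
    have hsub' : Metric.ball x₀ ρ ⊆ Metric.ball x r :=
      (Metric.ball_subset_ball hρ).trans (hsub x₀ hx₀)
    have hmv := (convex_ball x₀ ρ).norm_image_sub_le_of_norm_fderiv_le' (𝕜 := ℝ) (f := φ)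
      (φ := fderiv ℝ φ x₀) (C := L * ρ) (fun w hw =>
        (hφ.contDiffAt (hU.mem_nhds (hball (hsub' hw)).1.1)).differentiableAt (by norm_num))
      (fun w hw => (hlip w (hsub' hw) x₀ hx₀r).trans (by
        have := (mem_ball_iff_norm.1 hw).le
        gcongr)) hz hy
    have h1 : ‖gradient φ x₀‖⁻¹ * φ y - ‖gradient φ x₀‖⁻¹ * φ z - inner ℝ (n x₀) (y - z)
        = ‖gradient φ x₀‖⁻¹ * (φ y - φ z - fderiv ℝ φ x₀ (y - z)) := by
      rw [hn₀, real_inner_smul_left, inner_gradient_left]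
      ring
    rw [h1, abs_mul, abs_of_pos (inv_pos.2 hg₀')]
    rw [Real.norm_eq_abs] at hmv
    calc ‖gradient φ x₀‖⁻¹ * |φ y - φ z - fderiv ℝ φ x₀ (y - z)|
        ≤ m⁻¹ * (L * ρ * ‖y - z‖) := by gcongr
      _ ≤ 2 * m⁻¹ * ((L + 1) * ρ * ‖y - z‖) := by
          gcongr
          · have := inv_pos.2 hm0
            linarith
          · linarith
      _ = _ := by ring

theorem IsClosedSurface.exists_uniformlyFlat {Γ : Set E3} {n : E3 → E3}
    (h : IsClosedSurface Γ n) :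
    ∃ ρ₀ M : ℝ, 0 < ρ₀ ∧ 0 < M ∧ UniformlyFlat Γ n univ ρ₀ M := by
  have key : ∃ ρ₀ M : ℝ, 0 < ρ₀ ∧ 0 < M ∧ UniformlyFlat Γ n Γ ρ₀ M := by
    refine h.isCompact.induction_on
      (p := fun s => ∃ ρ₀ M : ℝ, 0 < ρ₀ ∧ 0 < M ∧ UniformlyFlat Γ n s ρ₀ M) ?_ ?_ ?_ ?_
    · exact ⟨1, 1, one_pos, one_pos, fun x hx => absurd hx.2 (notMem_empty x)⟩
    · rintro s t hst ⟨ρ, M, hρ, hM, hf⟩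
      exact ⟨ρ, M, hρ, hM, fun x hx => hf x ⟨hx.1, hst hx.2⟩⟩
    · rintro s t ⟨ρ, M, hρ, hM, hf⟩ ⟨ρ', M', hρ', hM', hf'⟩
      refine ⟨min ρ ρ', max M M', lt_min hρ hρ', lt_max_of_lt_left hM, ?_⟩
      rintro x ⟨hx, hx' | hx'⟩
      · exact hf.mono (min_le_left _ _) (le_max_left _ _) x ⟨hx, hx'⟩
      · exact hf'.mono (min_le_right _ _) (le_max_right _ _) x ⟨hx, hx'⟩
    · intro x hx
      obtain ⟨s, hs, h1⟩ := h.exists_uniformlyFlat_nhds hx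
      exact ⟨s, nhdsWithin_le_nhds hs, h1⟩
  obtain ⟨ρ, M, hρ, hM, hf⟩ := key
  exact ⟨ρ, M, hρ, hM, fun x hx => hf x ⟨hx.1, hx.1⟩⟩

end TraceFEM

namespace TraceFEM

/-! ### A surface that is almost flat at the scale of the mesh -/

/-- Around the point `x₀`, at the scale `h` of the elements of `K`, the set `Γ` is the zero set of
`ψ`, whose increments are those of `x ↦ ⟪n₀, x⟫` up to the relative error `τ`. -/
structure FlatSetting (σ κ τ h : ℝ) (K : Mesh) (Γ : Set E3) (x₀ n₀ : E3) (ψ : E3 → ℝ) : Prop where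
  two_le_σ : 2 ≤ σ
  one_le_κ : 1 ≤ κ
  h_pos : 0 < h
  τ_nonneg : 0 ≤ τ
  τ_le : τ ≤ 1 / 2
  finite : K.faces.Finite
  shape : ShapeRegular σ K
  le_hT : ∀ T ∈ cutTets Γ K, h ≤ κ * hT T
  hT_le : ∀ T ∈ cutTets Γ K, hT T ≤ h
  covers : Metric.ball x₀ (4 * h) ⊆ ⋃ T ∈ tets K, tet T
  normal : ‖n₀‖ = 1
  mem_iff : ∀ y ∈ Metric.ball x₀ (4 * h), y ∈ Γ ↔ ψ y = 0
  flat : ∀ x ∈ Metric.ball x₀ (4 * h), ∀ y ∈ Metric.ball x₀ (4 * h),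
    |ψ x - ψ y - inner ℝ n₀ (x - y)| ≤ τ * ‖x - y‖

namespace FlatSetting

variable {σ κ τ h : ℝ} {K : Mesh} {Γ : Set E3} {x₀ n₀ : E3} {ψ : E3 → ℝ}

/-- Reversing the orientation exchanges the two sides of `Γ`, so only elements that barely reach
below `Γ` need a construction. -/
theorem neg (H : FlatSetting σ κ τ h K Γ x₀ n₀ ψ) :
    FlatSetting σ κ τ h K Γ x₀ (-n₀) (fun x => -ψ x) where
  __ := H
  normal := by rw [norm_neg, H.normal]
  mem_iff y hy := by rw [H.mem_iff y hy, neg_eq_zero]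
  flat x hx y hy := by
    have h1 := H.flat x hx y hy
    have h2 : -ψ x - -ψ y - inner ℝ (-n₀) (x - y) = -(ψ x - ψ y - inner ℝ n₀ (x - y)) := by
      rw [inner_neg_left]
      ring
    rwa [h2, abs_neg]

theorem inner_self (H : FlatSetting σ κ τ h K Γ x₀ n₀ ψ) : inner ℝ n₀ n₀ = (1 : ℝ) := by
  rw [real_inner_self_eq_norm_sq, H.normal, one_pow]

theorem abs_inner_le (H : FlatSetting σ κ τ h K Γ x₀ n₀ ψ) (x : E3) : |inner ℝ n₀ x| ≤ ‖x‖ := by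
  simpa [H.normal] using abs_real_inner_le_norm n₀ x

theorem sub_le (H : FlatSetting σ κ τ h K Γ x₀ n₀ ψ) {x y : E3}
    (hx : x ∈ Metric.ball x₀ (4 * h)) (hy : y ∈ Metric.ball x₀ (4 * h)) :
    ψ x - ψ y ≤ inner ℝ n₀ (x - y) + τ * ‖x - y‖ := by
  linarith [(abs_le.1 (H.flat x hx y hy)).2]

theorem abs_sub_le (H : FlatSetting σ κ τ h K Γ x₀ n₀ ψ) {x y : E3}
    (hx : x ∈ Metric.ball x₀ (4 * h)) (hy : y ∈ Metric.ball x₀ (4 * h)) :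
    |ψ x - ψ y| ≤ 3 / 2 * ‖x - y‖ := by
  have h1 := abs_le.1 (H.flat x hx y hy)
  have h2 := abs_le.1 (H.abs_inner_le (x - y))
  have h3 : τ * ‖x - y‖ ≤ 1 / 2 * ‖x - y‖ := mul_le_mul_of_nonneg_right H.τ_le (norm_nonneg _)
  rw [abs_le]
  constructor <;> linarith [h1.1, h1.2, h2.1, h2.2]

theorem le_sub_of_vertical (H : FlatSetting σ κ τ h K Γ x₀ n₀ ψ) {x : E3} {t : ℝ} (ht : 0 ≤ t)
    (hx : x ∈ Metric.ball x₀ (4 * h)) (hy : x + t • n₀ ∈ Metric.ball x₀ (4 * h)) :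
    t / 2 ≤ ψ (x + t • n₀) - ψ x := by
  have h1 := abs_le.1 (H.flat _ hy x hx)
  rw [add_sub_cancel_left, real_inner_smul_right, H.inner_self, norm_smul, H.normal,
    Real.norm_of_nonneg ht] at h1
  have h3 : τ * t ≤ 1 / 2 * t := mul_le_mul_of_nonneg_right H.τ_le ht
  linarith [h1.1]

theorem continuousOn (H : FlatSetting σ κ τ h K Γ x₀ n₀ ψ) :
    ContinuousOn ψ (Metric.ball x₀ (4 * h)) := by
  refine (LipschitzOnWith.of_dist_le_mul (K := 2) fun x hx y hy => ?_).continuousOn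
  rw [dist_eq_norm, dist_eq_norm, Real.norm_eq_abs]
  refine (H.abs_sub_le hx hy).trans ?_
  gcongr
  norm_num

theorem exists_mem_segment (H : FlatSetting σ κ τ h K Γ x₀ n₀ ψ) {x y : E3}
    (hx : x ∈ Metric.ball x₀ (4 * h)) (hy : y ∈ Metric.ball x₀ (4 * h)) (hψx : ψ x ≤ 0)
    (hψy : 0 ≤ ψ y) : ∃ t ∈ Icc (0 : ℝ) 1, x + t • (y - x) ∈ Γ ∧ ψ (x + t • (y - x)) = 0 := by
  have hmem : ∀ t ∈ Icc (0 : ℝ) 1, x + t • (y - x) ∈ Metric.ball x₀ (4 * h) := fun t ht =>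
    (convex_ball x₀ (4 * h)).add_smul_sub_mem hx hy ht
  have hc : ContinuousOn (fun t : ℝ => ψ (x + t • (y - x))) (Icc 0 1) :=
    H.continuousOn.comp (by fun_prop) hmem
  have := intermediate_value_Icc zero_le_one hc
  obtain ⟨t, ht, h0⟩ := this (show (0 : ℝ) ∈ Icc _ _ from ⟨by simpa using hψx, by simpa using hψy⟩)
  exact ⟨t, ht, (H.mem_iff _ (hmem t ht)).2 h0, h0⟩

theorem mem_cutTets (H : FlatSetting σ κ τ h K Γ x₀ n₀ ψ) {T : Finset E3} (hT : T ∈ tets K)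
    {x y : E3} (hxT : x ∈ tet T) (hyT : y ∈ tet T)
    (hx : x ∈ Metric.ball x₀ (4 * h)) (hy : y ∈ Metric.ball x₀ (4 * h)) (hψx : ψ x ≤ 0)
    (hψy : 0 ≤ ψ y) : T ∈ cutTets Γ K := by
  obtain ⟨t, ht, h1, -⟩ := H.exists_mem_segment hx hy hψx hψy
  exact ⟨hT, _, (convex_tet T).add_smul_sub_mem hxT hyT ht, h1⟩

theorem mem_ball (H : FlatSetting σ κ τ h K Γ x₀ n₀ ψ) {T : Finset E3} (hT : T ∈ cutTets Γ K)
    (hx₀ : x₀ ∈ tet T) {x : E3} (hx : x ∈ tet T) : ‖x - x₀‖ ≤ h :=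
  (norm_sub_le_hT hx hx₀).trans (H.hT_le T hT)

/-- `T` contains a ball on each side of `Γ`. Every segment between corresponding points of the two
balls crosses `Γ` inside `T`, so the projection along the line of centers covers a disc. -/
theorem le_area_of_two_sides (H : FlatSetting σ κ τ h K Γ x₀ n₀ ψ) {T : Finset E3}
    (hTc : T ∈ cutTets Γ K) (hx₀ : x₀ ∈ tet T) {ε : ℝ} (hε : 0 < ε) (hεκ : κ * ε ≤ 1) {u₁ u₂ : E3}
    (hu₁ : u₁ ∈ tet T) (hu₂ : u₂ ∈ tet T) (h₁ : ψ u₁ < -(ε * h)) (h₂ : ε * h < ψ u₂) :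
    ENNReal.ofReal ((ε * h / 4 / σ) ^ 2) ≤ area (tet T ∩ Γ) := by
  have hσ : 0 < σ := by linarith [H.two_le_σ]
  have hh := H.h_pos
  have hκ := H.one_le_κ
  have hball : ∀ x ∈ tet T, x ∈ Metric.ball x₀ (4 * h) := fun x hx => by
    rw [mem_ball_iff_norm]
    linarith [H.mem_ball hTc hx₀ hx]
  -- Both balls lie within `2 * t` of `u₁` and `u₂`; as `ψ` has Lipschitz constant `3 / 2`, it
  -- changes there by at most `3 * ε * h / 4` and keeps its sign.
  set t := ε * h / 4 with ht
  have ht0 : 0 < t := by positivity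
  have htT : t ≤ hT T := by
    have h1 := H.le_hT T hTc
    have h2 : κ * t ≤ κ * hT T := by
      have : κ * t = κ * ε * (h / 4) := by rw [ht]; ring
      nlinarith
    exact le_of_mul_le_mul_left h2 (by linarith)
  obtain ⟨w₁, hw₁, hb₁⟩ := H.shape.exists_closedBall hσ hTc.1 hu₁ ht0 htT
  obtain ⟨w₂, hw₂, hb₂⟩ := H.shape.exists_closedBall hσ hTc.1 hu₂ ht0 htT
  have htσ : t / σ ≤ t := div_le_self ht0.le (by linarith [H.two_le_σ])
  have htσ0 : 0 < t / σ := by positivity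
  have hdist : ∀ {w u y : E3}, ‖w - u‖ ≤ t → y ∈ Metric.closedBall w (t / σ) → ‖y - u‖ ≤ 2 * t := by
    intro w u y hwu hy
    rw [mem_closedBall_iff_norm] at hy
    calc ‖y - u‖ = ‖(y - w) + (w - u)‖ := by congr 1; abel
      _ ≤ 2 * t := by linarith [norm_add_le (y - w) (w - u)]
  have hneg : ∀ y ∈ Metric.closedBall w₁ (t / σ), ψ y < 0 := fun y hy => by
    have := abs_le.1 (H.abs_sub_le (hball y (hb₁ hy)) (hball u₁ hu₁))
    have h3 := hdist hw₁ hy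
    linarith [this.2]
  have hpos : ∀ y ∈ Metric.closedBall w₂ (t / σ), 0 < ψ y := fun y hy => by
    have := abs_le.1 (H.abs_sub_le (hball y (hb₂ hy)) (hball u₂ hu₂))
    have h3 := hdist hw₂ hy
    linarith [this.1]
  have hne : w₂ - w₁ ≠ 0 := by
    intro h0
    have h3 := hneg w₁ (Metric.mem_closedBall_self htσ0.le)
    have h4 := hpos w₂ (Metric.mem_closedBall_self htσ0.le)
    rw [sub_eq_zero.1 h0] at h4
    linarith
  have hd : 0 < ‖w₂ - w₁‖ := norm_pos_iff.2 hne
  refine area_mono_of_projection (n₀ := ‖w₂ - w₁‖⁻¹ • (w₂ - w₁)) (z := w₁) ?_ htσ0.le ?_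
  · rw [norm_smul, norm_inv, norm_norm, inv_mul_cancel₀ hd.ne']
  · intro u _ hu
    have hm₁ : w₁ + u ∈ Metric.closedBall w₁ (t / σ) := by simpa using hu
    have hm₂ : w₂ + u ∈ Metric.closedBall w₂ (t / σ) := by simpa using hu
    obtain ⟨c, hc, hcΓ, -⟩ := H.exists_mem_segment (hball _ (hb₁ hm₁)) (hball _ (hb₂ hm₂))
      (hneg _ hm₁).le (hpos _ hm₂).le
    refine ⟨c * ‖w₂ - w₁‖, ?_⟩
    have : w₁ + u + (c * ‖w₂ - w₁‖) • ‖w₂ - w₁‖⁻¹ • (w₂ - w₁) =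
        w₁ + u + c • (w₂ + u - (w₁ + u)) := by
      rw [smul_smul, mul_assoc, mul_inv_cancel₀ hd.ne', mul_one, add_sub_add_right_eq_sub]
    rw [this]
    exact ⟨(convex_tet T).add_smul_sub_mem (hb₁ hm₁) (hb₂ hm₂) hc, hcΓ⟩

end FlatSetting

/-- `S` collects the vertices with positive weight at `x`. From `x` one can move a little away from
each of them inside `T`, so a minimum at `x` can be tested in both directions. -/
theorem exists_carrier {T : Finset E3} {x : E3} (hx : x ∈ tet T) :
    ∃ S ⊆ T, S.Nonempty ∧ x ∈ tet S ∧ ∀ v ∈ S, ∃ c : ℝ, 0 < c ∧ x - c • (v - x) ∈ tet T := by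
  classical
  obtain ⟨w, hw0, hw1, hwx⟩ := Finset.mem_convexHull'.1 hx
  refine ⟨T.filter fun v => 0 < w v, Finset.filter_subset _ _, ?_, ?_, ?_⟩
  · by_contra h
    rw [Finset.not_nonempty_iff_eq_empty, Finset.filter_eq_empty_iff] at h
    have : ∑ y ∈ T, w y ≤ 0 := Finset.sum_nonpos fun y hy => not_lt.1 (h hy)
    linarith
  · refine Finset.mem_convexHull'.2 ⟨w, fun y hy => hw0 y (Finset.mem_filter.1 hy).1, ?_, ?_⟩
    · rw [← hw1, Finset.sum_filter_of_ne]
      exact fun y hy hne => lt_of_le_of_ne (hw0 y hy) hne.symm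
    · rw [← hwx, Finset.sum_filter_of_ne]
      exact fun y hy hne => lt_of_le_of_ne (hw0 y hy) (fun h => hne (by rw [← h, zero_smul]))
  · intro v hv
    obtain ⟨hvT, hv0⟩ := Finset.mem_filter.1 hv
    refine ⟨w v, hv0, Finset.mem_convexHull'.2
      ⟨fun y => (1 + w v) * w y - if y = v then w v else 0, fun y hy => ?_, ?_, ?_⟩⟩
    · dsimp only
      split_ifs with h
      · rw [h]; nlinarith
      · have := hw0 y hy
        nlinarith
    · rw [Finset.sum_sub_distrib, ← Finset.mul_sum, hw1, Finset.sum_ite_eq' T v, if_pos hvT]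
      ring
    · simp only [sub_smul, Finset.sum_sub_distrib, mul_smul, ← Finset.smul_sum, hwx, ite_smul,
        zero_smul, Finset.sum_ite_eq' T v, if_pos hvT]
      module

end TraceFEM

/-! ### Vertical columns over an element that the surface cuts only marginally. -/

namespace TraceFEM

theorem exists_orthonormal_complement {n₀ : E3} (hn : ‖n₀‖ = 1) :
    ∃ e₁ e₂ : E3, inner ℝ n₀ e₁ = (0 : ℝ) ∧ inner ℝ n₀ e₂ = (0 : ℝ) ∧ ‖e₁‖ = 1 ∧ ‖e₂‖ = 1 ∧
      (∀ u : E3, inner ℝ n₀ u = (0 : ℝ) → u = inner ℝ e₁ u • e₁ + inner ℝ e₂ u • e₂) ∧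
      inner ℝ e₁ e₂ = (0 : ℝ) := by
  have hn0 : n₀ ≠ 0 := by
    intro h
    simp [h] at hn
  have : Fact (Module.finrank ℝ E3 = 2 + 1) := ⟨by simp⟩
  let B := OrthonormalBasis.fromOrthogonalSpanSingleton (𝕜 := ℝ) 2 hn0
  refine ⟨B 0, B 1, Submodule.mem_orthogonal_singleton_iff_inner_right.1 (B 0).2,
    Submodule.mem_orthogonal_singleton_iff_inner_right.1 (B 1).2, B.norm_eq_one 0, B.norm_eq_one 1,
    fun u hu => ?_, B.inner_eq_zero (by decide)⟩
  have := B.sum_repr' ⟨u, Submodule.mem_orthogonal_singleton_iff_inner_right.2 hu⟩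
  rw [Fin.sum_univ_two] at this
  exact (congrArg Subtype.val this).symm

/-- A vertical column whose top lies in the element `T` that `Γ` cuts only marginally; `S` is the face
of `T` that is lowest with respect to `Γ`. -/
structure Column (σ κ τ h s : ℝ) (K : Mesh) (Γ : Set E3) (x₀ n₀ : E3) (ψ : E3 → ℝ)
    (T S : Finset E3) (z xs : E3) : Prop extends FlatSetting σ κ τ h K Γ x₀ n₀ ψ where
  s_eq : 100 * (σ * κ) * s = 1
  mem_cut : T ∈ cutTets Γ K
  x₀_mem : x₀ ∈ tet T
  S_sub : S ⊆ T
  S_nonempty : S.Nonempty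
  xs_mem : xs ∈ tet S
  ψ_xs : ψ xs ≤ 0
  ψ_barycenter : ψ (barycenter S) ≤ s * h
  z_near : ‖z - barycenter S‖ ≤ 2 * s * h
  ball_sub : Metric.closedBall z (s * h / (2 * σ)) ⊆ tet T
  ψ_top : ∀ u : E3, inner ℝ n₀ u = (0 : ℝ) → ‖u‖ ≤ s * h / (4 * σ) → s * h / (16 * σ) ≤ ψ (z + u)
  avoid : ∀ u : E3, inner ℝ n₀ u = (0 : ℝ) → ‖u‖ ≤ s * h / (4 * σ) → ∀ t : ℝ,
    z + u - t • n₀ ≠ barycenter S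

section

variable {σ κ τ h s : ℝ} {K : Mesh} {Γ : Set E3} {x₀ n₀ : E3} {ψ : E3 → ℝ}

/-- `S` is the carrier of the minimum point `xs` of `ψ` on `T`. Minimality in both directions makes
`S` almost horizontal, so its barycenter is almost as low as `xs`; the column is placed in a ball of
`T` near this barycenter. -/
theorem FlatSetting.exists_column (H : FlatSetting σ κ τ h K Γ x₀ n₀ ψ)
    (hs : 100 * (σ * κ) * s = 1) (hτ : 2 * τ ≤ s) {T : Finset E3} (hTc : T ∈ cutTets Γ K)
    (hx₀ : x₀ ∈ tet T) (hx₀Γ : x₀ ∈ Γ) (hlow : ∀ x ∈ tet T, -(s / (16 * σ) * h) ≤ ψ x) :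
    ∃ S z xs, Column σ κ τ h s K Γ x₀ n₀ ψ T S z xs := by
  have hσ2 := H.two_le_σ
  have hκ := H.one_le_κ
  have hh := H.h_pos
  have hσ : 0 < σ := by linarith
  have hσκ : 2 ≤ σ * κ := by nlinarith
  have hs0 : 0 < s := by
    by_contra hneg
    nlinarith [mul_nonneg (by linarith : (0 : ℝ) ≤ σ * κ) (by linarith : 0 ≤ -s)]
  have hsκ : κ * s ≤ 1 := by nlinarith [mul_pos (by linarith : 0 < κ) hs0]
  have hball : ∀ x ∈ tet T, x ∈ Metric.ball x₀ (4 * h) := fun x hx => by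
    rw [mem_ball_iff_norm]
    linarith [H.mem_ball hTc hx₀ hx]
  obtain ⟨xs, hxsT, hmin⟩ := (isCompact_tet T).exists_isMinOn ⟨x₀, hx₀⟩
    (H.continuousOn.mono fun x hx => hball x hx)
  have hψxs : ψ xs ≤ 0 := by
    have h1 : ψ xs ≤ ψ x₀ := hmin hx₀
    rwa [(H.mem_iff x₀ (hball _ hx₀)).1 hx₀Γ] at h1
  obtain ⟨S, hST, hS, hxsS, hcar⟩ := exists_carrier hxsT
  -- The lower bound comes from moving towards `v`, the upper one from moving away from it.
  have hdir : ∀ v ∈ S, |inner ℝ n₀ (v - xs)| ≤ τ * h := by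
    intro v hv
    have hvT : v ∈ tet T := subset_tet T (hST hv)
    have h0 : ‖v - xs‖ ≤ h := (norm_sub_le_hT hvT hxsT).trans (H.hT_le T hTc)
    have h0' : τ * ‖v - xs‖ ≤ τ * h := mul_le_mul_of_nonneg_left h0 H.τ_nonneg
    have h1 := H.sub_le (hball v hvT) (hball xs hxsT)
    have h2 : ψ xs ≤ ψ v := hmin hvT
    obtain ⟨c, hc, hcT⟩ := hcar v hv
    have h3 := H.sub_le (hball _ hcT) (hball xs hxsT)
    have h4 : ψ xs ≤ ψ (xs - c • (v - xs)) := hmin hcT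
    rw [show xs - c • (v - xs) - xs = (-c) • (v - xs) by module, real_inner_smul_right, norm_smul,
      norm_neg, Real.norm_of_nonneg hc.le] at h3
    have h5 : inner ℝ n₀ (v - xs) ≤ τ * ‖v - xs‖ := by
      refine le_of_mul_le_mul_left ?_ hc
      nlinarith
    rw [abs_le]
    constructor <;> linarith
  set b := barycenter S with hb
  have hbT : b ∈ tet T := tet_mono hST (barycenter_mem hS)
  have hdirb : |inner ℝ n₀ (b - xs)| ≤ τ * h := by
    have hconv : Convex ℝ {x : E3 | |inner ℝ n₀ (x - xs)| ≤ τ * h} := by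
      have : {x : E3 | |inner ℝ n₀ (x - xs)| ≤ τ * h} =
          (innerSL ℝ n₀) ⁻¹' Metric.closedBall (inner ℝ n₀ xs) (τ * h) := by
        ext x
        simp [Real.dist_eq, inner_sub_right]
      rw [this]
      exact (convex_closedBall _ _).linear_preimage (innerSL ℝ n₀).toLinearMap
    exact convexHull_min hdir hconv (barycenter_mem hS)
  have hψb : ψ b ≤ s * h := by
    have h1 := H.sub_le (hball b hbT) (hball xs hxsT)
    have h2 : ‖b - xs‖ ≤ h := (norm_sub_le_hT hbT hxsT).trans (H.hT_le T hTc)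
    have h3 : τ * ‖b - xs‖ ≤ τ * h := mul_le_mul_of_nonneg_left h2 H.τ_nonneg
    have h4 := (abs_le.1 hdirb).2
    nlinarith
  have hsh : 0 < s * h := by positivity
  have hshT : s * h ≤ hT T := by
    have h1 := H.le_hT T hTc
    refine le_of_mul_le_mul_left (a := κ) ?_ (by linarith)
    nlinarith
  -- With `R = s * h / (4 * σ)` this ball has radius `4 * R`. Its center is now shifted horizontally
  -- by `2 * R`, away from `b`: a ball of radius `2 * R` remains in `T`, and a column of radius `R`
  -- about the new center misses `b`.
  obtain ⟨z₀, hz₀, hz₀b⟩ := H.shape.exists_closedBall hσ hTc.1 hbT hsh hshT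
  obtain ⟨e, he1, he0, hpos⟩ : ∃ e : E3, ‖e‖ = 1 ∧ inner ℝ n₀ e = (0 : ℝ) ∧
      (0 : ℝ) ≤ inner ℝ e (z₀ - b) := by
    obtain ⟨e, -, h1, -, h2, -⟩ := exists_orthonormal_complement H.normal
    rcases le_total 0 (inner ℝ e (z₀ - b)) with hle | hle
    · exact ⟨e, h2, h1, hle⟩
    · refine ⟨-e, by rwa [norm_neg], by rw [inner_neg_right, h1, neg_zero], ?_⟩
      rw [inner_neg_left]
      linarith
  set R := s * h / (4 * σ) with hR
  have hR0 : 0 < R := by positivity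
  have hR1 : s * h / (2 * σ) = 2 * R := by rw [hR]; field_simp; norm_num
  have hR2 : s * h / σ = 4 * R := by rw [hR]; field_simp
  have hR3 : s * h / (16 * σ) = R / 4 := by rw [hR]; field_simp; norm_num
  have hR4 : s / (16 * σ) * h = R / 4 := by rw [hR]; field_simp; norm_num
  have hR5 : 8 * R ≤ s * h := by
    rw [hR, ← mul_div_assoc, div_le_iff₀ (by positivity)]
    nlinarith
  set z := z₀ + (2 * R) • e with hz
  have hzb : Metric.closedBall z (2 * R) ⊆ tet T := by
    refine Subset.trans (Metric.closedBall_subset_closedBall' ?_) hz₀b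
    rw [hR2, hz, dist_eq_norm, add_sub_cancel_left, norm_smul, he1,
      Real.norm_of_nonneg (by positivity)]
    linarith
  refine ⟨S, z, xs, { H with
    s_eq := hs
    mem_cut := hTc
    x₀_mem := hx₀
    S_sub := hST
    S_nonempty := hS
    xs_mem := hxsS
    ψ_xs := hψxs
    ψ_barycenter := hψb
    z_near := ?_
    ball_sub := by rw [hR1]; exact hzb
    ψ_top := ?_
    avoid := ?_ }⟩
  · have h1 : z - b = (z₀ - b) + (2 * R) • e := by rw [hz]; abel
    rw [h1]
    refine (norm_add_le _ _).trans ?_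
    rw [norm_smul, he1, Real.norm_of_nonneg (by positivity)]
    linarith
  · intro u hu hun
    rw [hR3]
    -- The point at depth `R` is in `T`, so `ψ` is at least `- R / 4` there; rising by `R` gains at
    -- least `R / 2`.
    have hmem : z + u - R • n₀ ∈ tet T := by
      apply hzb
      rw [mem_closedBall_iff_norm, show z + u - R • n₀ - z = u - R • n₀ by abel]
      refine (norm_sub_le _ _).trans ?_
      rw [norm_smul, H.normal, Real.norm_of_nonneg hR0.le]
      linarith
    have hmem' : z + u ∈ tet T := hzb (by
      rw [mem_closedBall_iff_norm, add_sub_cancel_left]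
      linarith)
    have h1 := H.le_sub_of_vertical hR0.le (hball _ hmem) (by
      rw [sub_add_cancel]
      exact hball _ hmem')
    rw [sub_add_cancel] at h1
    have h2 := hlow _ hmem
    rw [hR4] at h2
    linarith
  · intro u hu hun t heq
    have h1 : inner ℝ e (z + u - t • n₀ - b) = (0 : ℝ) := by rw [heq, sub_self, inner_zero_right]
    rw [show z + u - t • n₀ - b = (z₀ - b) + (2 * R) • e + u - t • n₀ by rw [hz]; abel,
      inner_sub_right, inner_add_right, inner_add_right, real_inner_smul_right,
      real_inner_smul_right, real_inner_self_eq_norm_sq, he1, real_inner_comm n₀ e, he0] at h1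
    have h2 := abs_le.1 (abs_real_inner_le_norm e u)
    rw [he1, one_mul] at h2
    linarith [h2.1]

namespace Column

variable {T S : Finset E3} {z xs : E3}

theorem σ_pos (C : Column σ κ τ h s K Γ x₀ n₀ ψ T S z xs) : 0 < σ := by linarith [C.two_le_σ]

theorem s_pos (C : Column σ κ τ h s K Γ x₀ n₀ ψ T S z xs) : 0 < s := by
  have h1 := C.s_eq
  have h2 : 0 < σ * κ := mul_pos C.σ_pos (by linarith [C.one_le_κ])
  by_contra hneg
  nlinarith [mul_nonneg h2.le (by linarith : 0 ≤ -s)]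

theorem s_le (C : Column σ κ τ h s K Γ x₀ n₀ ψ T S z xs) : s ≤ 1 / 200 := by
  have h1 := C.s_eq
  have h2 : 2 ≤ σ * κ := by nlinarith [C.two_le_σ, C.one_le_κ]
  nlinarith [C.s_pos]

theorem radius_le (C : Column σ κ τ h s K Γ x₀ n₀ ψ T S z xs) : s * h / (4 * σ) ≤ s * h / 8 := by
  have := mul_pos C.s_pos C.h_pos
  have := C.two_le_σ
  gcongr
  linarith

theorem barycenter_mem_tet (C : Column σ κ τ h s K Γ x₀ n₀ ψ T S z xs) {T' : Finset E3}
    (hT' : S ⊆ T') : barycenter S ∈ tet T' := tet_mono hT' (barycenter_mem C.S_nonempty)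

theorem norm_barycenter (C : Column σ κ τ h s K Γ x₀ n₀ ψ T S z xs) : ‖barycenter S - x₀‖ ≤ h :=
  C.mem_ball C.mem_cut C.x₀_mem (C.barycenter_mem_tet C.S_sub)

theorem mem_ball_of_near (C : Column σ κ τ h s K Γ x₀ n₀ ψ T S z xs) {x : E3}
    (hx : ‖x - barycenter S‖ ≤ 2 * h) : x ∈ Metric.ball x₀ (4 * h) := by
  rw [mem_ball_iff_norm]
  have h1 := norm_add_le (x - barycenter S) (barycenter S - x₀)
  rw [sub_add_sub_cancel] at h1
  linarith [C.norm_barycenter, C.h_pos]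

theorem xs_mem_ball (C : Column σ κ τ h s K Γ x₀ n₀ ψ T S z xs) :
    xs ∈ Metric.ball x₀ (4 * h) := by
  rw [mem_ball_iff_norm]
  linarith [C.mem_ball C.mem_cut C.x₀_mem (tet_mono C.S_sub C.xs_mem), C.h_pos]

theorem norm_point_le (C : Column σ κ τ h s K Γ x₀ n₀ ψ T S z xs) {u : E3}
    (hu : ‖u‖ ≤ s * h / (4 * σ)) {t : ℝ} (ht : |t| ≤ 10 * (s * h)) :
    ‖z + u - t • n₀ - barycenter S‖ ≤ 13 * (s * h) := by
  have h1 : z + u - t • n₀ - barycenter S = (z - barycenter S) + u - t • n₀ := by abel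
  rw [h1]
  have h2 := norm_sub_le ((z - barycenter S) + u) (t • n₀)
  have h3 := norm_add_le (z - barycenter S) u
  rw [norm_smul, C.normal, Real.norm_eq_abs, mul_one] at h2
  linarith [C.z_near, C.radius_le, mul_pos C.s_pos C.h_pos]

theorem point_mem_ball (C : Column σ κ τ h s K Γ x₀ n₀ ψ T S z xs) {u : E3}
    (hu : ‖u‖ ≤ s * h / (4 * σ)) {t : ℝ} (ht : |t| ≤ 10 * (s * h)) :
    z + u - t • n₀ ∈ Metric.ball x₀ (4 * h) := by
  refine C.mem_ball_of_near ((C.norm_point_le hu ht).trans ?_)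
  nlinarith [C.s_le, C.h_pos]

/-- An element containing `S` contains `xs`, which is not above `Γ`; a point on the other side
forces a cut. -/
theorem mem_cut_of_nonneg (C : Column σ κ τ h s K Γ x₀ n₀ ψ T S z xs) {T' : Finset E3}
    (hT' : T' ∈ tets K) (hS : S ⊆ T') {x : E3} (hx : x ∈ tet T') (hxb : x ∈ Metric.ball x₀ (4 * h))
    (hψ : 0 ≤ ψ x) : T' ∈ cutTets Γ K :=
  C.mem_cutTets hT' (tet_mono hS C.xs_mem) hx C.xs_mem_ball hxb C.ψ_xs hψ

/-- The coordinates of `S` are at least `1 / 4` at its barycenter. A distance `s * h` costs at most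
`1 / 200`, by the choice of `s`; the start of the column costs three such distances and its length
at most ten, so they stay positive. -/
theorem exists_mem_star (C : Column σ κ τ h s K Γ x₀ n₀ ψ T S z xs) {u : E3}
    (hu : ‖u‖ ≤ s * h / (4 * σ)) {l : ℝ} (hl : l ≤ 10 * (s * h))
    (hstep : ∀ t ∈ Ico 0 l, ∀ T₁ ∈ cutTets Γ K, S ⊆ T₁ → z + u - t • n₀ ∈ tet T₁ →
      ∀ T₂ ∈ tets K, S ⊆ T₂ → z + u - t • n₀ ∈ tet T₂ → T₂ ∈ cutTets Γ K) :
    ∀ t ∈ Icc 0 l, ∃ T₁ ∈ cutTets Γ K, S ⊆ T₁ ∧ z + u - t • n₀ ∈ tet T₁ := by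
  have hσ := C.σ_pos
  have hκ := C.one_le_κ
  have hh := C.h_pos
  have hs := C.s_pos
  have hslope : ∀ T' ∈ cutTets Γ K, ∀ v x y : E3,
      |bary T' v x - bary T' v y| ≤ σ * κ / (2 * h) * ‖x - y‖ := by
    intro T' hT' v x y
    refine (C.shape.abs_bary_sub_le hT'.1 v x y).trans
      (mul_le_mul_of_nonneg_right ?_ (norm_nonneg _))
    have := C.shape.hT_pos hT'.1
    rw [div_le_div_iff₀ (by positivity) (by positivity)]
    have h1 := mul_le_mul_of_nonneg_left (C.le_hT T' hT') hσ.le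
    linarith
  have hA : σ * κ / (2 * h) * (s * h) = 1 / 200 := by
    have := C.s_eq
    field_simp
    linarith
  have hA0 : 0 ≤ σ * κ / (2 * h) := by positivity
  have hzT : z + u ∈ tet T := C.ball_sub (by
    rw [mem_closedBall_iff_norm, add_sub_cancel_left]
    refine hu.trans ?_
    gcongr
    norm_num)
  have key := exists_mem_star_of_path (K := K) C.finite (G := {T' ∈ cutTets Γ K | S ⊆ T'})
    (fun T' hT' => hT'.1.1) (A := σ * κ / (2 * h)) (fun T' hT' => hslope T' hT'.1) hA0 (S := S)
    (γ := fun t => z + u - t • n₀) (l := l) (m := 1) (c := 1 / 4 - 3 / 200) ?_ ?_ ?_ zero_le_one ?_ ?_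
  · intro t ht
    obtain ⟨T₁, hT₁, h1⟩ := key t ht
    exact ⟨T₁, hT₁.1, hT₁.2, h1⟩
  · intro r _ t _
    rw [show z + u - r • n₀ - (z + u - t • n₀) = (t - r) • n₀ by module, norm_smul, C.normal,
      Real.norm_eq_abs, abs_sub_comm]
    linarith
  · intro t ht
    have := C.covers (C.point_mem_ball hu (t := t) (by rw [abs_of_nonneg ht.1]; exact ht.2.trans hl))
    simpa using this
  · refine ⟨T, ⟨C.mem_cut, C.S_sub⟩, by simpa using hzT, fun v hv => ?_⟩
    have h1 := bary_barycenter C.mem_cut.1 C.S_sub hv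
    have h2 := abs_le.1 (hslope T C.mem_cut v (z + u - (0 : ℝ) • n₀) (barycenter S))
    have h3 : ‖z + u - (0 : ℝ) • n₀ - barycenter S‖ ≤ 3 * (s * h) := by
      rw [show z + u - (0 : ℝ) • n₀ - barycenter S = (z - barycenter S) + u by module]
      have := norm_add_le (z - barycenter S) u
      linarith [C.z_near, C.radius_le, mul_pos C.s_pos C.h_pos]
    have h4 := mul_le_mul_of_nonneg_left h3 hA0
    linarith [h2.1]
  · have h4 := mul_le_mul_of_nonneg_left hl hA0
    linarith
  · rintro t ht T₁ ⟨hT₁, hS₁⟩ h1 T₂ hT₂ hS₂ h2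
    exact ⟨hstep t ht T₁ hT₁ hS₁ h1 T₂ hT₂ hS₂ h2, hS₂⟩

/-- At depth `8 * s * h` the column is below `Γ`, since the barycenter of `S` is at most `s * h`
above in terms of `ψ` and `z` is within `2 * s * h` of it. Down to the crossing point `ψ` is
nonnegative, so all elements met are active. -/
theorem exists_mem_surface (C : Column σ κ τ h s K Γ x₀ n₀ ψ T S z xs) (hτ : 2 * τ ≤ s) {u : E3}
    (hu0 : inner ℝ n₀ u = (0 : ℝ)) (hu : ‖u‖ ≤ s * h / (4 * σ)) :
    ∃ t ∈ Icc 0 (8 * (s * h)), z + u - t • n₀ ∈ Γ ∧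
      ∃ T₁ ∈ cutTets Γ K, S ⊆ T₁ ∧ z + u - t • n₀ ∈ tet T₁ := by
  have hσ := C.σ_pos
  have hh := C.h_pos
  have hs := C.s_pos
  have hsh : 0 < s * h := mul_pos hs hh
  have hmem : ∀ t ∈ Icc 0 (8 * (s * h)), z + u - t • n₀ ∈ Metric.ball x₀ (4 * h) := fun t ht =>
    C.point_mem_ball hu (by rw [abs_of_nonneg ht.1]; linarith [ht.2])
  have htop : z + u ∈ Metric.ball x₀ (4 * h) := by simpa using hmem 0 ⟨le_rfl, by positivity⟩
  have hbot := hmem (8 * (s * h)) ⟨by positivity, le_rfl⟩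
  have hψtop : 0 ≤ ψ (z + u) := le_trans (by positivity) (C.ψ_top u hu0 hu)
  have hψbot : ψ (z + u - (8 * (s * h)) • n₀) ≤ 0 := by
    have h1 := C.sub_le hbot (C.mem_ball_of_near (x := barycenter S) (by simp [hh.le]))
    have h2 := C.norm_point_le hu (t := 8 * (s * h)) (by rw [abs_of_nonneg (by positivity)]; linarith)
    have h3 := mul_le_mul_of_nonneg_left h2 C.τ_nonneg
    have h4 : inner ℝ n₀ (z + u - (8 * (s * h)) • n₀ - barycenter S) ≤ 2 * s * h - 8 * (s * h) := by
      rw [show z + u - (8 * (s * h)) • n₀ - barycenter S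
        = (z - barycenter S) + u - (8 * (s * h)) • n₀ by abel, inner_sub_right, inner_add_right, hu0,
        real_inner_smul_right, C.inner_self]
      have := (abs_le.1 (C.abs_inner_le (z - barycenter S))).2
      linarith [C.z_near]
    have h5 : τ * (13 * (s * h)) ≤ s * h := by
      have : 13 * τ ≤ 1 := by linarith [C.s_le]
      nlinarith
    linarith [C.ψ_barycenter]
  obtain ⟨c, hc, hcΓ, hc0⟩ := C.exists_mem_segment hbot htop hψbot hψtop
  set t := (1 - c) * (8 * (s * h)) with ht
  have hpt : z + u - (8 * (s * h)) • n₀ + c • (z + u - (z + u - (8 * (s * h)) • n₀)) =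
      z + u - t • n₀ := by rw [ht]; module
  rw [hpt] at hcΓ hc0
  have htI : t ∈ Icc 0 (8 * (s * h)) := ⟨by nlinarith [hc.2], by nlinarith [hc.1]⟩
  refine ⟨t, htI, hcΓ, C.exists_mem_star hu (l := t) (by linarith [htI.2]) ?_ t ⟨htI.1, le_rfl⟩⟩
  intro r hr T₁ _ _ _ T₂ hT₂ hS₂ h2
  have hrI : r ∈ Icc 0 (8 * (s * h)) := ⟨hr.1, hr.2.le.trans htI.2⟩
  refine C.mem_cut_of_nonneg hT₂ hS₂ h2 (hmem r hrI) ?_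
  have h3 := C.le_sub_of_vertical (x := z + u - t • n₀) (t := t - r) (by linarith [hr.2])
    (hmem t htI) (by
      rw [show z + u - t • n₀ + (t - r) • n₀ = z + u - r • n₀ by module]
      exact hmem r hrI)
  rw [show z + u - t • n₀ + (t - r) • n₀ = z + u - r • n₀ by module, hc0] at h3
  linarith [hr.2]

end Column

end

end TraceFEM

/-! ### Triangles inscribed in a parabola, and an element with a large cut. -/

namespace TraceFEM

theorem abs_mul_le_of_le {p q P Q : ℝ} (hp : |p| ≤ P) (hq : |q| ≤ Q) : |p * q| ≤ P * Q := by
  rw [abs_mul]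
  exact mul_le_mul hp hq (abs_nonneg _) ((abs_nonneg _).trans hp)

/-- Three points `(j, j²)` with distinct integers `j` span a triangle whose determinant is of
Vandermonde type, a nonzero integer. A perturbation of size `η` leaves it at least `1 / 2` in
absolute value, so the triangle contains a square of side `2 * η` around its centroid; the weights
come from Cramer's rule. -/
theorem exists_weights_of_near_parabola {j₁ j₂ j₃ : ℕ} (h₁₂ : j₁ ≠ j₂) (h₁₃ : j₁ ≠ j₃) (h₂₃ : j₂ ≠ j₃)
    {M η : ℝ} (hM : 1 ≤ M) (hj₁ : j₁ ≤ M) (hj₂ : j₂ ≤ M) (hj₃ : j₃ ≤ M) (hη : 100 * M ^ 2 * η = 1)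
    {x₁ x₂ x₃ y₁ y₂ y₃ a b : ℝ} (hx₁ : |x₁ - j₁| ≤ η) (hx₂ : |x₂ - j₂| ≤ η) (hx₃ : |x₃ - j₃| ≤ η)
    (hy₁ : |y₁ - j₁ ^ 2| ≤ η) (hy₂ : |y₂ - j₂ ^ 2| ≤ η) (hy₃ : |y₃ - j₃ ^ 2| ≤ η)
    (ha : |a| ≤ η) (hb : |b| ≤ η) :
    ∃ w₁ w₂ w₃ : ℝ, 0 ≤ w₁ ∧ 0 ≤ w₂ ∧ 0 ≤ w₃ ∧ w₁ + w₂ + w₃ = 1 ∧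
      w₁ * x₁ + w₂ * x₂ + w₃ * x₃ = (x₁ + x₂ + x₃) / 3 + a ∧
      w₁ * y₁ + w₂ * y₂ + w₃ * y₃ = (y₁ + y₂ + y₃) / 3 + b := by
  have hη0 : 0 ≤ η := (abs_nonneg _).trans ha
  have hM2 : M ≤ M ^ 2 := by nlinarith
  have hηM : M * η ≤ M ^ 2 * η := by gcongr
  have hη1 : η ≤ 1 / 100 := by nlinarith
  have hηM1 : η ≤ M * η := by nlinarith
  have hD₀ : 1 ≤ |((j₂ : ℝ) - j₁) * (j₃ ^ 2 - j₁ ^ 2) - (j₃ - j₁) * (j₂ ^ 2 - j₁ ^ 2)| := by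
    have h0 : ((j₂ : ℤ) - j₁) * (j₃ - j₁) * (j₃ - j₂) ≠ 0 := by
      refine mul_ne_zero (mul_ne_zero ?_ ?_) ?_ <;> omega
    have h1 := Int.one_le_abs h0
    have h2 : ((j₂ : ℝ) - j₁) * (j₃ ^ 2 - j₁ ^ 2) - (j₃ - j₁) * (j₂ ^ 2 - j₁ ^ 2) =
        ((((j₂ : ℤ) - j₁) * (j₃ - j₁) * (j₃ - j₂) : ℤ) : ℝ) := by
      push_cast
      ring
    rw [h2]
    exact_mod_cast h1
  have hsub : ∀ {i j : ℕ}, (i : ℝ) ≤ M → (j : ℝ) ≤ M → |(i : ℝ) - j| ≤ M := fun {i j} hi hj => by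
    have := Nat.cast_nonneg (α := ℝ) i
    have := Nat.cast_nonneg (α := ℝ) j
    rw [abs_le]
    constructor <;> linarith
  have hsub2 : ∀ {i j : ℕ}, (i : ℝ) ≤ M → (j : ℝ) ≤ M → |(i : ℝ) ^ 2 - j ^ 2| ≤ M ^ 2 :=
    fun {i j} hi hj => by
      have h1 := pow_le_pow_left₀ (Nat.cast_nonneg (α := ℝ) i) hi 2
      have h2 := pow_le_pow_left₀ (Nat.cast_nonneg (α := ℝ) j) hj 2
      have := sq_nonneg (i : ℝ)
      have := sq_nonneg (j : ℝ)
      rw [abs_le]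
      constructor <;> linarith
  have hdiff : ∀ {p q P Q : ℝ}, |p - P| ≤ η → |q - Q| ≤ η → |(p - q) - (P - Q)| ≤ 2 * η :=
    fun {p q P Q} h1 h2 => by
      rw [abs_le] at *
      constructor <;> linarith [h1.1, h1.2, h2.1, h2.2]
  have hX₂ := hdiff hx₂ hx₁
  have hX₃ := hdiff hx₃ hx₁
  have hY₂ := hdiff hy₂ hy₁
  have hY₃ := hdiff hy₃ hy₁
  have hbig : ∀ {p P Q : ℝ}, |p - P| ≤ 2 * η → |P| ≤ Q → |p| ≤ Q + 2 * η := fun {p P Q} h1 h2 => by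
    rw [abs_le] at *
    constructor <;> linarith [h1.1, h1.2, h2.1, h2.2]
  set X₂ := x₂ - x₁
  set X₃ := x₃ - x₁
  set Y₂ := y₂ - y₁
  set Y₃ := y₃ - y₁
  have hD : 1 / 2 ≤ |X₂ * Y₃ - X₃ * Y₂| := by
    have e1 := abs_le.1 (abs_mul_le_of_le (hbig hX₂ (hsub hj₂ hj₁)) hY₃)
    have e2 := abs_le.1 (abs_mul_le_of_le hX₂ (hsub2 hj₃ hj₁))
    have e3 := abs_le.1 (abs_mul_le_of_le (hbig hX₃ (hsub hj₃ hj₁)) hY₂)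
    have e4 := abs_le.1 (abs_mul_le_of_le hX₃ (hsub2 hj₂ hj₁))
    have e5 : |(X₂ * Y₃ - X₃ * Y₂) - (((j₂ : ℝ) - j₁) * (j₃ ^ 2 - j₁ ^ 2)
        - (j₃ - j₁) * (j₂ ^ 2 - j₁ ^ 2))| ≤ 1 / 2 := by
      have e6 : (M + 2 * η) * (2 * η) ≤ 4 * (M ^ 2 * η) := by nlinarith
      have e7 : 2 * η * M ^ 2 = 2 * (M ^ 2 * η) := by ring
      have e8 : M ^ 2 * η = 1 / 100 := by linarith
      rw [abs_le]
      constructor <;> linarith [e1.1, e1.2, e2.1, e2.2, e3.1, e3.2, e4.1, e4.2]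
    have := abs_sub_abs_le_abs_sub (((j₂ : ℝ) - j₁) * (j₃ ^ 2 - j₁ ^ 2)
        - (j₃ - j₁) * (j₂ ^ 2 - j₁ ^ 2)) (X₂ * Y₃ - X₃ * Y₂)
    rw [abs_sub_comm] at e5
    linarith
  set D := X₂ * Y₃ - X₃ * Y₂ with hDdef
  have hD0 : D ≠ 0 := fun h => by
    rw [h, abs_zero] at hD
    norm_num at hD
  have hfrac : ∀ {p : ℝ}, |p| ≤ 1 / 12 → |p / D| ≤ 1 / 6 := fun {p} hp => by
    rw [abs_div, div_le_iff₀ (by linarith)]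
    linarith
  have hnum : ∀ {X Y : ℝ}, |X| ≤ M + 2 * η → |Y| ≤ M ^ 2 + 2 * η → |a * Y - b * X| ≤ 1 / 12 :=
    fun {X Y} hX hY => by
      have e1 := abs_le.1 (abs_mul_le_of_le ha hY)
      have e2 := abs_le.1 (abs_mul_le_of_le hb hX)
      have e3 : η * (M ^ 2 + 2 * η) ≤ 3 / 100 := by nlinarith
      have e4 : η * (M + 2 * η) ≤ 3 / 100 := by nlinarith
      rw [abs_le]
      constructor <;> linarith [e1.1, e1.2, e2.1, e2.2]
  have h2 := abs_le.1 (hfrac (hnum (hbig hX₃ (hsub hj₃ hj₁)) (hbig hY₃ (hsub2 hj₃ hj₁))))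
  have h3 := abs_le.1 (hfrac (hnum (hbig hX₂ (hsub hj₂ hj₁)) (hbig hY₂ (hsub2 hj₂ hj₁))))
  refine ⟨1 / 3 - (a * Y₃ - b * X₃) / D + (a * Y₂ - b * X₂) / D, 1 / 3 + (a * Y₃ - b * X₃) / D,
    1 / 3 - (a * Y₂ - b * X₂) / D, by linarith [h2.2, h3.1], by linarith [h2.1], by linarith [h3.2],
    by ring, ?_, ?_⟩
  · have e : (a * Y₃ - b * X₃) / D * X₂ - (a * Y₂ - b * X₂) / D * X₃ = a := by
      rw [div_mul_eq_mul_div, div_mul_eq_mul_div, div_sub_div_same, div_eq_iff hD0, hDdef]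
      ring
    have e2 : x₂ = X₂ + x₁ := by ring
    have e3 : x₃ = X₃ + x₁ := by ring
    rw [e2, e3]
    linear_combination e
  · have e : (a * Y₃ - b * X₃) / D * Y₂ - (a * Y₂ - b * X₂) / D * Y₃ = b := by
      rw [div_mul_eq_mul_div, div_mul_eq_mul_div, div_sub_div_same, div_eq_iff hD0, hDdef]
      ring
    have e2 : y₂ = Y₂ + y₁ := by ring
    have e3 : y₃ = Y₃ + y₁ := by ring
    rw [e2, e3]
    linear_combination e

section

variable {σ κ τ h s : ℝ} {K : Mesh} {Γ : Set E3} {x₀ n₀ : E3} {ψ : E3 → ℝ} {T S : Finset E3}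
  {z xs : E3}

/-- These elements share the barycenter of `S`, so they lie in one ball of radius `h`, and the
packing bound applies. -/
theorem Column.card_star_le (C : Column σ κ τ h s K Γ x₀ n₀ ψ T S z xs) {F : Finset (Finset E3)}
    (hF : ∀ T' ∈ F, T' ∈ cutTets Γ K ∧ S ⊆ T') : (F.card : ℝ) ≤ (σ * κ) ^ 3 := by
  have hσ := C.σ_pos
  have hh := C.h_pos
  have hκ : 0 < κ := by linarith [C.one_le_κ]
  have := C.shape.card_mul_le hσ (F := F) (fun T' hT' => (hF T' hT').1.1) (g := h / κ)
    (by positivity) (fun T' hT' => by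
      rw [div_le_iff₀ hκ, mul_comm]
      exact C.le_hT T' (hF T' hT').1) (b := barycenter S) (ρ := h) hh.le (fun T' hT' x hx => by
      rw [mem_closedBall_iff_norm]
      exact (norm_sub_le_hT hx (C.barycenter_mem_tet (hF T' hT').2)).trans
        (C.hT_le T' (hF T' hT').1))
  have e : (F.card : ℝ) * (h / κ / σ) ^ 3 = F.card / (σ * κ) ^ 3 * h ^ 3 := by
    field_simp
  rw [e] at this
  have h3 : F.card / (σ * κ) ^ 3 ≤ 1 := by
    by_contra hcon
    have : 0 < h ^ 3 := by positivity
    nlinarith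
  rwa [div_le_one (by positivity)] at h3

/-- The part of `Γ` met by the columns over the disc with center `U` projects onto that disc and is
covered by at most `N` elements, one of which takes its share. Positive area also yields a point of
`Γ` over the disc. -/
theorem Column.exists_large_cut (C : Column σ κ τ h s K Γ x₀ n₀ ψ T S z xs) (hτ : 2 * τ ≤ s) {N : ℕ}
    (hN : (σ * κ) ^ 3 ≤ N) {U : E3} (hU : inner ℝ n₀ U = (0 : ℝ)) {ρ : ℝ} (hρ : 0 < ρ)
    (hUρ : ‖U‖ + ρ ≤ s * h / (4 * σ)) :
    ∃ T' ∈ cutTets Γ K, S ⊆ T' ∧ ENNReal.ofReal (ρ ^ 2 / N) ≤ area (tet T' ∩ Γ) ∧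
      ∃ u : E3, inner ℝ n₀ u = (0 : ℝ) ∧ ‖u - U‖ ≤ ρ ∧ ∃ t ∈ Icc 0 (8 * (s * h)),
        z + u - t • n₀ ∈ tet T' ∩ Γ := by
  classical
  have hfin : {T' ∈ cutTets Γ K | S ⊆ T'}.Finite := C.finite.subset fun T' hT' => hT'.1.1.1
  set F := hfin.toFinset with hF
  have hFmem : ∀ T', T' ∈ F ↔ T' ∈ cutTets Γ K ∧ S ⊆ T' := fun T' => by simp [hF]
  have hTF : T ∈ F := (hFmem T).2 ⟨C.mem_cut, C.S_sub⟩
  have hσκ : 0 < (σ * κ) ^ 3 := by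
    have := C.σ_pos
    have := C.one_le_κ
    positivity
  have hN0 : (0 : ℝ) < N := hσκ.trans_le hN
  let P : Finset E3 → Set E3 := fun T' => {p ∈ tet T' ∩ Γ | ∃ u : E3, inner ℝ n₀ u = (0 : ℝ) ∧
    ‖u - U‖ ≤ ρ ∧ ∃ t ∈ Icc 0 (8 * (s * h)), p = z + u - t • n₀}
  have hcover : ENNReal.ofReal (ρ ^ 2) ≤ area (⋃ T' ∈ F, P T') := by
    refine area_mono_of_projection (n₀ := n₀) (z := z + U) C.normal hρ.le fun u hu hun => ?_
    have h0 : inner ℝ n₀ (U + u) = (0 : ℝ) := by rw [inner_add_right, hU, hu, add_zero]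
    obtain ⟨t, ht, htΓ, T', hT', hS', htT⟩ := C.exists_mem_surface hτ (u := U + u) h0
      ((norm_add_le _ _).trans (by linarith))
    refine ⟨-t, ?_⟩
    rw [show z + U + u + (-t) • n₀ = z + (U + u) - t • n₀ by module]
    exact mem_biUnion ((hFmem T').2 ⟨hT', hS'⟩)
      ⟨⟨htT, htΓ⟩, U + u, h0, by simpa using hun, t, ht, rfl⟩
  have hsum : ∑ _T' ∈ F, ENNReal.ofReal (ρ ^ 2 / N) ≤ ∑ T' ∈ F, area (P T') := by
    refine le_trans ?_ (hcover.trans (measure_biUnion_finset_le F P))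
    rw [Finset.sum_const, nsmul_eq_mul, ← ENNReal.ofReal_natCast, ← ENNReal.ofReal_mul (by positivity)]
    refine ENNReal.ofReal_le_ofReal ?_
    have h1 : (F.card : ℝ) ≤ N := (C.card_star_le fun T' hT' => (hFmem T').1 hT').trans hN
    rw [mul_div_assoc', div_le_iff₀ hN0]
    nlinarith [sq_nonneg ρ]
  obtain ⟨T', hT'F, hT'⟩ : ∃ T' ∈ F, ENNReal.ofReal (ρ ^ 2 / N) ≤ area (P T') := by
    by_contra! hcon
    exact absurd hsum (not_le.2 (ENNReal.sum_lt_sum_of_nonempty ⟨T, hTF⟩ hcon))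
  obtain ⟨hcut, hS'⟩ := (hFmem T').1 hT'F
  refine ⟨T', hcut, hS', hT'.trans (measure_mono fun p hp => hp.1), ?_⟩
  have hpos : 0 < area (P T') := lt_of_lt_of_le (ENNReal.ofReal_pos.2 (by positivity)) hT'
  obtain ⟨p, hp, u, hu, huU, t, ht, rfl⟩ := nonempty_of_measure_ne_zero hpos.ne'
  exact ⟨u, hu, huU, t, ht, hp⟩

end

end TraceFEM

/-! ### A fat, almost horizontal triangle inside one element. -/

namespace TraceFEM

theorem sum_mem_of_convex₃ {D : Set E3} (hD : Convex ℝ D) {x y z : E3} (hx : x ∈ D) (hy : y ∈ D)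
    (hz : z ∈ D) {a b c : ℝ} (ha : 0 ≤ a) (hb : 0 ≤ b) (hc : 0 ≤ c) (h : a + b + c = 1) :
    a • x + b • y + c • z ∈ D := by
  have := hD.sum_mem (t := Finset.univ) (w := ![a, b, c]) (z := ![x, y, z])
    (by simp [Fin.forall_fin_succ, ha, hb, hc]) (by simpa [Fin.sum_univ_three] using h)
    (by simp [Fin.forall_fin_succ, hx, hy, hz])
  simpa [Fin.sum_univ_three] using this

set_option maxHeartbeats 1000000 in
/-- A large part of `Γ` lies in one element of the star of `S`, which moreover contains an almost
horizontal triangle of fixed size with vertices on `Γ`. -/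
theorem exists_fat_triangle {σ κ s : ℝ} (hσ : 0 < σ) (hκ : 0 < κ) (hs : 0 < s) :
    ∃ f c : ℝ, 0 < f ∧ 0 < c ∧ ∀ {τ h : ℝ} {K : Mesh} {Γ : Set E3} {x₀ n₀ : E3} {ψ : E3 → ℝ}
      {T S : Finset E3} {z xs : E3}, Column σ κ τ h s K Γ x₀ n₀ ψ T S z xs → 2 * τ ≤ s →
      ∃ T' ∈ cutTets Γ K, S ⊆ T' ∧ ENNReal.ofReal (c * h ^ 2) ≤ area (tet T' ∩ Γ) ∧
      ∃ D ⊆ tet T', (∀ y ∈ D, |ψ y| ≤ τ * h ∧ ‖y - z‖ ≤ 9 * (s * h)) ∧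
      ∃ (u₀ : E3) (t₀ : ℝ), inner ℝ n₀ u₀ = (0 : ℝ) ∧ ‖u₀‖ ≤ s * h / (8 * σ) ∧
        z + u₀ - t₀ • n₀ ∈ D ∧
        ∀ u : E3, inner ℝ n₀ u = (0 : ℝ) → ‖u‖ ≤ f * h → ∃ t : ℝ, z + u₀ - t₀ • n₀ + u + t • n₀ ∈ D := by
  set N : ℕ := ⌈(σ * κ) ^ 3⌉₊ with hN
  have hN1 : (σ * κ) ^ 3 ≤ N := Nat.le_ceil _
  have hN0 : (0 : ℝ) < N := lt_of_lt_of_le (by positivity) hN1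
  set M : ℝ := 2 * N + 1 with hM
  have hM1 : 1 ≤ M := by linarith
  set η : ℝ := 1 / (100 * M ^ 2) with hη
  have hη0 : 0 < η := by positivity
  have hηM : 100 * M ^ 2 * η = 1 := by rw [hη]; field_simp
  have hη1 : η ≤ 1 / 100 := by nlinarith [mul_pos hη0 hη0]
  -- The scale of the parabola: indices up to `M` and the error `η` stay within half of the column
  -- radius.
  set μ : ℝ := s / (4 * σ) / (8 * M ^ 2) with hμ
  have hμ0 : 0 < μ := by positivity
  have hμM : 8 * M ^ 2 * μ = s / (4 * σ) := by rw [hμ]; field_simp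
  refine ⟨μ * η, (μ * η) ^ 2 / N, by positivity, by positivity, ?_⟩
  intro τ h K Γ x₀ n₀ ψ T S z xs C hτ
  have hh := C.h_pos
  obtain ⟨e₁, e₂, h01, h02, hn1, hn2, hexp, h12⟩ := exists_orthonormal_complement C.normal
  have h11 : inner ℝ e₁ e₁ = (1 : ℝ) := by rw [real_inner_self_eq_norm_sq, hn1, one_pow]
  have h22 : inner ℝ e₂ e₂ = (1 : ℝ) := by rw [real_inner_self_eq_norm_sq, hn2, one_pow]
  have h21 : inner ℝ e₂ e₁ = (0 : ℝ) := by rw [real_inner_comm, h12]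
  have hR : s * h / (4 * σ) = 8 * M ^ 2 * (μ * h) := by
    rw [mul_div_right_comm, ← hμM]
    ring
  have hR2 : s * h / (8 * σ) = 4 * M ^ 2 * (μ * h) := by
    rw [show s * h / (8 * σ) = (s * h / (4 * σ)) / 2 by field_simp; norm_num, hR]
    ring
  have hμh : 0 < μ * h := by positivity
  have hM2 : M ≤ M ^ 2 := by nlinarith
  let U : ℕ → E3 := fun j => (μ * h) • ((j : ℝ) • e₁ + ((j : ℝ) ^ 2) • e₂)
  have hU0 : ∀ j, inner ℝ n₀ (U j) = (0 : ℝ) := fun j => by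
    simp only [U, inner_smul_right, inner_add_right, h01, h02]
    simp
  have hUn : ∀ j : ℕ, (j : ℝ) ≤ M → ‖U j‖ ≤ 2 * M ^ 2 * (μ * h) := fun j hj => by
    have hj0 : (0 : ℝ) ≤ j := Nat.cast_nonneg j
    have h1 := norm_add_le ((j : ℝ) • e₁) (((j : ℝ) ^ 2) • e₂)
    rw [norm_smul, norm_smul, hn1, hn2, Real.norm_of_nonneg hj0,
      Real.norm_of_nonneg (by positivity)] at h1
    have h2 := pow_le_pow_left₀ hj0 hj 2
    simp only [U]
    rw [norm_smul, Real.norm_of_nonneg hμh.le, mul_comm]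
    refine mul_le_mul_of_nonneg_right ?_ hμh.le
    linarith
  have hρ : 0 < μ * η * h := by positivity
  have hρle : μ * η * h ≤ M ^ 2 * (μ * h) := by
    have : η ≤ M ^ 2 := by nlinarith
    calc μ * η * h = η * (μ * h) := by ring
      _ ≤ _ := by gcongr
  have hjM : ∀ j ∈ Finset.range (2 * N + 1), (j : ℝ) ≤ M := fun j hj => by
    have : j ≤ 2 * N + 1 := (Finset.mem_range.1 hj).le
    rw [hM]
    exact_mod_cast this
  have hcut : ∀ j ∈ Finset.range (2 * N + 1), ∃ T' ∈ cutTets Γ K, S ⊆ T' ∧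
      ENNReal.ofReal ((μ * η * h) ^ 2 / N) ≤ area (tet T' ∩ Γ) ∧
      ∃ u : E3, inner ℝ n₀ u = (0 : ℝ) ∧ ‖u - U j‖ ≤ μ * η * h ∧ ∃ t ∈ Icc 0 (8 * (s * h)),
        z + u - t • n₀ ∈ tet T' ∩ Γ := fun j hj => by
    refine C.exists_large_cut hτ hN1 (hU0 j) hρ ?_
    have := hUn j (hjM j hj)
    rw [hR]
    nlinarith
  choose! Tj hTj hSj harea uj huj hujU tj htj hpj using hcut
  classical
  have hfin : {T' ∈ cutTets Γ K | S ⊆ T'}.Finite := C.finite.subset fun T' hT' => hT'.1.1.1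
  -- With `2 * N + 1` discs and at most `N` elements, some element is selected for three discs.
  have hcard : hfin.toFinset.card * 2 < (Finset.range (2 * N + 1)).card := by
    have h1 : (hfin.toFinset.card : ℝ) ≤ N :=
      (C.card_star_le fun T' hT' => by simpa using hT').trans hN1
    have h2 : hfin.toFinset.card ≤ N := by exact_mod_cast h1
    rw [Finset.card_range]
    omega
  obtain ⟨T', hT'F, hT'card⟩ := Finset.exists_lt_card_fiber_of_mul_lt_card_of_maps_to
    (s := Finset.range (2 * N + 1)) (t := hfin.toFinset) (f := Tj)
    (fun j hj => by simpa using ⟨hTj j hj, hSj j hj⟩) hcard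
  obtain ⟨j₁, j₂, j₃, hj₁, hj₂, hj₃, h₁₂, h₁₃, h₂₃⟩ := Finset.two_lt_card_iff.1 hT'card
  rw [Finset.mem_filter] at hj₁ hj₂ hj₃
  obtain ⟨hT'cut, hST'⟩ : T' ∈ cutTets Γ K ∧ S ⊆ T' := by simpa using hT'F
  let p : ℕ → E3 := fun j => z + uj j - tj j • n₀
  have hp : ∀ j, j ∈ Finset.range (2 * N + 1) ∧ Tj j = T' → p j ∈ tet T' ∩ Γ := fun j hj =>
    hj.2 ▸ hpj j hj.1
  have hu : ∀ j ∈ Finset.range (2 * N + 1), ‖uj j‖ ≤ 3 * M ^ 2 * (μ * h) := fun j hj => by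
    have h1 := hUn j (hjM j hj)
    have h2 := hujU j hj
    have h3 := norm_add_le (uj j - U j) (U j)
    rw [sub_add_cancel] at h3
    linarith
  have hpz : ∀ j ∈ Finset.range (2 * N + 1), ‖p j - z‖ ≤ 9 * (s * h) := fun j hj => by
    have h1 : p j - z = uj j - tj j • n₀ := by simp only [p]; abel
    rw [h1]
    refine (norm_sub_le _ _).trans ?_
    rw [norm_smul, C.normal, Real.norm_of_nonneg (htj j hj).1]
    have h2 := C.radius_le
    rw [hR] at h2
    have h3 := (htj j hj).2
    have h4 := hu j hj
    have h5 : 0 ≤ M ^ 2 * (μ * h) := by positivity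
    linarith
  have hs' := C.s_le
  have hpball : ∀ y : E3, ‖y - z‖ ≤ 9 * (s * h) → y ∈ Metric.ball x₀ (4 * h) := fun y hy => by
    refine C.mem_ball_of_near ?_
    have h1 := norm_add_le (y - z) (z - barycenter S)
    rw [sub_add_sub_cancel] at h1
    have := C.z_near
    nlinarith
  let D : Set E3 := convexHull ℝ {p j₁, p j₂, p j₃}
  have hvert : ∀ y ∈ ({p j₁, p j₂, p j₃} : Set E3), y ∈ tet T' ∧ ψ y = 0 ∧ ‖y - z‖ ≤ 9 * (s * h) := by
    have aux : ∀ j, j ∈ Finset.range (2 * N + 1) ∧ Tj j = T' →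
        p j ∈ tet T' ∧ ψ (p j) = 0 ∧ ‖p j - z‖ ≤ 9 * (s * h) := fun j hj =>
      ⟨(hp j hj).1, (C.mem_iff _ (hpball _ (hpz j hj.1))).1 (hp j hj).2, hpz j hj.1⟩
    rintro y (rfl | rfl | rfl)
    exacts [aux _ hj₁, aux _ hj₂, aux _ hj₃]
  have hDz : ∀ y ∈ D, ‖y - z‖ ≤ 9 * (s * h) := fun y hy => by
    have := convexHull_min (t := Metric.closedBall z (9 * (s * h)))
      (fun y hy => by rw [mem_closedBall_iff_norm]; exact (hvert y hy).2.2) (convex_closedBall _ _) hy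
    rwa [mem_closedBall_iff_norm] at this
  -- For fixed `y`, the set of `x` with `|ψ y - ⟪n₀, y - x⟫| ≤ τ * h` is convex and contains the
  -- vertices, by flatness and `ψ x = 0`; hence it contains `y`.
  have hDψ : ∀ y ∈ D, |ψ y| ≤ τ * h := fun y hy => by
    have hconv : Convex ℝ {x : E3 | |ψ y - inner ℝ n₀ (y - x)| ≤ τ * h} := by
      have : {x : E3 | |ψ y - inner ℝ n₀ (y - x)| ≤ τ * h} =
          (innerSL ℝ n₀) ⁻¹' Metric.closedBall (inner ℝ n₀ y - ψ y) (τ * h) := by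
        ext x
        simp only [inner_sub_right, mem_ofPred_eq, mem_preimage, innerSL_apply_apply,
          Metric.mem_closedBall, Real.dist_eq]
        rw [show inner ℝ n₀ x - (inner ℝ n₀ y - ψ y) = ψ y - (inner ℝ n₀ y - inner ℝ n₀ x) by ring]
      rw [this]
      exact (convex_closedBall _ _).linear_preimage (innerSL ℝ n₀).toLinearMap
    have hmem := convexHull_min (fun x hx => ?_) hconv hy
    · simpa using hmem
    · have h1 := C.flat y (hpball y (hDz y hy)) x (hpball x (hvert x hx).2.2)
      rw [(hvert x hx).2.1, sub_zero] at h1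
      refine h1.trans (mul_le_mul_of_nonneg_left ?_ C.τ_nonneg)
      have h2 := norm_sub_le (y - z) (x - z)
      rw [sub_sub_sub_cancel_right] at h2
      have h3 := hDz y hy
      have h4 := (hvert x hx).2.2
      nlinarith
  have hDw : ∀ w₁ w₂ w₃ : ℝ, 0 ≤ w₁ → 0 ≤ w₂ → 0 ≤ w₃ → w₁ + w₂ + w₃ = 1 →
      w₁ • p j₁ + w₂ • p j₂ + w₃ • p j₃ ∈ D := fun w₁ w₂ w₃ k₁ k₂ k₃ k =>
    sum_mem_of_convex₃ (convex_convexHull ℝ _) (subset_convexHull ℝ _ (by simp))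
      (subset_convexHull ℝ _ (by simp)) (subset_convexHull ℝ _ (by simp)) k₁ k₂ k₃ k
  let u₀ : E3 := (1 / 3 : ℝ) • (uj j₁ + uj j₂ + uj j₃)
  let t₀ : ℝ := (tj j₁ + tj j₂ + tj j₃) / 3
  have hc₀ : ∀ w₁ w₂ w₃ : ℝ, w₁ + w₂ + w₃ = 1 → w₁ • p j₁ + w₂ • p j₂ + w₃ • p j₃ =
      z + (w₁ • uj j₁ + w₂ • uj j₂ + w₃ • uj j₃) - (w₁ * tj j₁ + w₂ * tj j₂ + w₃ * tj j₃) • n₀ :=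
    fun w₁ w₂ w₃ hw => by
      simp only [p]
      have : w₁ = 1 - w₂ - w₃ := by linarith
      rw [this]
      module
  refine ⟨T', hT'cut, hST', ?_, D, convexHull_min (fun y hy => (hvert y hy).1) (convex_tet T'),
    fun y hy => ⟨hDψ y hy, hDz y hy⟩, u₀, t₀, ?_, ?_, ?_, ?_⟩
  · have h1 := harea j₁ hj₁.1
    rw [hj₁.2] at h1
    convert h1 using 2
    ring
  · simp only [u₀, inner_smul_right, inner_add_right, huj _ hj₁.1, huj _ hj₂.1, huj _ hj₃.1]
    simp
  · simp only [u₀]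
    rw [norm_smul, Real.norm_of_nonneg (by norm_num), hR2]
    have h1 := norm_add₃_le (a := uj j₁) (b := uj j₂) (c := uj j₃)
    have h2 := hu _ hj₁.1
    have h3 := hu _ hj₂.1
    have h4 := hu _ hj₃.1
    have h5 : 0 ≤ M ^ 2 * (μ * h) := by positivity
    linarith
  · have h1 := hDw (1 / 3) (1 / 3) (1 / 3) (by norm_num) (by norm_num) (by norm_num) (by norm_num)
    rw [hc₀ _ _ _ (by norm_num)] at h1
    convert h1 using 2
    · simp only [u₀]; module
    · simp only [t₀]; congr 1; ring
  · intro u hu0 hun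
    have hcoord : ∀ {e v : E3} {b : ℝ}, ‖e‖ = 1 → ‖v‖ ≤ b * (μ * h) →
        |inner ℝ e v / (μ * h)| ≤ b := fun {e v b} he hv => by
      rw [abs_div, abs_of_pos hμh, div_le_iff₀ hμh]
      refine le_trans ?_ hv
      simpa [he] using abs_real_inner_le_norm e v
    have hx : ∀ j ∈ Finset.range (2 * N + 1), |inner ℝ e₁ (uj j) / (μ * h) - j| ≤ η := fun j hj => by
      have h1 := hcoord (b := η) hn1 ((hujU j hj).trans_eq (by ring))
      rwa [inner_sub_right, sub_div, show inner ℝ e₁ (U j) / (μ * h) = j by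
        simp only [U, inner_smul_right, inner_add_right, h11, h12]
        field_simp
        ring] at h1
    have hy : ∀ j ∈ Finset.range (2 * N + 1), |inner ℝ e₂ (uj j) / (μ * h) - j ^ 2| ≤ η :=
      fun j hj => by
        have h1 := hcoord (b := η) hn2 ((hujU j hj).trans_eq (by ring))
        rwa [inner_sub_right, sub_div, show inner ℝ e₂ (U j) / (μ * h) = j ^ 2 by
          simp only [U, inner_smul_right, inner_add_right, h22, h21]
          field_simp
          ring] at h1
    obtain ⟨w₁, w₂, w₃, k₁, k₂, k₃, k, kx, ky⟩ := exists_weights_of_near_parabola h₁₂ h₁₃ h₂₃ hM1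
      (hjM _ hj₁.1) (hjM _ hj₂.1) (hjM _ hj₃.1) hηM (hx _ hj₁.1) (hx _ hj₂.1) (hx _ hj₃.1)
      (hy _ hj₁.1) (hy _ hj₂.1) (hy _ hj₃.1) (hcoord (b := η) hn1 (hun.trans_eq (by ring)))
      (hcoord (b := η) hn2 (hun.trans_eq (by ring)))
    have hw : w₁ • uj j₁ + w₂ • uj j₂ + w₃ • uj j₃ = u₀ + u := by
      have l0 : inner ℝ n₀ (w₁ • uj j₁ + w₂ • uj j₂ + w₃ • uj j₃ - (u₀ + u)) = (0 : ℝ) := by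
        simp only [u₀, inner_sub_right, inner_smul_right, inner_add_right, huj _ hj₁.1, huj _ hj₂.1,
          huj _ hj₃.1, hu0]
        simp
      have l1 : inner ℝ e₁ (w₁ • uj j₁ + w₂ • uj j₂ + w₃ • uj j₃ - (u₀ + u)) = (0 : ℝ) := by
        simp only [u₀, inner_sub_right, inner_smul_right, inner_add_right]
        field_simp at kx
        linarith
      have l2 : inner ℝ e₂ (w₁ • uj j₁ + w₂ • uj j₂ + w₃ • uj j₃ - (u₀ + u)) = (0 : ℝ) := by
        simp only [u₀, inner_sub_right, inner_smul_right, inner_add_right]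
        field_simp at ky
        linarith
      have l3 := hexp _ l0
      rw [l1, l2, zero_smul, zero_smul, add_zero] at l3
      exact sub_eq_zero.1 l3
    refine ⟨t₀ - (w₁ * tj j₁ + w₂ * tj j₂ + w₃ * tj j₃), ?_⟩
    have h1 := hDw w₁ w₂ w₃ k₁ k₂ k₃ k
    rw [hc₀ _ _ _ k, hw] at h1
    convert h1 using 1
    module

end TraceFEM

/-! ### Active elements above the triangle and the vertical neighbor. -/

namespace TraceFEM

/-- The component of `x` orthogonal to the unit vector `n₀`. -/
noncomputable def horizontal (n₀ x : E3) : E3 := x - (inner ℝ n₀ x : ℝ) • n₀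

theorem horizontal_add (n₀ x y : E3) : horizontal n₀ (x + y) = horizontal n₀ x + horizontal n₀ y := by
  simp only [horizontal, inner_add_right]
  module

theorem inner_horizontal {n₀ : E3} (hn : ‖n₀‖ = 1) (x : E3) : inner ℝ n₀ (horizontal n₀ x) = (0 : ℝ) := by
  rw [horizontal, inner_sub_right, real_inner_smul_right, real_inner_self_eq_norm_sq, hn]
  ring

theorem norm_horizontal_le {n₀ : E3} (hn : ‖n₀‖ = 1) (x : E3) : ‖horizontal n₀ x‖ ≤ ‖x‖ := by
  have h1 : ‖x‖ ^ 2 = ‖horizontal n₀ x‖ ^ 2 + (inner ℝ n₀ x : ℝ) ^ 2 := by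
    have h2 : x = horizontal n₀ x + (inner ℝ n₀ x : ℝ) • n₀ := by rw [horizontal]; module
    conv_lhs => rw [h2]
    rw [norm_add_sq_real, real_inner_smul_right, real_inner_comm n₀ (horizontal n₀ x), inner_horizontal hn, norm_smul, hn,
      Real.norm_eq_abs, mul_one, sq_abs]
    ring
  nlinarith [norm_nonneg x, norm_nonneg (horizontal n₀ x), sq_nonneg (inner ℝ n₀ x : ℝ)]

theorem horizontal_of_inner_eq_zero {n₀ u : E3} (hu : inner ℝ n₀ u = (0 : ℝ)) : horizontal n₀ u = u := by
  rw [horizontal, hu, zero_smul, sub_zero]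

theorem horizontal_smul_self {n₀ : E3} (hn : ‖n₀‖ = 1) (t : ℝ) : horizontal n₀ (t • n₀) = 0 := by
  rw [horizontal, real_inner_smul_right, real_inner_self_eq_norm_sq, hn]
  module

section

variable {σ κ τ h s : ℝ} {K : Mesh} {Γ : Set E3} {x₀ n₀ : E3} {ψ : E3 → ℝ} {T S : Finset E3}
  {z xs : E3}

/-- An element of the star of `S` that touches an active element at a point of the column is not too
small. -/
theorem Column.le_hT_of_touch (C : Column σ κ τ h s K Γ x₀ n₀ ψ T S z xs) {T₁ T₂ : Finset E3}
    (hT₁ : T₁ ∈ cutTets Γ K) (hT₂ : T₂ ∈ tets K) (hS₁ : S ⊆ T₁) (hS₂ : S ⊆ T₂) {g : E3}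
    (hg₁ : g ∈ tet T₁) (hg₂ : g ∈ tet T₂) (hg : g ≠ barycenter S) : 2 * h ≤ σ * κ * hT T₂ := by
  have hσ := C.σ_pos
  have hκ := C.one_le_κ
  obtain ⟨v, hv⟩ := C.S_nonempty
  by_cases hex : ∃ v' ∈ T₁, v' ∈ T₂ ∧ v ≠ v'
  · obtain ⟨v', h1, h2, hne⟩ := hex
    have h3 := C.shape.le_norm_sub_vertices hT₁.1 (hS₁ hv) h1 hne
    have h4 := norm_sub_le_hT (subset_tet T₂ (hS₂ hv)) (subset_tet T₂ h2)
    have h5 := C.le_hT T₁ hT₁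
    calc 2 * h ≤ κ * (2 * hT T₁) := by linarith
      _ ≤ κ * (σ * hT T₂) := mul_le_mul_of_nonneg_left
          (h3.trans (mul_le_mul_of_nonneg_left h4 hσ.le)) (by linarith)
      _ = _ := by ring
  -- If `v` is the only common vertex, the common point `g` is `v` and `S` is `{v}`, so `g` is its
  -- barycenter.
  · push Not at hex
    have hsub : (T₁ ∩ T₂ : Set E3) ⊆ {v} := fun v' hv' => (hex v' hv'.1 hv'.2).symm
    have h1 := convexHull_mono hsub (mem_convexHull_inter hT₁.1 hT₂ hg₁ hg₂)
    rw [convexHull_singleton, mem_singleton_iff] at h1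
    have h2 : S = {v} := by
      refine Finset.eq_singleton_iff_unique_mem.2 ⟨hv, fun v' hv' => ?_⟩
      exact (hex v' (hS₁ hv') (hS₂ hv')).symm
    refine absurd ?_ hg
    rw [h1, h2]
    simp [barycenter]

/-- The elements of the star of `S` that meet the column above an almost horizontal subset `D` of an
active element are active. -/
theorem Column.mem_cut_above (C : Column σ κ τ h s K Γ x₀ n₀ ψ T S z xs) {T' : Finset E3}
    (hT' : T' ∈ cutTets Γ K) {D : Set E3} (hDT : D ⊆ tet T')
    (hD : ∀ y ∈ D, |ψ y| ≤ τ * h ∧ ‖y - z‖ ≤ 9 * (s * h)) {θ : ℝ} (hθ : 0 < θ)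
    (hθκ : σ * κ * θ ≤ 1) (hτθ : 4 * σ * τ ≤ θ) {u : E3} (hu0 : inner ℝ n₀ u = (0 : ℝ))
    (hu : ‖u‖ ≤ s * h / (4 * σ))
    (hover : ∀ v, ‖horizontal n₀ v‖ ≤ θ * h → ∃ a : ℝ, z + u + v + a • n₀ ∈ D) {t₁ : ℝ}
    (ht₁ : z + u - t₁ • n₀ ∈ D) (ht₁' : t₁ ≤ 10 * (s * h)) {t : ℝ} (ht : t ∈ Ico 0 t₁)
    {T₁ T₂ : Finset E3} (hT₁ : T₁ ∈ cutTets Γ K) (hS₁ : S ⊆ T₁) (hg₁ : z + u - t • n₀ ∈ tet T₁)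
    (hT₂ : T₂ ∈ tets K) (hS₂ : S ⊆ T₂) (hg₂ : z + u - t • n₀ ∈ tet T₂) : T₂ ∈ cutTets Γ K := by
  have hσ := C.σ_pos
  have hκ := C.one_le_κ
  have hh := C.h_pos
  have hs := C.s_pos
  have hs' := C.s_le
  have hsh : s * h ≤ h / 200 := by nlinarith
  have hσκ : 2 ≤ σ * κ := by nlinarith [C.two_le_σ]
  have hθ2 : θ ≤ 1 / 2 := by nlinarith
  set g := z + u - t • n₀ with hg
  have hgb : ‖g - barycenter S‖ ≤ 13 * (s * h) :=
    C.norm_point_le hu (by rw [abs_of_nonneg ht.1]; linarith [ht.2])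
  have hgB : g ∈ Metric.ball x₀ (4 * h) := C.mem_ball_of_near (by linarith)
  have hDB : ∀ y ∈ D, y ∈ Metric.ball x₀ (4 * h) := fun y hy => by
    refine C.mem_ball_of_near ?_
    have h1 := norm_add_le (y - z) (z - barycenter S)
    rw [sub_add_sub_cancel] at h1
    linarith [C.z_near, (hD y hy).2]
  rcases le_or_gt 0 (ψ g) with hψ | hψ
  · exact C.mem_cut_of_nonneg hT₂ hS₂ hg₂ hgB hψ
  by_contra hncut
  have hne : T' ≠ T₂ := fun heq => hncut (heq ▸ hT')
  -- Quasi-uniformity says nothing about the element `T₂`, supposed inactive; its size is controlled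
  -- by an edge shared with the active `T₁`. For this the column had to avoid the barycenter.
  have hsize := C.le_hT_of_touch hT₁ hT₂ hS₁ hS₂ hg₁ hg₂ (C.avoid u hu0 hu t)
  have hθT : θ * h ≤ hT T₂ := by
    have h0 : 0 < σ * κ := by positivity
    refine le_of_mul_le_mul_left (a := σ * κ) ?_ h0
    nlinarith
  have hθh : 0 < θ * h := by positivity
  obtain ⟨w, hwg, hwT⟩ := C.shape.exists_closedBall hσ hT₂ hg₂ hθh hθT
  obtain ⟨f, α, hf₁, hf₂, hf₃⟩ := C.shape.exists_separation hT'.1 hT₂ hne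
  have hr0 : 0 < θ * h / σ := by positivity
  have hr1 : θ * h / σ ≤ θ * h := div_le_self hθh.le (by linarith [C.two_le_σ])
  -- The plane has `T'` on its lower side, because `g` in `T₂` lies vertically above a point of `D`
  -- in `T'`.
  have hfn : 0 ≤ f n₀ := by
    have h1 := hf₁ _ (hDT ht₁)
    have h2 := hf₂ _ hg₂
    have h3 : g = (z + u - t₁ • n₀) + (t₁ - t) • n₀ := by rw [hg]; module
    rw [h3, map_add, map_smul, smul_eq_mul] at h2
    by_contra hneg
    nlinarith [ht.2]
  obtain ⟨a, ha⟩ := hover (w - g) ((norm_horizontal_le C.normal _).trans hwg)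
  have hya : z + u + (w - g) + a • n₀ = w + (a + t) • n₀ := by rw [hg]; module
  rw [hya] at ha
  -- The center `w` of a ball in `T₂` is strictly on the upper side of the plane, so the point of
  -- `D` on its vertical line lies below it.
  have hneg : a + t < 0 := by
    have h1 := hf₁ _ (hDT ha)
    have h2 := hf₃ w (interior_mono hwT (by
      rw [interior_closedBall _ hr0.ne']
      exact Metric.mem_ball_self hr0))
    rw [map_add, map_smul, smul_eq_mul] at h1
    by_contra hcon
    nlinarith
  have hwb : ∀ v : E3, ‖v‖ ≤ θ * h → w + v ∈ Metric.ball x₀ (4 * h) := fun v hv => by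
    refine C.mem_ball_of_near ?_
    have h1 : w + v - barycenter S = (w - g) + v + (g - barycenter S) := by abel
    rw [h1]
    have h2 := norm_add₃_le (a := w - g) (b := v) (c := g - barycenter S)
    nlinarith
  have hwB : w ∈ Metric.ball x₀ (4 * h) := by simpa using hwb 0 (by simpa using hθh.le)
  -- Above `D` the value of `ψ` is at least `- τ * h`, and the radius of the ball gains more than
  -- that: the top of the ball is not below `Γ`, which makes `T₂` active.
  have h1 := C.le_sub_of_vertical (x := w + (a + t) • n₀) (t := -(a + t)) (by linarith) (hDB _ ha) (by
    rw [show w + (a + t) • n₀ + (-(a + t)) • n₀ = w by module]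
    exact hwB)
  rw [show w + (a + t) • n₀ + (-(a + t)) • n₀ = w by module] at h1
  have hnorm : ‖(θ * h / σ) • n₀‖ = θ * h / σ := by
    rw [norm_smul, C.normal, Real.norm_of_nonneg hr0.le, mul_one]
  have htopB : w + (θ * h / σ) • n₀ ∈ Metric.ball x₀ (4 * h) := hwb _ (by rw [hnorm]; exact hr1)
  have h2 := C.le_sub_of_vertical hr0.le hwB htopB
  have h3 := (abs_le.1 (hD _ ha).1).1
  have h4 : 4 * (τ * h) ≤ θ * h / σ := by
    rw [le_div_iff₀ hσ]
    nlinarith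
  refine hncut (C.mem_cut_of_nonneg hT₂ hS₂ (hwT ?_) htopB ?_)
  · rw [mem_closedBall_iff_norm, add_sub_cancel_left, hnorm]
  · have := C.τ_nonneg
    nlinarith

-- The ball is taken in `T'` near the centroid of the fat triangle. A vertical segment from it first
-- stays in `T'` up to the triangle by convexity, then runs through active elements containing `S`,
-- and ends in `T`.
set_option maxHeartbeats 1000000 in
theorem exists_vertical_neighbor {σ κ s : ℝ} (hσ : 2 ≤ σ) (hκ : 1 ≤ κ) (hs : 100 * (σ * κ) * s = 1) :
    ∃ c δ τ₀ : ℝ, 0 < c ∧ 0 < δ ∧ 0 < τ₀ ∧ ∀ {τ h : ℝ} {K : Mesh} {Γ : Set E3} {x₀ n₀ : E3}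
      {ψ : E3 → ℝ} {T S : Finset E3} {z xs : E3}, Column σ κ τ h s K Γ x₀ n₀ ψ T S z xs → τ ≤ τ₀ →
      ∃ T' ∈ cutTets Γ K, S ⊆ T' ∧ ENNReal.ofReal (c * h ^ 2) ≤ area (tet T' ∩ Γ) ∧
      ∃ (w : E3) (t : ℝ), 0 ≤ t ∧ t ≤ h ∧ Metric.closedBall w (δ * h) ⊆ tet T' ∧
        Metric.closedBall (w + t • n₀) (δ * h) ⊆ tet T ∧
        ∀ d ∈ Metric.closedBall w (δ * h), ∀ r ∈ Icc 0 t,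
          ∃ T₁ ∈ cutTets Γ K, S ⊆ T₁ ∧ d + r • n₀ ∈ tet T₁ := by
  have hσ0 : 0 < σ := by linarith
  have hκ0 : 0 < κ := by linarith
  have hσκ : 2 ≤ σ * κ := by nlinarith
  have hs0 : 0 < s := by
    by_contra hneg
    nlinarith [mul_nonneg (by linarith : (0 : ℝ) ≤ σ * κ) (by linarith : 0 ≤ -s)]
  obtain ⟨f, c, hf, hc, hfat⟩ := exists_fat_triangle hσ0 hκ0 hs0
  set R := s / (4 * σ) with hR
  have hR0 : 0 < R := by positivity
  have hRs : 8 * R ≤ s := by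
    rw [hR, ← mul_div_assoc, div_le_iff₀ (by positivity)]
    nlinarith
  -- Balls of size `θ * h` must fit into the column of radius `R * h`, and their shadows into the
  -- shadow of the triangle, of radius `f * h`.
  set θ := min (R / 16) (f / 4) with hθ
  have hθ0 : 0 < θ := by positivity
  have hθR : 16 * θ ≤ R := by linarith [min_le_left (R / 16) (f / 4)]
  have hθf : 4 * θ ≤ f := by linarith [min_le_right (R / 16) (f / 4)]
  have hθκ : σ * κ * θ ≤ 1 := by
    have : σ * κ * θ ≤ σ * κ * s := by gcongr; linarith
    linarith
  have hκθ : κ * θ ≤ 1 := by nlinarith [mul_pos hκ0 hθ0]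
  refine ⟨c, θ / σ, min (s / 2) (θ / (4 * σ)), hc, by positivity, by positivity, ?_⟩
  intro τ h K Γ x₀ n₀ ψ T S z xs C hτ
  have hτs : 2 * τ ≤ s := by linarith [hτ.trans (min_le_left _ _)]
  have hτθ : 4 * σ * τ ≤ θ := by
    have := hτ.trans (min_le_right _ _)
    rw [le_div_iff₀ (by positivity)] at this
    linarith
  have hh := C.h_pos
  have hs' := C.s_le
  have hn := C.normal
  have hRh : s * h / (4 * σ) = R * h := by rw [hR]; field_simp
  have hRh2 : s * h / (8 * σ) = R * h / 2 := by rw [hR]; field_simp; norm_num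
  have hRh3 : s * h / (2 * σ) = 2 * (R * h) := by rw [hR]; field_simp; norm_num
  have hRh4 : s * h / (16 * σ) = R * h / 4 := by rw [hR]; field_simp; norm_num
  have hsh : 0 < s * h := by positivity
  have hRsh : 8 * (R * h) ≤ s * h := by nlinarith
  have hθRh : 16 * (θ * h) ≤ R * h := by nlinarith
  have hshh : s * h ≤ h / 200 := by nlinarith
  have hθh : 0 < θ * h := by positivity
  have hδ : θ / σ * h = θ * h / σ := by ring
  have hδ1 : θ * h / σ ≤ θ * h := div_le_self hθh.le (by linarith)
  have hτh : τ * h ≤ θ * h := by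
    have : τ ≤ θ := by nlinarith [C.τ_nonneg]
    gcongr
  obtain ⟨T', hT', hST', harea, D, hDT, hD, u₀, t₀, hu₀, hu₀n, hc₀, hover⟩ := hfat C hτs
  rw [hRh2] at hu₀n
  set c₀ := z + u₀ - t₀ • n₀ with hc₀def
  have hDb : ∀ y ∈ D, y ∈ Metric.ball x₀ (4 * h) := fun y hy => by
    refine C.mem_ball_of_near ?_
    have h1 := norm_add_le (y - z) (z - barycenter S)
    rw [sub_add_sub_cancel] at h1
    linarith [C.z_near, (hD y hy).2]
  have hθT' : θ * h ≤ hT T' := by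
    refine le_of_mul_le_mul_left (a := κ) ?_ hκ0
    nlinarith [C.le_hT T' hT']
  obtain ⟨w, hwc, hwT⟩ := C.shape.exists_closedBall hσ0 hT'.1 (hDT hc₀) hθh hθT'
  have ht₀ : |t₀| ≤ 9 * (s * h) := by
    have h1 := (hD c₀ hc₀).2
    have h2 := C.abs_inner_le (c₀ - z)
    rw [show c₀ - z = u₀ - t₀ • n₀ by rw [hc₀def]; abel] at h1 h2
    rw [inner_sub_right, hu₀, real_inner_smul_right, C.inner_self, zero_sub, mul_one, abs_neg] at h2
    linarith
  have htopB : z + u₀ ∈ Metric.ball x₀ (4 * h) := by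
    simpa using C.point_mem_ball (u := u₀) (t := 0) (by rw [hRh]; linarith [mul_pos hR0 hh])
      (by rw [abs_zero]; positivity)
  have ht₀' : θ * h ≤ t₀ := by
    have h1 := C.ψ_top u₀ hu₀ (by rw [hRh]; linarith [mul_pos hR0 hh])
    rw [hRh4] at h1
    have h2 := (abs_le.1 (hD c₀ hc₀).1).2
    have h3 : 0 ≤ t₀ := by
      by_contra hneg
      have h4 := C.le_sub_of_vertical (x := z + u₀) (t := -t₀) (by linarith) htopB (by
        rw [show z + u₀ + -t₀ • n₀ = c₀ by rw [hc₀def]; module]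
        exact hDb _ hc₀)
      rw [show z + u₀ + -t₀ • n₀ = c₀ by rw [hc₀def]; module] at h4
      linarith
    have h4 := (abs_le.1 (C.abs_sub_le htopB (hDb _ hc₀))).2
    rw [show z + u₀ - c₀ = t₀ • n₀ by rw [hc₀def]; abel, norm_smul, hn, Real.norm_of_nonneg h3] at h4
    linarith
  have hwc' := abs_le.1 (C.abs_inner_le (w - c₀))
  -- Lifting by `t` brings `w` to the height of `z`, so the lifted ball differs from the one around
  -- `z` by a horizontal shift only.
  set t := (inner ℝ n₀ (z - w) : ℝ) with ht
  have htt₀ : t = t₀ - inner ℝ n₀ (w - c₀) := by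
    rw [ht, show z - w = t₀ • n₀ - u₀ - (w - c₀) by rw [hc₀def]; abel, inner_sub_right, inner_sub_right,
      hu₀, real_inner_smul_right, C.inner_self]
    ring
  have hdec : ∀ d : E3, d = z + horizontal n₀ (d - z) - (inner ℝ n₀ (z - d) : ℝ) • n₀ := fun d => by
    rw [horizontal, ← neg_sub d z, inner_neg_right]
    module
  have hhor : ∀ d : E3, horizontal n₀ (d - z) = u₀ + horizontal n₀ (d - c₀) := fun d => by
    rw [show d - z = u₀ + (-t₀) • n₀ + (d - c₀) by rw [hc₀def]; module, horizontal_add, horizontal_add,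
      horizontal_smul_self hn, horizontal_of_inner_eq_zero hu₀, add_zero]
  refine ⟨T', hT', hST', harea, w, t, by linarith, ?_, by rwa [hδ], ?_, ?_⟩
  · have := (abs_le.1 ht₀).2
    linarith
  · rw [hδ]
    refine Subset.trans (Metric.closedBall_subset_closedBall' ?_) C.ball_sub
    rw [dist_eq_norm, hRh3]
    have h1 : w + t • n₀ - z = horizontal n₀ (w - z) := by
      conv_lhs => rw [hdec w]
      module
    rw [h1, hhor]
    have h2 := norm_add_le u₀ (horizontal n₀ (w - c₀))
    have h3 := norm_horizontal_le hn (w - c₀)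
    linarith
  · intro d hd r hr
    have hdT' : d ∈ tet T' := hwT (by rwa [hδ] at hd)
    rw [hδ, mem_closedBall_iff_norm] at hd
    have hdc : ‖horizontal n₀ (d - c₀)‖ ≤ 2 * (θ * h) := by
      refine (norm_horizontal_le hn _).trans ?_
      have := norm_add_le (d - w) (w - c₀)
      rw [sub_add_sub_cancel] at this
      linarith
    set u := horizontal n₀ (d - z) with hu
    set td := (inner ℝ n₀ (z - d) : ℝ) with htd
    have hu0 : inner ℝ n₀ u = (0 : ℝ) := inner_horizontal hn _
    have hun : ‖u‖ ≤ R * h - θ * h := by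
      rw [hu, hhor]
      have := norm_add_le u₀ (horizontal n₀ (d - c₀))
      linarith
    have hun' : ‖u‖ ≤ s * h / (4 * σ) := by rw [hRh]; linarith
    have hdr : d + r • n₀ = z + u - (td - r) • n₀ := by
      conv_lhs => rw [hdec d]
      module
    have htdt : td - t = inner ℝ n₀ (w - d) := by
      rw [htd, ht, ← inner_sub_right]
      congr 1
      abel
    have hlow : -(θ * h) ≤ td - r := by
      have h1 := (abs_le.1 (C.abs_inner_le (w - d))).1
      rw [norm_sub_rev] at h1
      linarith [hr.2]
    -- The quantity `td - r` is the depth below `z`. If it is not positive, the point still lies in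
    -- the ball in `T`, because the depth is at least `- θ * h`.
    rcases le_or_gt (td - r) 0 with hp | hp
    · refine ⟨T, C.mem_cut, C.S_sub, C.ball_sub ?_⟩
      rw [hdr, mem_closedBall_iff_norm, hRh3, show z + u - (td - r) • n₀ - z = u - (td - r) • n₀ by abel]
      refine (norm_sub_le _ _).trans ?_
      rw [norm_smul, hn, Real.norm_of_nonpos hp]
      linarith [mul_pos hR0 hh]
    · have hoverD : ∀ v, ‖horizontal n₀ v‖ ≤ θ * h → ∃ a : ℝ, z + u + v + a • n₀ ∈ D := fun v hv => by
        obtain ⟨a, ha⟩ := hover (horizontal n₀ (d - c₀) + horizontal n₀ v)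
          (by rw [inner_add_right, inner_horizontal hn, inner_horizontal hn, add_zero])
          ((norm_add_le _ _).trans (by nlinarith))
        refine ⟨a - t₀ - inner ℝ n₀ v, ?_⟩
        convert ha using 1
        rw [hu, hhor, hc₀def, horizontal.eq_def n₀ v]
        module
      obtain ⟨a, ha⟩ := hoverD 0 (by rw [horizontal]; simpa using hθh.le)
      have hy : z + u - (-a) • n₀ ∈ D := by convert ha using 1; module
      have hya : |(-a)| ≤ 9 * (s * h) := by
        have h1 := (hD _ hy).2
        have h2 := C.abs_inner_le (z + u - (-a) • n₀ - z)
        rw [show z + u - (-a) • n₀ - z = u - (-a) • n₀ by abel] at h1 h2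
        rw [inner_sub_right, hu0, real_inner_smul_right, C.inner_self, zero_sub, mul_one, abs_neg] at h2
        linarith
      -- The triangle is crossed at depth `-a`: points at or below it are on a segment in `T'`,
      -- points above it are covered by `Column.mem_cut_above`.
      rcases le_or_gt (-a) (td - r) with hle | hlt
      · refine ⟨T', hT', hST', ?_⟩
        have hy' : d + (td + a) • n₀ ∈ tet T' := by
          convert hDT hy using 1
          conv_lhs => rw [hdec d]
          module
        rcases eq_or_lt_of_le hr.1 with h0 | h0
        · rw [← h0, zero_smul, add_zero]
          exact hdT'
        · have hpos : 0 < td + a := by linarith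
          have := (convex_tet T').add_smul_mem hdT' hy' (t := r / (td + a))
            ⟨by positivity, (div_le_one hpos).2 (by linarith)⟩
          rwa [smul_smul, div_mul_cancel₀ _ hpos.ne'] at this
      · rw [hdr]
        have hl : -a ≤ 10 * (s * h) := by linarith [(abs_le.1 hya).2]
        exact C.exists_mem_star hun' hl (fun t' ht' T₁ hT₁ hS₁ hg₁ T₂ hT₂ hS₂ hg₂ =>
          C.mem_cut_above hT' hDT hD hθ0 hθκ hτθ hu0 hun' hoverD hy hl ht' hT₁ hS₁ hg₁ hT₂ hS₂ hg₂)
          _ ⟨hp.le, hlt.le⟩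

/-- A ball in a neighbor `T'` of `T` can be moved in the direction `n₁` into a ball in `T` without
leaving the active neighbors of `T`, and `T'` contains a large part of `Γ`. -/
def HasVerticalNeighbor (c δ h : ℝ) (Γ : Set E3) (K : Mesh) (n₁ : E3) (T : Finset E3) : Prop :=
  ∃ T' ∈ nbrs Γ K T, ENNReal.ofReal (c * h ^ 2) ≤ area (tet T' ∩ Γ) ∧
    ∃ (w : E3) (t : ℝ), 0 ≤ t ∧ t ≤ h ∧ Metric.closedBall w (δ * h) ⊆ tet T' ∧
      Metric.closedBall (w + t • n₁) (δ * h) ⊆ tet T ∧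
      ∀ d ∈ Metric.closedBall w (δ * h), ∀ r ∈ Icc 0 t, ∃ T₁ ∈ nbrs Γ K T, d + r • n₁ ∈ tet T₁

theorem HasVerticalNeighbor.mono {c c' δ δ' h : ℝ} {Γ : Set E3} {K : Mesh} {n₁ : E3} {T : Finset E3}
    (H : HasVerticalNeighbor c δ h Γ K n₁ T) (hh : 0 ≤ h) (hc : c' ≤ c) (hδ : δ' ≤ δ) :
    HasVerticalNeighbor c' δ' h Γ K n₁ T := by
  obtain ⟨T', hT', harea, w, t, ht0, hth, h1, h2, h3⟩ := H
  have hshrink : ∀ w : E3, Metric.closedBall w (δ' * h) ⊆ Metric.closedBall w (δ * h) := fun w =>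
    Metric.closedBall_subset_closedBall (by gcongr)
  exact ⟨T', hT', (ENNReal.ofReal_le_ofReal (by gcongr)).trans harea, w, t, ht0, hth,
    (hshrink _).trans h1, (hshrink _).trans h2, fun d hd => h3 d (hshrink _ hd)⟩

/-- Three cases: `T` reaches at most `ε * h` below `Γ` in terms of `ψ`, the same above `Γ` (reverse
the orientation), or it reaches farther on both sides and is its own neighbor, with translation
zero. -/
theorem exists_hasVerticalNeighbor {σ κ : ℝ} (hσ : 2 ≤ σ) (hκ : 1 ≤ κ) :
    ∃ c δ τ : ℝ, 0 < c ∧ 0 < δ ∧ 0 < τ ∧ τ ≤ 1 / 2 ∧ ∀ {h : ℝ} {K : Mesh} {Γ : Set E3} {x₀ n₀ : E3}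
      {ψ : E3 → ℝ} {T : Finset E3}, FlatSetting σ κ τ h K Γ x₀ n₀ ψ → T ∈ cutTets Γ K →
      x₀ ∈ tet T → x₀ ∈ Γ → ∃ n₁ : E3, (n₁ = n₀ ∨ n₁ = -n₀) ∧ HasVerticalNeighbor c δ h Γ K n₁ T := by
  have hσκ : 0 < σ * κ := by positivity
  set s := 1 / (100 * (σ * κ)) with hs
  have hs0 : 0 < s := by positivity
  have hs1 : 100 * (σ * κ) * s = 1 := by rw [hs]; field_simp
  obtain ⟨c, δ, τ₀, hc, hδ, hτ₀, hmain⟩ := exists_vertical_neighbor hσ hκ hs1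
  set ε := s / (16 * σ) with hε
  have hε0 : 0 < ε := by positivity
  have hεκ : κ * ε ≤ 1 := by
    have h1 : ε ≤ s := div_le_self hs0.le (by linarith)
    have h2 : κ * s ≤ 1 := by nlinarith [mul_pos (by linarith : 0 < κ) hs0]
    nlinarith
  set τ := min (min τ₀ (s / 2)) (1 / 2) with hτ
  have hτle : τ ≤ τ₀ := (min_le_left _ _).trans (min_le_left _ _)
  have hτs : 2 * τ ≤ s := by linarith [(min_le_left (min τ₀ (s / 2)) (1 / 2)).trans (min_le_right _ _)]
  refine ⟨min c ((ε / 4 / σ) ^ 2), min δ (1 / (σ * κ)), τ, by positivity, by positivity, by positivity,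
    min_le_right _ _, ?_⟩
  have hcol : ∀ {h : ℝ} {K : Mesh} {Γ : Set E3} {x₀ n₀ : E3} {ψ : E3 → ℝ} {T : Finset E3},
      FlatSetting σ κ τ h K Γ x₀ n₀ ψ → T ∈ cutTets Γ K → x₀ ∈ tet T → x₀ ∈ Γ →
      (∀ x ∈ tet T, -(ε * h) ≤ ψ x) →
      HasVerticalNeighbor (min c ((ε / 4 / σ) ^ 2)) (min δ (1 / (σ * κ))) h Γ K n₀ T := by
    intro h K Γ x₀ n₀ ψ T H hT hx₀ hx₀Γ hlow
    obtain ⟨S, z, xs, C⟩ := H.exists_column hs1 hτs hT hx₀ hx₀Γ hlow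
    have hnbr : ∀ T₁ ∈ cutTets Γ K, S ⊆ T₁ → T₁ ∈ nbrs Γ K T := fun T₁ hT₁ hS =>
      ⟨hT₁, _, C.barycenter_mem_tet hS, C.barycenter_mem_tet C.S_sub⟩
    obtain ⟨T', hT', hS', harea, w, t, ht0, hth, h1, h2, h3⟩ := hmain C hτle
    refine HasVerticalNeighbor.mono ⟨T', hnbr T' hT' hS', harea, w, t, ht0, hth, h1, h2,
      fun d hd r hr => ?_⟩ H.h_pos.le (min_le_left _ _) (min_le_left _ _)
    obtain ⟨T₁, hT₁, hS₁, h4⟩ := h3 d hd r hr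
    exact ⟨T₁, hnbr T₁ hT₁ hS₁, h4⟩
  intro h K Γ x₀ n₀ ψ T H hT hx₀ hx₀Γ
  have hh := H.h_pos
  by_cases hlow : ∀ x ∈ tet T, -(ε * h) ≤ ψ x
  · exact ⟨n₀, Or.inl rfl, hcol H hT hx₀ hx₀Γ hlow⟩
  by_cases hup : ∀ x ∈ tet T, ψ x ≤ ε * h
  · exact ⟨-n₀, Or.inr rfl, hcol H.neg hT hx₀ hx₀Γ fun x hx => neg_le_neg (hup x hx)⟩
  push Not at hlow hup
  obtain ⟨u₁, hu₁, h1⟩ := hlow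
  obtain ⟨u₂, hu₂, h2⟩ := hup
  have hself : T ∈ nbrs Γ K T := ⟨hT, x₀, hx₀, hx₀⟩
  obtain ⟨w, -, hw⟩ := H.shape.exists_closedBall (by linarith) hT.1 hx₀ (H.shape.hT_pos hT.1) le_rfl
  have hball : Metric.closedBall w (min δ (1 / (σ * κ)) * h) ⊆ tet T := by
    refine (Metric.closedBall_subset_closedBall ?_).trans hw
    calc min δ (1 / (σ * κ)) * h ≤ 1 / (σ * κ) * (κ * TraceFEM.hT T) := by
          gcongr
          · exact min_le_right _ _
          · exact H.le_hT T hT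
      _ = TraceFEM.hT T / σ := by field_simp
  refine ⟨n₀, Or.inl rfl, T, hself, (ENNReal.ofReal_le_ofReal ?_).trans
    (H.le_area_of_two_sides hT hx₀ hε0 hεκ hu₁ hu₂ h1 h2), w, 0, le_rfl, hh.le, hball,
    by simpa using hball, fun d hd r hr => ⟨T, hself, ?_⟩⟩
  · calc min c ((ε / 4 / σ) ^ 2) * h ^ 2 ≤ (ε / 4 / σ) ^ 2 * h ^ 2 := by gcongr; exact min_le_right _ _
      _ = (ε * h / 4 / σ) ^ 2 := by ring
  · rw [le_antisymm hr.2 hr.1, zero_smul, add_zero]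
    exact hball hd

end

end TraceFEM

namespace TraceFEM

/-! ### Norm equivalences for polynomials -/

/-- By the kernel condition `f` factors through the finite-dimensional range of `g`, on which every
linear map is bounded. -/
theorem _root_.LinearMap.exists_norm_le_of_ker_le {V E F : Type*} [AddCommGroup V] [Module ℝ V]
    [FiniteDimensional ℝ V] [NormedAddCommGroup E] [NormedSpace ℝ E] [NormedAddCommGroup F]
    [NormedSpace ℝ F] (f : V →ₗ[ℝ] E) (g : V →ₗ[ℝ] F) (h : LinearMap.ker g ≤ LinearMap.ker f) :
    ∃ C : ℝ, 0 < C ∧ ∀ v, ‖f v‖ ≤ C * ‖g v‖ := by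
  obtain ⟨s, hs⟩ := LinearMap.exists_rightInverse_of_surjective g.rangeRestrict
    (LinearMap.range_eq_top.2 g.surjective_rangeRestrict)
  have : FiniteDimensional ℝ (LinearMap.range g) := inferInstance
  let T : LinearMap.range g →L[ℝ] E := LinearMap.toContinuousLinearMap (f ∘ₗ s)
  refine ⟨‖T‖ + 1, by positivity, fun v => ?_⟩
  have h1 : f v = T (g.rangeRestrict v) := by
    have h2 : v - s (g.rangeRestrict v) ∈ LinearMap.ker g := by
      have h3 := LinearMap.congr_fun hs (g.rangeRestrict v)
      have h4 : g (s (g.rangeRestrict v)) = g v := congrArg Subtype.val h3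
      simp [h4]
    have h5 := h h2
    simp only [LinearMap.mem_ker, map_sub, sub_eq_zero] at h5
    exact h5
  have h6 := T.le_opNorm (g.rangeRestrict v)
  have h7 : ‖g.rangeRestrict v‖ = ‖g v‖ := rfl
  rw [h1]
  rw [h7] at h6
  exact h6.trans (mul_le_mul_of_nonneg_right (by linarith) (norm_nonneg _))

theorem memLp_restrict_of_continuous {F : Type*} [NormedAddCommGroup F] {f : E3 → F}
    (hf : Continuous f) {A : Set E3} (hA : IsCompact A) : MemLp f 2 (volume.restrict A) := by
  obtain ⟨C, hC⟩ := hA.exists_bound_of_continuousOn hf.continuousOn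
  have : IsFiniteMeasure (volume.restrict A) := ⟨by simpa using hA.measure_lt_top⟩
  have hm : AEStronglyMeasurable f (volume.restrict A) := by
    have : SecondCountableTopologyEither E3 F := inferInstance
    exact hf.aestronglyMeasurable
  exact MemLp.of_bound hm C (ae_restrict_of_forall_mem hA.measurableSet hC)

/-- A linear family of square integrable functions, as a linear map into `L²`. -/
noncomputable def toLpMap {V F : Type*} [AddCommGroup V] [Module ℝ V] [NormedAddCommGroup F]
    [NormedSpace ℝ F] {μ : Measure E3} (Φ : V →ₗ[ℝ] E3 → F) (h : ∀ v, MemLp (Φ v) 2 μ) :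
    V →ₗ[ℝ] Lp F 2 μ where
  toFun v := (h v).toLp
  map_add' v w := by
    rw [← MemLp.toLp_add]
    exact MemLp.toLp_congr _ _ (by rw [map_add])
  map_smul' c v := by
    rw [RingHom.id_apply, ← MemLp.toLp_const_smul]
    exact MemLp.toLp_congr _ _ (by rw [map_smul])

theorem norm_toLpMap {V F : Type*} [AddCommGroup V] [Module ℝ V] [NormedAddCommGroup F]
    [NormedSpace ℝ F] {μ : Measure E3} (Φ : V →ₗ[ℝ] E3 → F) (h : ∀ v, MemLp (Φ v) 2 μ) (v : V) :
    ‖toLpMap Φ h v‖ = (eLpNorm (Φ v) 2 μ).toReal := Lp.norm_toLp _ (h v)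

/-- A continuous function of zero `L²` norm on `B` vanishes on the interior of `B`, so the
hypothesis `h` is the kernel inclusion of the abstract lemma. -/
theorem exists_eLpNorm_le {V F G : Type*} [AddCommGroup V] [Module ℝ V] [FiniteDimensional ℝ V]
    [NormedAddCommGroup F] [NormedSpace ℝ F] [NormedAddCommGroup G] [NormedSpace ℝ G]
    (Φ : V →ₗ[ℝ] E3 → F) (Ψ : V →ₗ[ℝ] E3 → G) (hΦ : ∀ v, Continuous (Φ v))
    (hΨ : ∀ v, Continuous (Ψ v)) {A B : Set E3} (hA : IsCompact A) (hB : IsCompact B)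
    (h : ∀ v, (∀ x ∈ interior B, Ψ v x = 0) → Φ v = 0) :
    ∃ C : ℝ, 0 < C ∧ ∀ v, eLpNorm (Φ v) 2 (volume.restrict A) ≤
      ENNReal.ofReal C * eLpNorm (Ψ v) 2 (volume.restrict B) := by
  have hΦA := fun v => memLp_restrict_of_continuous (hΦ v) hA
  have hΨB := fun v => memLp_restrict_of_continuous (hΨ v) hB
  obtain ⟨C, hC, hfg⟩ := LinearMap.exists_norm_le_of_ker_le (toLpMap Φ hΦA) (toLpMap Ψ hΨB)
    (fun v hv => by
      have h1 : eLpNorm (Ψ v) 2 (volume.restrict B) = 0 := by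
        have h2 := norm_toLpMap Ψ hΨB v
        rw [LinearMap.mem_ker.1 hv, norm_zero] at h2
        exact ((ENNReal.toReal_eq_zero_iff _).1 h2.symm).resolve_right (hΨB v).eLpNorm_ne_top
      rw [eLpNorm_eq_zero_iff (hΨB v).aestronglyMeasurable (by norm_num)] at h1
      have h2 : Φ v = 0 := by
        refine h v fun x hx => ?_
        have h3 : Ψ v =ᵐ[volume.restrict (interior B)] 0 :=
          ae_restrict_of_ae_restrict_of_subset interior_subset h1
        exact (Measure.eqOn_open_of_ae_eq h3 isOpen_interior (hΨ v).continuousOn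
          continuousOn_const) hx
      rw [LinearMap.mem_ker, ← norm_eq_zero, norm_toLpMap, h2, eLpNorm_zero, ENNReal.toReal_zero])
  refine ⟨C, hC, fun v => ?_⟩
  have h1 := hfg v
  rw [norm_toLpMap, norm_toLpMap] at h1
  rw [← ENNReal.ofReal_toReal (hΦA v).eLpNorm_ne_top, ← ENNReal.ofReal_toReal (hΨB v).eLpNorm_ne_top,
    ← ENNReal.ofReal_mul hC.le]
  exact ENNReal.ofReal_le_ofReal h1

/-- `f` is a polynomial function of degree at most `k`. -/
def IsPoly (k : ℕ) (f : E3 → ℝ) : Prop :=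
  ∃ p : MvPolynomial (Fin 3) ℝ, p.totalDegree ≤ k ∧ ∀ x, f x = MvPolynomial.eval (fun i => x i) p

theorem IsPoly.sub {k : ℕ} {f g : E3 → ℝ} (hf : IsPoly k f) (hg : IsPoly k g) :
    IsPoly k fun x => f x - g x := by
  obtain ⟨p, hp, hfp⟩ := hf
  obtain ⟨r, hr, hgr⟩ := hg
  exact ⟨p - r, (MvPolynomial.totalDegree_sub p r).trans (max_le hp hr), fun x => by
    simp only [map_sub, hfp, hgr]⟩

theorem totalDegree_bind₁_le {p : MvPolynomial (Fin 3) ℝ} {l : Fin 3 → MvPolynomial (Fin 3) ℝ}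
    (hl : ∀ i, (l i).totalDegree ≤ 1) : (MvPolynomial.bind₁ l p).totalDegree ≤ p.totalDegree := by
  rw [← MvPolynomial.aeval_eq_bind₁, MvPolynomial.aeval_def, MvPolynomial.eval₂_eq]
  refine MvPolynomial.totalDegree_finsetSum_le fun d hd => ?_
  refine (MvPolynomial.totalDegree_mul _ _).trans ?_
  have h1 : (algebraMap ℝ (MvPolynomial (Fin 3) ℝ) (MvPolynomial.coeff d p)).totalDegree = 0 :=
    MvPolynomial.totalDegree_C _
  rw [h1, zero_add]
  refine (MvPolynomial.totalDegree_finsetProd _ _).trans ?_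
  refine le_trans ?_ (MvPolynomial.le_totalDegree hd)
  rw [Finsupp.sum]
  refine Finset.sum_le_sum fun i _ => (MvPolynomial.totalDegree_pow _ _).trans ?_
  nlinarith [hl i]

theorem IsPoly.comp_affine {k : ℕ} {f : E3 → ℝ} (hf : IsPoly k f) (w : E3) (ρ : ℝ) :
    IsPoly k fun x => f (w + ρ • x) := by
  obtain ⟨p, hp, hfp⟩ := hf
  refine ⟨MvPolynomial.bind₁ (fun i => MvPolynomial.C (w i) + MvPolynomial.C ρ * MvPolynomial.X i) p,
    (totalDegree_bind₁_le fun i => ?_).trans hp, fun x => ?_⟩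
  · refine (MvPolynomial.totalDegree_add _ _).trans (max_le (by simp) ?_)
    refine (MvPolynomial.totalDegree_mul _ _).trans ?_
    simp
  · beta_reduce
    rw [hfp]
    simp only [← MvPolynomial.aeval_eq_eval]
    rw [MvPolynomial.aeval_bind₁]
    simp

theorem analyticOnNhd_eval (p : MvPolynomial (Fin 3) ℝ) :
    AnalyticOnNhd ℝ (fun x : E3 => MvPolynomial.eval (fun i => x i) p) univ := by
  have h := AnalyticOnNhd.aeval_mvPolynomial (𝕜 := ℝ) (f := fun (x : E3) (i : Fin 3) => x i)
    (s := univ) (fun i => (EuclideanSpace.proj (𝕜 := ℝ) i).analyticOnNhd univ) p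
  simpa [MvPolynomial.aeval_eq_eval] using h

theorem contDiff_eval (p : MvPolynomial (Fin 3) ℝ) :
    ContDiff ℝ 2 (fun x : E3 => MvPolynomial.eval (fun i => x i) p) :=
  contDiffOn_univ.1 ((analyticOnNhd_eval p).contDiffOn uniqueDiffOn_univ)

theorem IsPoly.contDiff {k : ℕ} {f : E3 → ℝ} (hf : IsPoly k f) : ContDiff ℝ 2 f := by
  obtain ⟨p, -, hfp⟩ := hf
  rw [funext hfp]
  exact contDiff_eval p

theorem IsPoly.differentiable {k : ℕ} {f : E3 → ℝ} (hf : IsPoly k f) : Differentiable ℝ f :=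
  hf.contDiff.differentiable (by norm_num)

theorem _root_.ContDiff.continuous_gradient {f : E3 → ℝ} (hf : ContDiff ℝ 2 f) : Continuous (gradient f) :=
  (LinearIsometryEquiv.continuous _).comp (hf.continuous_fderiv (by norm_num))

theorem IsPoly.continuous_gradient {k : ℕ} {f : E3 → ℝ} (hf : IsPoly k f) :
    Continuous (gradient f) := hf.contDiff.continuous_gradient

/-- Evaluation of polynomials of degree at most `k`. -/
noncomputable def evalMap (k : ℕ) : MvPolynomial.restrictTotalDegree (Fin 3) ℝ k →ₗ[ℝ] E3 → ℝ where
  toFun p x := MvPolynomial.eval (fun i => x i) p.1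
  map_add' p r := by ext x; simp
  map_smul' c p := by ext x; simp [MvPolynomial.smul_eval]

/-- The gradients of polynomials of degree at most `k`. -/
noncomputable def gradientMap (k : ℕ) :
    MvPolynomial.restrictTotalDegree (Fin 3) ℝ k →ₗ[ℝ] E3 → E3 where
  toFun p := gradient (evalMap k p)
  map_add' p r := by
    ext1 x
    have hp := ((contDiff_eval p.1).differentiable (by norm_num)) x
    have hr := ((contDiff_eval r.1).differentiable (by norm_num)) x
    have h : fderiv ℝ (evalMap k (p + r)) x = fderiv ℝ (evalMap k p) x + fderiv ℝ (evalMap k r) x := by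
      rw [map_add]
      exact fderiv_add hp hr
    rw [gradient, h, map_add]
    rfl
  map_smul' c p := by
    ext1 x
    have hp := ((contDiff_eval p.1).differentiable (by norm_num)) x
    have h : fderiv ℝ (evalMap k (c • p)) x = c • fderiv ℝ (evalMap k p) x := by
      rw [map_smul]
      exact fderiv_const_smul hp c
    rw [gradient, h, map_smulₛₗ]
    rfl

theorem gradient_const_fun (c : ℝ) : gradient (fun _ : E3 => c) = 0 := by
  ext1 x
  simp [gradient]

/-- Norm comparison on the finite-dimensional space of polynomials. A polynomial that vanishes, or
has zero gradient, on a ball is constant everywhere by the identity theorem for analytic functions.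
-/
theorem exists_gradient_le_unitBall (k : ℕ) {Λ : ℝ} : ∃ C : ℝ, 0 < C ∧ ∀ f, IsPoly k f →
    eLpNorm (gradient f) 2 (volume.restrict (Metric.closedBall 0 Λ)) ≤
      ENNReal.ofReal C * eLpNorm f 2 (volume.restrict (Metric.closedBall 0 1)) ∧
    eLpNorm (gradient f) 2 (volume.restrict (Metric.closedBall 0 Λ)) ≤
      ENNReal.ofReal C * eLpNorm (gradient f) 2 (volume.restrict (Metric.closedBall 0 1)) := by
  have hev : ∀ v, Continuous (evalMap k v) := fun v => (contDiff_eval v.1).continuous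
  have hgr : ∀ v, Continuous (gradientMap k v) := fun v => (contDiff_eval v.1).continuous_gradient
  have h0 : (0 : E3) ∈ interior (Metric.closedBall (0 : E3) 1) := by
    rw [interior_closedBall _ one_ne_zero]
    simp
  have hnhds := isOpen_interior.mem_nhds h0
  obtain ⟨C₁, hC₁, h1⟩ := exists_eLpNorm_le (gradientMap k) (evalMap k) hgr hev
    (isCompact_closedBall (0 : E3) Λ) (isCompact_closedBall (0 : E3) 1) (fun v hv => by
      have h2 : evalMap k v = fun _ => (0 : ℝ) :=
        (analyticOnNhd_eval v.1).eq_of_eventuallyEq (g := fun _ => 0) (z₀ := 0)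
          analyticOnNhd_const (Filter.eventually_of_mem hnhds hv)
      change gradient (evalMap k v) = 0
      rw [h2, gradient_const_fun])
  obtain ⟨C₂, hC₂, h2⟩ := exists_eLpNorm_le (gradientMap k) (gradientMap k) hgr hgr
    (isCompact_closedBall (0 : E3) Λ) (isCompact_closedBall (0 : E3) 1) (fun v hv => by
      have hd : DifferentiableOn ℝ (evalMap k v) (interior (Metric.closedBall (0 : E3) 1)) :=
        ((contDiff_eval v.1).differentiable (by norm_num)).differentiableOn
      have hpre : IsPreconnected (interior (Metric.closedBall (0 : E3) 1)) :=
        (convex_closedBall _ _).interior.isPreconnected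
      have hc : ∀ x ∈ interior (Metric.closedBall (0 : E3) 1),
          evalMap k v x = evalMap k v 0 := fun x hx =>
        isOpen_interior.is_const_of_fderiv_eq_zero hpre hd (fun y hy => by
          have h3 : gradient (evalMap k v) y = 0 := hv y hy
          rw [gradient] at h3
          exact (LinearIsometryEquiv.map_eq_zero_iff _).1 h3) hx h0
      have h2 : evalMap k v = fun _ => evalMap k v 0 :=
        (analyticOnNhd_eval v.1).eq_of_eventuallyEq (g := fun _ => evalMap k v 0) (z₀ := 0)
          analyticOnNhd_const (Filter.eventually_of_mem hnhds hc)
      change gradient (evalMap k v) = 0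
      rw [h2, gradient_const_fun])
  refine ⟨max C₁ C₂, lt_max_of_lt_left hC₁, ?_⟩
  rintro f ⟨p, hp, hf⟩
  let v : MvPolynomial.restrictTotalDegree (Fin 3) ℝ k :=
    ⟨p, (MvPolynomial.mem_restrictTotalDegree _ _ _).2 hp⟩
  have hfv : f = evalMap k v := funext hf
  have hgv : gradient f = gradientMap k v := by rw [hfv]; rfl
  rw [hgv, hfv]
  exact ⟨(h1 v).trans (by gcongr; exact le_max_left _ _),
    (h2 v).trans (by gcongr; exact le_max_right _ _)⟩

/-- The Jacobian factor depends neither on the function nor on `Λ`, so it cancels in inequalities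
between norms on different balls. -/
theorem exists_eLpNorm_comp_affine (w : E3) {ρ : ℝ} (hρ : 0 < ρ) :
    ∃ c : ENNReal, c ≠ 0 ∧ c ≠ ⊤ ∧ ∀ {F : Type} [NormedAddCommGroup F] (f : E3 → F) (Λ : ℝ),
      eLpNorm (fun x => f (w + ρ • x)) 2 (volume.restrict (Metric.closedBall 0 Λ)) =
        c * eLpNorm f 2 (volume.restrict (Metric.closedBall w (Λ * ρ))) := by
  have hpos : ENNReal.ofReal |(ρ ^ Module.finrank ℝ E3)⁻¹| ≠ 0 := by
    rw [Ne, ENNReal.ofReal_eq_zero, not_le]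
    positivity
  refine ⟨ENNReal.ofReal |(ρ ^ Module.finrank ℝ E3)⁻¹| ^ (1 / (2 : ENNReal)).toReal, ?_, ?_, ?_⟩
  · exact (ENNReal.rpow_pos (pos_iff_ne_zero.2 hpos) ENNReal.ofReal_ne_top).ne'
  · exact ENNReal.rpow_ne_top_of_nonneg (by positivity) ENNReal.ofReal_ne_top
  intro F _ f Λ
  let e : E3 ≃ₜ E3 := (Homeomorph.smulOfNeZero ρ hρ.ne').trans (Homeomorph.addLeft w)
  have he : ⇑e = fun x => w + ρ • x := rfl
  have hmap : Measure.map e volume = ENNReal.ofReal |(ρ ^ Module.finrank ℝ E3)⁻¹| • volume := by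
    have h1 : ⇑e = (fun x => w + x) ∘ fun x => ρ • x := rfl
    rw [h1, ← Measure.map_map (by fun_prop) (by fun_prop), Measure.map_addHaar_smul _ hρ.ne',
      Measure.map_smul, map_add_left_eq_self]
  have hpre : e ⁻¹' Metric.closedBall w (Λ * ρ) = Metric.closedBall 0 Λ := by
    ext x
    simp only [he, mem_preimage, Metric.mem_closedBall, dist_eq_norm, add_sub_cancel_left, sub_zero,
      norm_smul, Real.norm_of_nonneg hρ.le]
    rw [mul_comm, mul_le_mul_iff_left₀ hρ]
  have hemb : MeasurableEmbedding e := e.measurableEmbedding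
  have h2 := hemb.eLpNorm_map_measure (g := f) (p := 2) (μ := volume.restrict (e ⁻¹' Metric.closedBall w (Λ * ρ)))
  rw [← hemb.restrict_map, hmap, Measure.restrict_smul,
    eLpNorm_smul_measure_of_ne_zero hpos, hpre] at h2
  exact h2.symm

theorem gradient_comp_affine {f : E3 → ℝ} (hf : Differentiable ℝ f) (w : E3) (ρ : ℝ) :
    gradient (fun x => f (w + ρ • x)) = fun x => ρ • gradient f (w + ρ • x) := by
  ext1 x
  refine ext_inner_right ℝ fun v => ?_
  rw [inner_gradient_left, inner_smul_left, inner_gradient_left]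
  have h1 : HasFDerivAt (fun x : E3 => w + ρ • x) (ρ • ContinuousLinearMap.id ℝ E3) x :=
    ((hasFDerivAt_id x).const_smul ρ).const_add w
  have h2 := ((hf (w + ρ • x)).hasFDerivAt.comp x h1).fderiv
  have h3 : fderiv ℝ (fun x => f (w + ρ • x)) x =
      (fderiv ℝ f (w + ρ • x)).comp (ρ • ContinuousLinearMap.id ℝ E3) := h2
  rw [h3]
  simp

/-- Inverse and extension inequalities for polynomials on balls, with scaling. -/
theorem exists_gradient_le (k : ℕ) {Λ : ℝ} : ∃ C : ℝ, 0 < C ∧ ∀ f, IsPoly k f →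
    ∀ (w : E3) (ρ : ℝ), 0 < ρ →
    eLpNorm (gradient f) 2 (volume.restrict (Metric.closedBall w (Λ * ρ))) ≤
      ENNReal.ofReal (C / ρ) * eLpNorm f 2 (volume.restrict (Metric.closedBall w ρ)) ∧
    eLpNorm (gradient f) 2 (volume.restrict (Metric.closedBall w (Λ * ρ))) ≤
      ENNReal.ofReal C * eLpNorm (gradient f) 2 (volume.restrict (Metric.closedBall w ρ)) := by
  obtain ⟨C, hC, h⟩ := exists_gradient_le_unitBall k (Λ := Λ)
  refine ⟨C, hC, fun f hf w ρ hρ => ?_⟩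
  obtain ⟨c, hc0, hct, hc⟩ := exists_eLpNorm_comp_affine w hρ
  obtain ⟨h1, h2⟩ := h _ (hf.comp_affine w ρ)
  have hs : ∀ Λ : ℝ, eLpNorm (fun x => ρ • gradient f (w + ρ • x)) 2
      (volume.restrict (Metric.closedBall 0 Λ)) = ENNReal.ofReal ρ *
        (c * eLpNorm (gradient f) 2 (volume.restrict (Metric.closedBall w (Λ * ρ)))) := by
    intro Λ
    rw [← hc]
    have := eLpNorm_const_smul ρ (fun x => gradient f (w + ρ • x)) 2
      (volume.restrict (Metric.closedBall 0 Λ))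
    rw [Real.enorm_of_nonneg hρ.le] at this
    exact this
  have hρ0 : ENNReal.ofReal ρ ≠ 0 := by simpa using hρ
  have hcanc : ∀ {a b : ENNReal}, c * a ≤ c * b → a ≤ b := fun {a b} hab =>
    (ENNReal.mul_le_mul_iff_right hc0 hct).1 hab
  have hcanρ : ∀ {a b : ENNReal}, ENNReal.ofReal ρ * a ≤ ENNReal.ofReal ρ * b → a ≤ b := fun {a b} hab =>
    (ENNReal.mul_le_mul_iff_right hρ0 ENNReal.ofReal_ne_top).1 hab
  rw [gradient_comp_affine hf.differentiable, hs] at h1 h2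
  constructor
  · rw [hc, one_mul] at h1
    refine hcanc (hcanρ (h1.trans (le_of_eq ?_)))
    rw [ENNReal.ofReal_div_of_pos hρ, div_eq_mul_inv]
    have : ENNReal.ofReal ρ * (ENNReal.ofReal ρ)⁻¹ = 1 :=
      ENNReal.mul_inv_cancel hρ0 ENNReal.ofReal_ne_top
    calc _ = 1 * (ENNReal.ofReal C * (c * eLpNorm f 2 (volume.restrict (Metric.closedBall w ρ)))) := by
            rw [one_mul]
      _ = _ := by rw [← this]; ring
  · rw [hs, one_mul] at h2
    refine hcanc (hcanρ (h2.trans (le_of_eq ?_)))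
    ring

end TraceFEM

namespace TraceFEM

/-! ### Differences of piecewise smooth functions along segments -/

theorem sq_eLpNorm_two {α F : Type*} [MeasurableSpace α] {μ : Measure α} [NormedAddCommGroup F]
    (f : α → F) : eLpNorm f 2 μ ^ 2 = ∫⁻ x, ‖f x‖ₑ ^ 2 ∂μ := by
  have h := eLpNorm_nnreal_pow_eq_lintegral (f := f) (μ := μ) (p := 2) two_ne_zero
  have h2 : ∀ a : ENNReal, a ^ ((2 : NNReal) : ℝ) = a ^ 2 := fun a => ENNReal.rpow_natCast a 2
  simp only [h2] at h
  exact h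

theorem sq_lintegral_le {α : Type*} [MeasurableSpace α] {μ : Measure α} {g : α → ENNReal}
    (hg : AEMeasurable g μ) : (∫⁻ x, g x ∂μ) ^ 2 ≤ μ univ * ∫⁻ x, g x ^ 2 ∂μ := by
  have h := ENNReal.lintegral_mul_le_Lp_mul_Lq μ Real.HolderConjugate.two_two hg
    (aemeasurable_const (b := (1 : ENNReal)))
  have h2 : ∀ a : ENNReal, (a ^ (1 / 2 : ℝ)) ^ 2 = a := fun a => by
    rw [← ENNReal.rpow_natCast, ← ENNReal.rpow_mul]
    norm_num
  calc _ ≤ ((∫⁻ a, g a ^ (2 : ℝ) ∂μ) ^ (1 / 2 : ℝ) * (∫⁻ a, 1 ^ (2 : ℝ) ∂μ) ^ (1 / 2 : ℝ)) ^ 2 := by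
        gcongr
        simpa using h
    _ = _ := by
        rw [mul_pow, h2, h2, mul_comm]
        simp

theorem countable_of_forall_not_lt_lt {s : Set ℝ}
    (h : ∀ a ∈ s, ∀ b ∈ s, ∀ c ∈ s, a < b → b < c → False) : s.Countable := by
  refine Set.Finite.countable (by_contra fun hs => ?_)
  obtain ⟨t, ht, hcard⟩ := Set.Infinite.exists_subset_card_eq hs 3
  have hm : ∀ i : Fin 3, t.orderEmbOfFin hcard i ∈ s := fun i => ht (Finset.orderEmbOfFin_mem _ _ _)
  exact h _ (hm 0) _ (hm 1) _ (hm 2) ((t.orderEmbOfFin hcard).strictMono (by decide))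
    ((t.orderEmbOfFin hcard).strictMono (by decide))

/-- If a line meets the boundary of a closed convex set in a null set, then it meets it in
countably many points. -/
theorem _root_.Convex.countable_line_frontier {s : Set E3} (hs : Convex ℝ s) (hc : IsClosed s) (d e : E3)
    (h0 : ∀ᵐ r : ℝ, d + r • e ∉ frontier s) : {r : ℝ | d + r • e ∈ frontier s}.Countable := by
  refine countable_of_forall_not_lt_lt fun a ha b hb c hcc hab hbc => ?_
  have hmem : ∀ {r : ℝ}, d + r • e ∈ frontier s → d + r • e ∈ s := fun hr => hc.frontier_subset hr
  have hcomb : ∀ x y z : ℝ, x < y → y < z → d + y • e ∈ openSegment ℝ (d + x • e) (d + z • e) := by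
    intro x y z hxy hyz
    have hpos : 0 < z - x := by linarith
    refine ⟨(z - y) / (z - x), (y - x) / (z - x), div_pos (by linarith) hpos,
      div_pos (by linarith) hpos, by field_simp; ring, ?_⟩
    have h1 : (z - y) / (z - x) + (y - x) / (z - x) = 1 := by field_simp; ring
    have h2 : (z - y) / (z - x) * x + (y - x) / (z - x) * z = y := by field_simp; ring
    calc _ = ((z - y) / (z - x) + (y - x) / (z - x)) • d
          + ((z - y) / (z - x) * x + (y - x) / (z - x) * z) • e := by module
      _ = _ := by rw [h1, h2, one_smul]
  have hb' : d + b • e ∉ interior s := hb.2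
  -- Suppose three frontier points. An interior point between the outer ones would make the middle
  -- one interior; without it a whole segment lies in the frontier, against `h0`.
  by_cases hex : ∃ r ∈ Ioo a c, d + r • e ∈ interior s
  · obtain ⟨r, hr, hri⟩ := hex
    rcases lt_trichotomy r b with hlt | heq | hgt
    · exact hb' (hs.openSegment_interior_self_subset_interior hri (hmem hcc) (hcomb r b c hlt hbc))
    · exact hb' (heq ▸ hri)
    · exact hb' (hs.openSegment_self_interior_subset_interior (hmem ha) hri (hcomb a b r hab hgt))
  · push Not at hex
    have hsub : Ioo a c ⊆ {r : ℝ | ¬ d + r • e ∉ frontier s} := fun r hr => by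
      rw [mem_ofPred_eq, not_not]
      exact ⟨subset_closure (hs.openSegment_subset (hmem ha) (hmem hcc)
        (hcomb a r c hr.1 hr.2)), hex r hr⟩
    have := measure_mono_null hsub h0
    rw [Real.volume_Ioo, ENNReal.ofReal_eq_zero] at this
    linarith

theorem ae_ae_line_notMem {s : Set E3} (hs : MeasurableSet s) (h0 : volume s = 0) (e : E3) :
    ∀ᵐ d : E3, ∀ᵐ r : ℝ, d + r • e ∉ s := by
  have hm : MeasurableSet {x : E3 × ℝ | x.1 + x.2 • e ∉ s} := by
    have : Measurable fun x : E3 × ℝ => x.1 + x.2 • e := by fun_prop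
    exact this hs.compl
  rw [Measure.ae_ae_comm hm]
  refine Filter.Eventually.of_forall fun r => ?_
  have h1 := (measurePreserving_add_right (volume : Measure E3) (r • e)).quasiMeasurePreserving
  exact h1.ae (measure_eq_zero_iff_ae_notMem.1 h0)

/-- The fundamental theorem of calculus on almost every line, then Cauchy–Schwarz in `r` and Fubini.
Almost every line meets the boundaries of the finitely many elements in countably many points, so
continuity of `q` across faces suffices. -/
theorem eLpNorm_translate_sub_le {q : E3 → ℝ} {V : Set E3} (hV : IsOpen V)
    (hq : ContDiffOn ℝ 2 q V) {F : Set (Finset E3)} (hF : F.Finite)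
    (hFV : ∀ T ∈ F, interior (tet T) ⊆ V) {e : E3} {D : Set E3} (hD : MeasurableSet D) {t : ℝ}
    (ht : 0 ≤ t) (hc : ∀ d ∈ D, ContinuousOn (fun r : ℝ => q (d + r • e)) (Icc 0 t))
    (hcov : ∀ d ∈ D, ∀ r ∈ Icc 0 t, ∃ T ∈ F, d + r • e ∈ tet T) :
    eLpNorm (fun d => q (d + t • e) - q d) 2 (volume.restrict D) ≤ ENNReal.ofReal t *
      eLpNorm (fun x => inner ℝ e (gradient q x)) 2 (volume.restrict (region F)) := by
  set f : E3 → ℝ := V.indicator fun x => inner ℝ e (gradient q x) with hf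
  have hgc : ContinuousOn (fun x => inner ℝ e (gradient q x)) V := by
    refine continuousOn_const.inner ?_
    exact (LinearIsometryEquiv.continuous _).comp_continuousOn
      (hq.continuousOn_fderiv_of_isOpen hV (by norm_num))
  have hfm : Measurable f := by
    classical
    rw [hf, ← Set.piecewise_eq_indicator]
    exact hgc.measurable_piecewise continuousOn_const hV.measurableSet
  have hregm : MeasurableSet (region F) :=
    hF.measurableSet_biUnion fun T _ => (isCompact_tet T).measurableSet
  have hline : ∀ᵐ d ∂(volume.restrict D), ‖q (d + t • e) - q d‖ₑ ≤
      ∫⁻ r in Icc 0 t, ‖f (d + r • e)‖ₑ := by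
    rw [ae_restrict_iff' hD]
    have h1 : ∀ᵐ d : E3, ∀ T ∈ F, ∀ᵐ r : ℝ, d + r • e ∉ frontier (tet T) :=
      (ae_ball_iff hF.countable).2 fun T _ => ae_ae_line_notMem isClosed_frontier.measurableSet
        ((convex_tet T).addHaar_frontier _) e
    filter_upwards [h1] with d hd hdD
    -- If the integral is infinite there is nothing to prove; otherwise the derivative is
    -- integrable, as the fundamental theorem requires.
    by_cases hfin : ∫⁻ r in Icc 0 t, ‖f (d + r • e)‖ₑ = ⊤
    · rw [hfin]
      exact le_top
    have hlm : Measurable fun r : ℝ => f (d + r • e) := hfm.comp (by fun_prop)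
    have hint : IntegrableOn (fun r : ℝ => f (d + r • e)) (Icc 0 t) :=
      ⟨hlm.aestronglyMeasurable, lt_top_iff_ne_top.2 hfin⟩
    have hcount : (⋃ T ∈ F, {r : ℝ | d + r • e ∈ frontier (tet T)}).Countable :=
      hF.countable.biUnion fun T hT =>
        (convex_tet T).countable_line_frontier (isCompact_tet T).isClosed d e (hd T hT)
    have hftc := integral_eq_of_hasDerivAt_off_countable_of_le (fun r : ℝ => q (d + r • e))
      (fun r => f (d + r • e)) ht hcount (hc d hdD) (fun r hr => by
        obtain ⟨T, hT, hrT⟩ := hcov d hdD r (Ioo_subset_Icc_self hr.1)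
        have hri : d + r • e ∈ V := by
          refine hFV T hT (by_contra fun hni => hr.2 ?_)
          exact mem_biUnion hT ⟨subset_closure hrT, hni⟩
        have hdq : HasFDerivAt q (fderiv ℝ q (d + r • e)) (d + r • e) :=
          ((hq.contDiffAt (hV.mem_nhds hri)).differentiableAt (by norm_num)).hasFDerivAt
        have hde : HasDerivAt (fun r : ℝ => d + r • e) e r := by
          simpa using ((hasDerivAt_id r).smul_const e).const_add d
        have h2 := hdq.comp_hasDerivAt r hde
        have h3 : f (d + r • e) = fderiv ℝ q (d + r • e) e := by
          rw [hf, indicator_of_mem hri, real_inner_comm, inner_gradient_left]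
        rw [h3]
        exact h2)
      ((intervalIntegrable_iff_integrableOn_Icc_of_le ht).2 hint)
    simp only [zero_smul, add_zero] at hftc
    rw [← hftc, intervalIntegral.integral_of_le ht, ← integral_Icc_eq_integral_Ioc]
    exact enorm_integral_le_lintegral_enorm _
  set A := ∫⁻ x in region F, ‖inner ℝ e (gradient q x)‖ₑ ^ 2 with hA
  have hjm : Measurable (Function.uncurry fun (d : E3) (r : ℝ) => ‖f (d + r • e)‖ₑ ^ 2) := by
    have : Measurable fun x : E3 × ℝ => x.1 + x.2 • e := by fun_prop
    exact (hfm.comp this).enorm.pow_const 2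
  have hslice : ∀ r ∈ Icc 0 t, ∫⁻ d in D, ‖f (d + r • e)‖ₑ ^ 2 ≤ A := by
    intro r hr
    set φ : E3 → ENNReal := (region F).indicator fun x => ‖f x‖ₑ ^ 2
    calc ∫⁻ d in D, ‖f (d + r • e)‖ₑ ^ 2 ≤ ∫⁻ d in D, φ (d + r • e) := by
          refine setLIntegral_mono_ae' hD (Filter.Eventually.of_forall fun d hd => ?_)
          obtain ⟨T, hT, hrT⟩ := hcov d hd r hr
          have : d + r • e ∈ region F := mem_biUnion hT hrT
          simp only [φ, indicator_of_mem this, le_refl]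
      _ ≤ ∫⁻ d, φ (d + r • e) := setLIntegral_le_lintegral _ _
      _ = ∫⁻ x, φ x := lintegral_add_right_eq_self φ (r • e)
      _ = ∫⁻ x in region F, ‖f x‖ₑ ^ 2 := lintegral_indicator hregm _
      _ ≤ A := by
          refine lintegral_mono fun x => ?_
          gcongr
          rw [hf]
          exact enorm_indicator_le_enorm_self _ _
  have hsq : eLpNorm (fun d => q (d + t • e) - q d) 2 (volume.restrict D) ^ 2 ≤
      (ENNReal.ofReal t * eLpNorm (fun x => inner ℝ e (gradient q x)) 2
        (volume.restrict (region F))) ^ 2 := by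
    rw [mul_pow, sq_eLpNorm_two, sq_eLpNorm_two, ← hA]
    calc _ ≤ ∫⁻ d in D, ENNReal.ofReal t * ∫⁻ r in Icc 0 t, ‖f (d + r • e)‖ₑ ^ 2 := by
          refine lintegral_mono_ae ?_
          filter_upwards [hline] with d hd
          refine (pow_le_pow_left' hd 2).trans ?_
          have hlm : Measurable fun r : ℝ => ‖f (d + r • e)‖ₑ :=
            (hfm.comp (by fun_prop : Measurable fun r : ℝ => d + r • e)).enorm
          refine (sq_lintegral_le hlm.aemeasurable).trans ?_
          simp
      _ = ENNReal.ofReal t * ∫⁻ d in D, ∫⁻ r in Icc 0 t, ‖f (d + r • e)‖ₑ ^ 2 := by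
          rw [lintegral_const_mul]
          exact hjm.lintegral_prod_right'
      _ = ENNReal.ofReal t * ∫⁻ r in Icc 0 t, ∫⁻ d in D, ‖f (d + r • e)‖ₑ ^ 2 := by
          rw [lintegral_lintegral_swap hjm.aemeasurable]
      _ ≤ ENNReal.ofReal t * ∫⁻ r in Icc 0 t, A := by
          gcongr 1
          exact setLIntegral_mono_ae' measurableSet_Icc (Filter.Eventually.of_forall hslice)
      _ = _ := by
          simp only [lintegral_const, MeasurableSet.univ, Measure.restrict_apply, univ_inter,
            Real.volume_Icc, sub_zero]
          ring
  exact (ENNReal.pow_le_pow_left_iff two_ne_zero).1 hsq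

end TraceFEM

namespace TraceFEM

/-! ### The local gradient estimate -/

theorem restrict_tet (T : Finset E3) :
    (volume : Measure E3).restrict (tet T) = volume.restrict (interior (tet T)) := by
  refine Measure.restrict_congr_set ?_
  exact (interior_ae_eq_of_null_frontier ((convex_tet T).addHaar_frontier _)).symm

theorem gradient_congr_interior {q f : E3 → ℝ} {S : Set E3} (h : ∀ x ∈ interior S, q x = f x) :
    ∀ x ∈ interior S, gradient q x = gradient f x := fun x hx => by
  have h1 : q =ᶠ[nhds x] f := Filter.eventually_of_mem (isOpen_interior.mem_nhds hx) h
  rw [gradient, gradient, h1.fderiv_eq]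

theorem ae_gradient_eq {q f : E3 → ℝ} {T : Finset E3} (h : ∀ x ∈ interior (tet T), q x = f x) :
    gradient q =ᵐ[volume.restrict (tet T)] gradient f := by
  rw [restrict_tet]
  exact ae_restrict_of_forall_mem isOpen_interior.measurableSet (gradient_congr_interior h)

theorem eLpNorm_translate {F : Type*} [NormedAddCommGroup F] (f : E3 → F) (w a : E3) (r : ℝ) :
    eLpNorm (fun x => f (x + a)) 2 (volume.restrict (Metric.closedBall w r)) =
      eLpNorm f 2 (volume.restrict (Metric.closedBall (w + a) r)) := by
  have hemb : MeasurableEmbedding fun x : E3 => x + a := measurableEmbedding_addRight a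
  have hpre : (fun x : E3 => x + a) ⁻¹' Metric.closedBall (w + a) r = Metric.closedBall w r := by
    ext x
    simp [dist_eq_norm]
  have hmp := (measurePreserving_add_right (volume : Measure E3) a).restrict_preimage_emb hemb
    (Metric.closedBall (w + a) r)
  rw [hpre] at hmp
  have := hemb.eLpNorm_map_measure (g := f) (p := 2) (μ := volume.restrict (Metric.closedBall w r))
  rw [hmp.map_eq] at this
  exact this.symm

theorem restrict_ball_eq_closedBall (w : E3) (r : ℝ) (hr : r ≠ 0) :
    (volume : Measure E3).restrict (Metric.ball w r) = volume.restrict (Metric.closedBall w r) := by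
  have h1 : interior (Metric.closedBall w r) = Metric.ball w r := interior_closedBall w hr
  rw [← h1]
  exact (Measure.restrict_congr_set (interior_ae_eq_of_null_frontier
    ((convex_closedBall w r).addHaar_frontier _)))

theorem nbrs_subset_cutTets {Γ : Set E3} {K : Mesh} {T : Finset E3} : nbrs Γ K T ⊆ cutTets Γ K :=
  fun _ h => h.1

theorem mem_nbrs_self {Γ : Set E3} {K : Mesh} {T : Finset E3} (hT : T ∈ cutTets Γ K) :
    T ∈ nbrs Γ K T := by
  obtain ⟨x, hx⟩ := hT.2
  exact ⟨hT, x, hx.1, hx.1⟩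

theorem region_mono {S S' : Set (Finset E3)} (h : S ⊆ S') : region S ⊆ region S' :=
  biUnion_subset_biUnion_left h

theorem tet_subset_region {S : Set (Finset E3)} {T : Finset E3} (h : T ∈ S) : tet T ⊆ region S :=
  subset_biUnion_of_mem (u := fun T => tet T) h

theorem cutTets_finite {Γ : Set E3} {K : Mesh} (h : K.faces.Finite) : (cutTets Γ K).Finite :=
  h.subset fun _ hT => hT.1.1

theorem exists_isPoly {k : ℕ} {Γ : Set E3} {K : Mesh} {q : E3 → ℝ} (hq : q ∈ pressureSpace k Γ K)
    {T : Finset E3} (hT : T ∈ cutTets Γ K) :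
    ∃ f, IsPoly k f ∧ ∀ x ∈ interior (tet T), q x = f x := by
  obtain ⟨p, hp, h⟩ := hq.2.1 T hT
  exact ⟨_, ⟨p, hp, fun _ => rfl⟩, h⟩

theorem contDiffOn_iUnion_interior {k : ℕ} {Γ : Set E3} {K : Mesh} {q : E3 → ℝ}
    (hq : q ∈ pressureSpace k Γ K) {F : Set (Finset E3)} (hF : F ⊆ cutTets Γ K) :
    ContDiffOn ℝ 2 q (⋃ T ∈ F, interior (tet T)) := by
  intro x hx
  obtain ⟨T, hT, hxT⟩ := mem_iUnion₂.1 hx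
  obtain ⟨f, hf, hqf⟩ := exists_isPoly hq (hF hT)
  have h1 : q =ᶠ[nhds x] f := Filter.eventually_of_mem (isOpen_interior.mem_nhds hxT) hqf
  exact (hf.contDiff.contDiffAt.congr_of_eventuallyEq h1).contDiffWithinAt

/-- On the small ball the polynomial `Q = f (· + a) - f'` is a vertical difference of `q`, of `L²`
norm at most `h` times that of the directional derivative. The inverse inequality returns the factor
`1 / h`, and the extension inequality carries `∇f'` from the small ball to one containing the
translate of `T`. -/
theorem exists_eLpNorm_gradient_le (k : ℕ) {δ : ℝ} (hδ : 0 < δ) : ∃ C : ℝ, 0 < C ∧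
    ∀ {h : ℝ} {Γ : Set E3} {K : Mesh} {n₁ : E3} {T T' : Finset E3} {w : E3} {t : ℝ}, 0 < h →
    K.faces.Finite → T ∈ cutTets Γ K → hT T ≤ h → T' ∈ nbrs Γ K T → 0 ≤ t → t ≤ h →
    Metric.closedBall w (δ * h) ⊆ tet T' → Metric.closedBall (w + t • n₁) (δ * h) ⊆ tet T →
    (∀ d ∈ Metric.closedBall w (δ * h), ∀ r ∈ Icc 0 t, ∃ T₁ ∈ nbrs Γ K T, d + r • n₁ ∈ tet T₁) →
    ∀ q ∈ pressureSpace k Γ K,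
    eLpNorm (gradient q) 2 (volume.restrict (tet T)) ≤ ENNReal.ofReal C *
      (eLpNorm (gradient q) 2 (volume.restrict (tet T')) +
        eLpNorm (fun x => inner ℝ n₁ (gradient q x)) 2 (volume.restrict (region (nbrs Γ K T)))) := by
  obtain ⟨C, hC, hCP⟩ := exists_gradient_le k (Λ := 1 / δ)
  refine ⟨max C (C / δ), lt_max_of_lt_left hC, ?_⟩
  intro h Γ K n₁ T T' w t hh hfin hTc hTh hT' ht0 hth hwT' hwT hcol q hq
  have hρ : 0 < δ * h := mul_pos hδ hh
  have hΛ : 1 / δ * (δ * h) = h := by field_simp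
  obtain ⟨f, hf, hqf⟩ := exists_isPoly hq hTc
  obtain ⟨f', hf', hqf'⟩ := exists_isPoly hq (nbrs_subset_cutTets hT')
  set a : E3 := t • n₁ with ha
  have hg : IsPoly k fun x => f (x + a) := by
    have := hf.comp_affine a 1
    simpa [add_comm] using this
  have hgg : gradient (fun x => f (x + a)) = fun x => gradient f (x + a) := by
    have := gradient_comp_affine hf.differentiable a 1
    simpa [add_comm] using this
  set Q : E3 → ℝ := fun x => f (x + a) - f' x with hQdef
  have hQ : IsPoly k Q := hg.sub hf'
  have hgQ : gradient (fun x => f (x + a)) = fun x => gradient Q x + gradient f' x := by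
    ext1 x
    have h1 : fderiv ℝ Q x = fderiv ℝ (fun x => f (x + a)) x - fderiv ℝ f' x :=
      fderiv_sub (hg.differentiable x) (hf'.differentiable x)
    rw [gradient, gradient, gradient, h1, map_sub, sub_add_cancel]
  have hbT' : Metric.ball w (δ * h) ⊆ interior (tet T') :=
    interior_maximal (Metric.ball_subset_closedBall.trans hwT') Metric.isOpen_ball
  have hbT : ∀ x ∈ Metric.ball w (δ * h), x + a ∈ interior (tet T) := fun x hx =>
    interior_maximal (Metric.ball_subset_closedBall.trans hwT) Metric.isOpen_ball
      (by simpa [dist_eq_norm] using hx)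
  have hTball : tet T ⊆ Metric.closedBall (w + a) h := fun x hx => by
    rw [Metric.mem_closedBall, dist_eq_norm]
    exact (norm_sub_le_hT hx (hwT (Metric.mem_closedBall_self hρ.le))).trans hTh
  have hcut : ∀ d ∈ Metric.ball w (δ * h),
      ContinuousOn (fun r : ℝ => q (d + r • n₁)) (Icc 0 t) := by
    intro d hd
    refine hq.1.comp (by fun_prop) fun r hr => ?_
    have hopen : IsOpen ((fun x : E3 => x - r • n₁) ⁻¹' Metric.ball w (δ * h)) :=
      Metric.isOpen_ball.preimage (by fun_prop)
    -- Continuity of `q` is known only in the interior of the active region; the translate of the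
    -- whole open ball lies in that region, hence in its interior.
    refine interior_maximal (fun x hx => ?_) hopen (by simpa using hd)
    obtain ⟨T₁, hT₁, hx₁⟩ := hcol (x - r • n₁) (Metric.ball_subset_closedBall hx) r hr
    rw [sub_add_cancel] at hx₁
    exact tet_subset_region (nbrs_subset_cutTets hT₁) hx₁
  have hnfin : (nbrs Γ K T).Finite := (cutTets_finite hfin).subset nbrs_subset_cutTets
  have htrans := eLpNorm_translate_sub_le (V := ⋃ T₁ ∈ nbrs Γ K T, interior (tet T₁))
    (isOpen_biUnion fun _ _ => isOpen_interior) (contDiffOn_iUnion_interior hq nbrs_subset_cutTets)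
    hnfin (fun T₁ hT₁ => subset_biUnion_of_mem (u := fun T => interior (tet T)) hT₁) (e := n₁)
    Metric.isOpen_ball.measurableSet ht0 hcut
    fun d hd r hr => hcol d (Metric.ball_subset_closedBall hd) r hr
  set N := eLpNorm (fun x => inner ℝ n₁ (gradient q x)) 2 (volume.restrict (region (nbrs Γ K T)))
  have hQN : eLpNorm Q 2 (volume.restrict (Metric.closedBall w (δ * h))) ≤ ENNReal.ofReal h * N := by
    rw [← restrict_ball_eq_closedBall _ _ hρ.ne']
    have hcongr : eLpNorm Q 2 (volume.restrict (Metric.ball w (δ * h))) =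
        eLpNorm (fun d => q (d + t • n₁) - q d) 2 (volume.restrict (Metric.ball w (δ * h))) := by
      refine eLpNorm_congr_ae (ae_restrict_of_forall_mem Metric.isOpen_ball.measurableSet
        fun x hx => ?_)
      simp only [hQdef]
      rw [← ha, hqf _ (hbT x hx), hqf' _ (hbT' hx)]
    rw [hcongr]
    refine htrans.trans ?_
    gcongr
  have hf'T' : eLpNorm (gradient f') 2 (volume.restrict (Metric.closedBall w (δ * h))) ≤
      eLpNorm (gradient q) 2 (volume.restrict (tet T')) := by
    rw [eLpNorm_congr_ae (ae_gradient_eq hqf')]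
    exact eLpNorm_mono_measure _ (Measure.restrict_mono hwT' le_rfl)
  have h1 := (hCP Q hQ w (δ * h) hρ).1
  have h2 := (hCP f' hf' w (δ * h) hρ).2
  rw [hΛ] at h1 h2
  calc eLpNorm (gradient q) 2 (volume.restrict (tet T))
      = eLpNorm (gradient f) 2 (volume.restrict (tet T)) := eLpNorm_congr_ae (ae_gradient_eq hqf)
    _ ≤ eLpNorm (gradient f) 2 (volume.restrict (Metric.closedBall (w + a) h)) :=
        eLpNorm_mono_measure _ (Measure.restrict_mono hTball le_rfl)
    _ = eLpNorm (fun x => gradient Q x + gradient f' x) 2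
          (volume.restrict (Metric.closedBall w h)) := by
        rw [← eLpNorm_translate, ← hgg, hgQ]
    _ ≤ eLpNorm (gradient Q) 2 (volume.restrict (Metric.closedBall w h)) +
          eLpNorm (gradient f') 2 (volume.restrict (Metric.closedBall w h)) :=
        eLpNorm_add_le hQ.continuous_gradient.aestronglyMeasurable
          hf'.continuous_gradient.aestronglyMeasurable (by norm_num)
    _ ≤ ENNReal.ofReal (C / (δ * h)) * (ENNReal.ofReal h * N) + ENNReal.ofReal C *
          eLpNorm (gradient q) 2 (volume.restrict (tet T')) := by
        gcongr
        · exact h1.trans (by gcongr)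
        · exact h2.trans (by gcongr)
    _ ≤ ENNReal.ofReal (max C (C / δ)) * N + ENNReal.ofReal (max C (C / δ)) *
          eLpNorm (gradient q) 2 (volume.restrict (tet T')) := by
        rw [← mul_assoc, ← ENNReal.ofReal_mul (by positivity)]
        have : C / (δ * h) * h = C / δ := by field_simp
        rw [this]
        gcongr
        · exact le_max_right _ _
        · exact le_max_left _ _
    _ = _ := by ring

end TraceFEM

namespace TraceFEM

/-! ### The extended normal field -/

theorem closestPoint_spec {Γ : Set E3} (hc : IsCompact Γ) (hne : Γ.Nonempty) (x : E3) :
    closestPoint Γ x ∈ Γ ∧ dist x (closestPoint Γ x) = Metric.infDist x Γ := by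
  obtain ⟨y, hy, hxy⟩ := hc.exists_infDist_eq_dist hne x
  exact Classical.epsilon_spec (p := fun p => p ∈ Γ ∧ dist x p = Metric.infDist x Γ)
    ⟨y, hy, hxy.symm⟩

theorem measurable_gradient (f : E3 → ℝ) : Measurable (gradient f) :=
  (LinearIsometryEquiv.continuous _).measurable.comp (measurable_fderiv ℝ f)

/-- Where the distance to `Γ` is differentiable, its gradient determines the closest point. -/
theorem closestPoint_eq {Γ : Set E3} (hc : IsCompact Γ) (hne : Γ.Nonempty) {x : E3}
    (hd : DifferentiableAt ℝ (Metric.infDist · Γ) x) :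
    closestPoint Γ x = x - Metric.infDist x Γ • gradient (Metric.infDist · Γ) x := by
  obtain ⟨hp, hxp⟩ := closestPoint_spec hc hne x
  set p := closestPoint Γ x
  rcases (Metric.infDist_nonneg : 0 ≤ Metric.infDist x Γ).eq_or_lt with h0 | hpos
  · rw [← h0, zero_smul, sub_zero]
    rw [← h0, dist_eq_zero] at hxp
    exact hxp.symm
  set d := Metric.infDist x Γ
  set u : E3 := d⁻¹ • (x - p) with hu
  have hnu : ‖u‖ = 1 := by
    rw [hu, norm_smul, ← dist_eq_norm, hxp, Real.norm_of_nonneg (by positivity)]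
    exact inv_mul_cancel₀ hpos.ne'
  have hxpu : x - p = d • u := by rw [hu, smul_smul, mul_inv_cancel₀ hpos.ne', one_smul]
  set L := fderiv ℝ (Metric.infDist · Γ) x
  have hL : ‖L‖ ≤ 1 := by
    simpa using norm_fderiv_le_of_lipschitz ℝ (Metric.lipschitz_infDist_pt Γ) (x₀ := x)
  -- Towards `p` the distance decreases at unit speed, while its gradient has norm at most `1`; so
  -- the gradient is the unit vector `u`.
  have hLu : 1 ≤ L u := by
    have hline : HasDerivAt (fun s : ℝ => x - s • u) (-u) 0 := by
      simpa using ((hasDerivAt_id (0 : ℝ)).smul_const u).const_sub x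
    have hdd : HasFDerivAt (Metric.infDist · Γ) L (x - (0 : ℝ) • u) := by
      simpa using hd.hasFDerivAt
    have h1 := hdd.comp_hasDerivAt (0 : ℝ) hline
    have h2 := (hasDerivWithinAt_iff_tendsto_slope' (s := Ioi (0 : ℝ)) self_notMem_Ioi).1
      h1.hasDerivWithinAt
    have h3 : L (-u) ≤ -1 := by
      refine le_of_tendsto h2 ?_
      filter_upwards [Ioc_mem_nhdsGT hpos] with s hs
      have h4 : Metric.infDist (x - s • u) Γ ≤ d - s := by
        refine (Metric.infDist_le_dist_of_mem hp).trans ?_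
        have : x - s • u - p = (d - s) • u := by rw [sub_smul, ← hxpu]; abel
        rw [dist_eq_norm, this, norm_smul, hnu, mul_one, Real.norm_of_nonneg (by linarith [hs.2])]
      rw [slope_def_field]
      simp only [Function.comp_apply, zero_smul, sub_zero]
      rw [div_le_iff₀ hs.1]
      change _ - d ≤ _
      linarith
    rw [map_neg] at h3
    linarith
  have hg : gradient (Metric.infDist · Γ) x = u := by
    have h1 : ‖gradient (Metric.infDist · Γ) x‖ ≤ 1 := by
      rw [gradient, LinearIsometryEquiv.norm_map]
      exact hL
    have h2 : (1 : ℝ) ≤ inner ℝ (gradient (Metric.infDist · Γ) x) u := by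
      rw [inner_gradient_left]
      exact hLu
    have h3 := norm_sub_sq_real (gradient (Metric.infDist · Γ) x) u
    rw [hnu] at h3
    have h4 : ‖gradient (Metric.infDist · Γ) x - u‖ ^ 2 ≤ 0 := by
      nlinarith [norm_nonneg (gradient (Metric.infDist · Γ) x)]
    have h5 : ‖gradient (Metric.infDist · Γ) x - u‖ = 0 := by
      nlinarith [norm_nonneg (gradient (Metric.infDist · Γ) x - u)]
    exact sub_eq_zero.1 (norm_eq_zero.1 h5)
  rw [hg, ← hxpu, sub_sub_cancel]

/-- The closest point is an arbitrary choice, but by Rademacher's theorem the distance is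
differentiable almost everywhere, and there its gradient gives the closest point by a measurable
formula. -/
theorem aestronglyMeasurable_normalExt {Γ : Set E3} {n : E3 → E3} (hc : IsCompact Γ)
    (hne : Γ.Nonempty) (hn : ContinuousOn n Γ) : AEStronglyMeasurable (normalExt Γ n) volume := by
  classical
  have hm : Measurable (Γ.piecewise n 0) :=
    hn.measurable_piecewise continuousOn_const hc.measurableSet
  have hg : Measurable fun x : E3 =>
      x - Metric.infDist x Γ • gradient (Metric.infDist · Γ) x :=
    measurable_id.sub ((Metric.continuous_infDist_pt Γ).measurable.smul (measurable_gradient _))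
  refine ((hm.comp hg).aestronglyMeasurable).congr ?_
  filter_upwards [(Metric.lipschitz_infDist_pt Γ).ae_differentiableAt] with x hx
  rw [Function.comp_apply, ← closestPoint_eq hc hne hx,
    piecewise_eq_of_mem _ _ _ (closestPoint_spec hc hne x).1]
  rfl

theorem UniformlyFlat.continuousOn {Γ : Set E3} {n : E3 → E3} {ρ₀ M : ℝ} (hρ : 0 < ρ₀)
    (h : UniformlyFlat Γ n univ ρ₀ M) : ContinuousOn n Γ := by
  intro x hx
  obtain ⟨-, hM, -⟩ := h x ⟨hx, mem_univ _⟩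
  rw [ContinuousWithinAt, tendsto_iff_norm_sub_tendsto_zero]
  have hlim : Filter.Tendsto (fun y => M * ‖y - x‖) (nhdsWithin x Γ) (nhds 0) := by
    have : Continuous fun y : E3 => M * ‖y - x‖ := by fun_prop
    simpa using (this.tendsto x).mono_left nhdsWithin_le_nhds
  refine squeeze_zero' (Filter.Eventually.of_forall fun _ => norm_nonneg _) ?_ hlim
  filter_upwards [self_mem_nhdsWithin, mem_nhdsWithin_of_mem_nhds (Metric.ball_mem_nhds x hρ)]
    with y hy hyb using hM y ⟨hy, hyb⟩

theorem IsClosedSurface.aestronglyMeasurable_normalDeriv {Γ : Set E3} {n : E3 → E3}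
    (h : IsClosedSurface Γ n) (q : E3 → ℝ) : AEStronglyMeasurable (normalDeriv Γ n q) volume := by
  obtain ⟨ρ₀, M, hρ, -, hf⟩ := h.exists_uniformlyFlat
  exact (aestronglyMeasurable_normalExt h.isCompact h.nonempty (hf.continuousOn hρ)).inner
    (measurable_gradient q).aestronglyMeasurable

theorem IsClosedSurface.norm_normalExt {Γ : Set E3} {n : E3 → E3}
    (h : IsClosedSurface Γ n) (x : E3) : ‖normalExt Γ n x‖ = 1 := by
  obtain ⟨ρ₀, M, -, -, hf⟩ := h.exists_uniformlyFlat
  exact (hf _ ⟨(closestPoint_spec h.isCompact h.nonempty x).1, mem_univ _⟩).1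

theorem IsClosedSurface.abs_normalDeriv_le {Γ : Set E3} {n : E3 → E3}
    (h : IsClosedSurface Γ n) (q : E3 → ℝ) (x : E3) : |normalDeriv Γ n q x| ≤ ‖gradient q x‖ := by
  have := abs_real_inner_le_norm (normalExt Γ n x) (gradient q x)
  rwa [h.norm_normalExt, one_mul] at this

/-! ### The norms -/

theorem l2norm_eq {F : Type*} [NormedAddCommGroup F] {f : E3 → F} {S : Set E3}
    (hf : AEStronglyMeasurable f (volume.restrict S)) :
    l2norm S f = (eLpNorm f 2 (volume.restrict S)).toReal := by
  rw [l2norm, integral_eq_lintegral_of_nonneg_ae (Filter.Eventually.of_forall fun _ => by positivity)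
    (by exact hf.norm.pow 2)]
  have h1 : ∀ x, ENNReal.ofReal (‖f x‖ ^ 2) = ‖f x‖ₑ ^ 2 := fun x => by
    rw [ENNReal.ofReal_pow (norm_nonneg _), ofReal_norm]
  simp only [h1]
  rw [← sq_eLpNorm_two, ENNReal.toReal_pow, Real.sqrt_sq ENNReal.toReal_nonneg]

theorem l2norm_nonneg {F : Type*} [NormedAddCommGroup F] (S : Set E3) (f : E3 → F) :
    0 ≤ l2norm S f := Real.sqrt_nonneg _

theorem l2norm_sq {F : Type*} [NormedAddCommGroup F] (S : Set E3) (f : E3 → F) :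
    l2norm S f ^ 2 = ∫ x in S, ‖f x‖ ^ 2 := Real.sq_sqrt (integral_nonneg fun _ => by positivity)

theorem integrableOn_gradient_sq {k : ℕ} {Γ : Set E3} {K : Mesh} {q : E3 → ℝ}
    (hq : q ∈ pressureSpace k Γ K) (hfin : K.faces.Finite) {F : Set (Finset E3)}
    (hF : F ⊆ cutTets Γ K) : IntegrableOn (fun x => ‖gradient q x‖ ^ 2) (region F) := by
  refine (integrableOn_finite_biUnion ((cutTets_finite hfin).subset hF)).2 fun T hT => ?_
  obtain ⟨f, hf, hqf⟩ := exists_isPoly hq (hF hT)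
  have h1 : IntegrableOn (fun x => ‖gradient f x‖ ^ 2) (tet T) :=
    (hf.continuous_gradient.norm.pow 2).continuousOn.integrableOn_compact (isCompact_tet T)
  refine h1.congr ?_
  filter_upwards [ae_gradient_eq hqf] with x hx
  rw [hx]

theorem eLpNorm_gradient_ne_top {k : ℕ} {Γ : Set E3} {K : Mesh} {q : E3 → ℝ}
    (hq : q ∈ pressureSpace k Γ K) (hfin : K.faces.Finite) {F : Set (Finset E3)}
    (hF : F ⊆ cutTets Γ K) : eLpNorm (gradient q) 2 (volume.restrict (region F)) ≠ ⊤ :=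
  ((memLp_two_iff_integrable_sq_norm (measurable_gradient q).aestronglyMeasurable).2
    (integrableOn_gradient_sq hq hfin hF)).eLpNorm_ne_top

theorem integrableOn_normalDeriv_sq {k : ℕ} {Γ : Set E3} {n : E3 → E3} (h : IsClosedSurface Γ n)
    {K : Mesh} {q : E3 → ℝ} (hq : q ∈ pressureSpace k Γ K) (hfin : K.faces.Finite)
    {F : Set (Finset E3)} (hF : F ⊆ cutTets Γ K) :
    IntegrableOn (fun x => ‖normalDeriv Γ n q x‖ ^ 2) (region F) := by
  refine Integrable.mono (integrableOn_gradient_sq hq hfin hF)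
    ((h.aestronglyMeasurable_normalDeriv q).restrict.norm.pow 2)
    (Filter.Eventually.of_forall fun x => ?_)
  rw [norm_pow, norm_pow, norm_norm, norm_norm]
  exact pow_le_pow_left₀ (norm_nonneg _) (h.abs_normalDeriv_le q x) 2

theorem eLpNorm_normalDeriv_ne_top {k : ℕ} {Γ : Set E3} {n : E3 → E3} (h : IsClosedSurface Γ n)
    {K : Mesh} {q : E3 → ℝ} (hq : q ∈ pressureSpace k Γ K) (hfin : K.faces.Finite)
    {F : Set (Finset E3)} (hF : F ⊆ cutTets Γ K) :
    eLpNorm (normalDeriv Γ n q) 2 (volume.restrict (region F)) ≠ ⊤ :=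
  ((memLp_two_iff_integrable_sq_norm (h.aestronglyMeasurable_normalDeriv q).restrict).2
    (integrableOn_normalDeriv_sq h hq hfin hF)).eLpNorm_ne_top

theorem eLpNorm_gradient_tet_ne_top {k : ℕ} {Γ : Set E3} {K : Mesh} {q : E3 → ℝ}
    (hq : q ∈ pressureSpace k Γ K) {T : Finset E3} (hT : T ∈ cutTets Γ K) :
    eLpNorm (gradient q) 2 (volume.restrict (tet T)) ≠ ⊤ := by
  obtain ⟨f, hf, hqf⟩ := exists_isPoly hq hT
  rw [eLpNorm_congr_ae (ae_gradient_eq hqf)]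
  exact (memLp_restrict_of_continuous hf.continuous_gradient (isCompact_tet T)).eLpNorm_ne_top

theorem l2norm_gradient_mono {k : ℕ} {Γ : Set E3} {K : Mesh} {q : E3 → ℝ}
    (hq : q ∈ pressureSpace k Γ K) (hfin : K.faces.Finite) {F : Set (Finset E3)}
    (hF : F ⊆ cutTets Γ K) {S : Set E3} (hS : S ⊆ region F) :
    l2norm S (gradient q) ≤ l2norm (region F) (gradient q) := by
  rw [l2norm_eq (measurable_gradient q).aestronglyMeasurable,
    l2norm_eq (measurable_gradient q).aestronglyMeasurable]
  exact ENNReal.toReal_mono (eLpNorm_gradient_ne_top hq hfin hF)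
    (eLpNorm_mono_measure _ (Measure.restrict_mono hS le_rfl))

/-- The extended normal varies little over the neighbors of a small cut tetrahedron. -/
theorem norm_normalExt_sub_le {Γ : Set E3} {n : E3 → E3} (hs : IsClosedSurface Γ n) {ρ₀ M h : ℝ}
    (hM : 0 ≤ M) (hf : UniformlyFlat Γ n univ ρ₀ M) (hρ : 3 * h < ρ₀) {K : Mesh}
    (hle : ∀ T ∈ cutTets Γ K, hT T ≤ h) {T : Finset E3} (hT' : T ∈ cutTets Γ K) {x₀ x : E3}
    (hx₀ : x₀ ∈ tet T) (hx₀Γ : x₀ ∈ Γ) (hx : x ∈ region (nbrs Γ K T)) :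
    ‖normalExt Γ n x - n x₀‖ ≤ 3 * M * h := by
  obtain ⟨T', hT'n, hxT'⟩ := mem_iUnion₂.1 hx
  obtain ⟨z, hzT', hzT⟩ := hT'n.2
  obtain ⟨y, hyT', hyΓ⟩ := hT'n.1.2
  obtain ⟨hp, hxp⟩ := closestPoint_spec hs.isCompact hs.nonempty x
  have h1 : dist x (closestPoint Γ x) ≤ h := by
    rw [hxp]
    refine (Metric.infDist_le_dist_of_mem hyΓ).trans ?_
    rw [dist_eq_norm]
    exact (norm_sub_le_hT hxT' hyT').trans (hle _ hT'n.1)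
  have h2 : dist x z ≤ h := by
    rw [dist_eq_norm]
    exact (norm_sub_le_hT hxT' hzT').trans (hle _ hT'n.1)
  have h3 : dist z x₀ ≤ h := by
    rw [dist_eq_norm]
    exact (norm_sub_le_hT hzT hx₀).trans (hle _ hT')
  -- One `h` from the closest point to `x`, one inside the neighbor, one inside `T`.
  have h4 : dist (closestPoint Γ x) x₀ ≤ 3 * h := by
    have := dist_triangle4 (closestPoint Γ x) x z x₀
    rw [dist_comm (closestPoint Γ x) x] at this
    linarith
  have h5 := (hf x₀ ⟨hx₀Γ, mem_univ _⟩).2.1 (closestPoint Γ x)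
    ⟨hp, by rw [Metric.mem_ball]; linarith⟩
  refine h5.trans ?_
  rw [← dist_eq_norm]
  nlinarith

end TraceFEM

namespace TraceFEM

/-! ### The estimate on elements of small meshes -/

theorem hT_le_meshSize {Γ : Set E3} {K : Mesh} (h : K.faces.Finite) {T : Finset E3}
    (hT' : T ∈ cutTets Γ K) : hT T ≤ meshSize Γ K :=
  le_csSup ((cutTets_finite h).image hT).bddAbove (mem_image_of_mem hT hT')

theorem ShapeRegular.mono {σ σ' : ℝ} {K : Mesh} (h : ShapeRegular σ K) (hσ : σ ≤ σ') :
    ShapeRegular σ' K := fun T hT' => by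
  obtain ⟨x, r, hr, hle, hb⟩ := h T hT'
  exact ⟨x, r, hr, hle.trans (mul_le_mul_of_nonneg_right hσ hr.le), hb⟩

theorem QuasiUniform.mono {κ κ' : ℝ} {Γ : Set E3} {K : Mesh} (h : QuasiUniform κ Γ K) (hκ : κ ≤ κ') :
    QuasiUniform κ' Γ K := fun T hT' =>
  (h T hT').trans (mul_le_mul_of_nonneg_right hκ (hT_nonneg T))

theorem IsAdmissible.mono {σ σ' κ κ' L : ℝ} {Γ Ω : Set E3} {K : Mesh}
    (h : IsAdmissible σ κ L Γ Ω K) (hσ : σ ≤ σ') (hκ : κ ≤ κ') : IsAdmissible σ' κ' L Γ Ω K where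
  triangulation := h.triangulation
  shapeRegular := h.shapeRegular.mono hσ
  quasiUniform := h.quasiUniform.mono hκ
  resolves := h.resolves

theorem ShapeRegular.meshSize_pos {σ : ℝ} {Γ : Set E3} {K : Mesh} (h : ShapeRegular σ K)
    (hfin : K.faces.Finite) {T : Finset E3} (hT' : T ∈ cutTets Γ K) : 0 < meshSize Γ K :=
  (h.hT_pos hT'.1).trans_le (hT_le_meshSize hfin hT')

theorem regTets_anti {c c' : ℝ} (h : c ≤ c') (Γ : Set E3) (K : Mesh) :
    regTets c' Γ K ⊆ regTets c Γ K := fun _ hT' =>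
  ⟨hT'.1, (ENNReal.ofReal_le_ofReal (mul_le_mul_of_nonneg_right h (sq_nonneg _))).trans hT'.2⟩

theorem NeighborEstimate.mono {k : ℕ} {Γ : Set E3} {n : E3 → E3} {K : Mesh} {c c' C C' : ℝ}
    (h : NeighborEstimate k Γ n K c C) (hc : c' ≤ c) (hC : C ≤ C') :
    NeighborEstimate k Γ n K c' C' := fun T hT' => by
  obtain ⟨T', ⟨h1, h2⟩, h3⟩ := h T hT'
  refine ⟨T', ⟨h1, regTets_anti hc Γ K h2⟩, fun q hq => (h3 q hq).trans ?_⟩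
  refine mul_le_mul_of_nonneg_right hC ?_
  have := mul_nonneg (hT_nonneg T) (l2norm_nonneg (region (nbrs Γ K T)) (gradient q))
  linarith [l2norm_nonneg (tet T') (gradient q),
    l2norm_nonneg (region (nbrs Γ K T)) (normalDeriv Γ n q)]

/-- A uniformly flat surface yields a `FlatSetting` around each of its points. -/
theorem UniformlyFlat.exists_flatSetting {Γ : Set E3} {n : E3 → E3} {ρ₀ M : ℝ}
    (hf : UniformlyFlat Γ n univ ρ₀ M) {σ κ τ L h : ℝ} (hσ : 2 ≤ σ) (hκ : 1 ≤ κ) (hτ : 0 ≤ τ)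
    (hτ' : τ ≤ 1 / 2) {Ω : Set E3} {K : Mesh} (hK : IsAdmissible σ κ L Γ Ω K) {x₀ : E3}
    (hx₀ : x₀ ∈ Γ) (hh : h = meshSize Γ K) (hh0 : 0 < h) (h1 : 4 * h ≤ ρ₀) (h2 : 4 * M * h ≤ τ)
    (hΩ : Metric.ball x₀ (4 * h) ⊆ Ω) : ∃ ψ, FlatSetting σ κ τ h K Γ x₀ (n x₀) ψ := by
  obtain ⟨hn, -, ψ, hψ, hflat⟩ := hf x₀ ⟨hx₀, mem_univ _⟩
  refine ⟨ψ, ⟨hσ, hκ, hh0, hτ, hτ', hK.triangulation.finite, hK.shapeRegular,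
    fun T hT' => hh ▸ hK.quasiUniform T hT',
    fun T hT' => hh ▸ hT_le_meshSize hK.triangulation.finite hT', ?_, hn,
    fun y hy => hψ y (Metric.ball_subset_ball h1 hy), fun x hx y hy => ?_⟩⟩
  · rw [hK.triangulation.covers]
    exact hΩ.trans subset_closure
  · refine (hflat (4 * h) h1 x hx y hy).trans ?_
    gcongr
    linarith

theorem eLpNorm_inner_le {Γ : Set E3} {n : E3 → E3} (hs : IsClosedSurface Γ n) {S : Set E3}
    (hS : MeasurableSet S) {n₀ n₁ : E3} (hn : n₁ = n₀ ∨ n₁ = -n₀) {η : ℝ} (hη : 0 ≤ η)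
    (h : ∀ x ∈ S, ‖normalExt Γ n x - n₀‖ ≤ η) (q : E3 → ℝ) :
    eLpNorm (fun x => inner ℝ n₁ (gradient q x)) 2 (volume.restrict S) ≤
      eLpNorm (normalDeriv Γ n q) 2 (volume.restrict S) +
        ENNReal.ofReal η * eLpNorm (gradient q) 2 (volume.restrict S) := by
  have h1 : eLpNorm (fun x => inner ℝ n₁ (gradient q x)) 2 (volume.restrict S) ≤
      eLpNorm (fun x => ‖normalDeriv Γ n q x‖ + ‖η • gradient q x‖) 2 (volume.restrict S) := by
    refine eLpNorm_mono_ae (ae_restrict_of_forall_mem hS fun x hx => ?_)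
    have h2 : ‖inner ℝ n₁ (gradient q x)‖ = ‖inner ℝ n₀ (gradient q x)‖ := by
      rcases hn with rfl | rfl
      · rfl
      · rw [inner_neg_left, norm_neg]
    have h3 : inner ℝ n₀ (gradient q x) =
        normalDeriv Γ n q x - inner ℝ (normalExt Γ n x - n₀) (gradient q x) := by
      rw [normalDeriv, inner_sub_left]
      ring
    have h4 : ‖inner ℝ (normalExt Γ n x - n₀) (gradient q x)‖ ≤ η * ‖gradient q x‖ :=
      (norm_inner_le_norm _ _).trans (mul_le_mul_of_nonneg_right (h x hx) (norm_nonneg _))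
    have h5 : 0 ≤ ‖normalDeriv Γ n q x‖ + ‖η • gradient q x‖ := by positivity
    rw [h2, h3, Real.norm_of_nonneg h5, norm_smul η, Real.norm_of_nonneg hη]
    exact (norm_sub_le _ _).trans (add_le_add le_rfl h4)
  refine h1.trans ((eLpNorm_add_le (hs.aestronglyMeasurable_normalDeriv q).restrict.norm
    ((measurable_gradient q).aestronglyMeasurable.const_smul η).norm (by norm_num)).trans ?_)
  rw [eLpNorm_norm, eLpNorm_norm]
  have h5 := eLpNorm_const_smul η (gradient q) 2 (volume.restrict S)
  rw [Real.enorm_of_nonneg hη] at h5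
  exact add_le_add le_rfl h5.le

/-- The geometric constants are fixed before `Γ`. Curvature enters `C` through `M`, by the variation
`3 * M * h` of the normal; `Ω` enters only `h₀`, so that the mesh covers a ball of radius `4 * h`
around each point of `Γ`. -/
theorem exists_neighborEstimate {σ κ : ℝ} (hσ : 2 ≤ σ) (hκ : 1 ≤ κ) : ∃ c₀ : ℝ, 0 < c₀ ∧
    ∀ (Γ : Set E3) (n : E3 → E3), IsClosedSurface Γ n → ∀ k : ℕ, ∃ C : ℝ, 0 < C ∧
      ∀ Ω : Set E3, IsOpen Ω → Γ ⊆ Ω → ∃ h₀ : ℝ, 0 < h₀ ∧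
        ∀ (L : ℝ) (K : Mesh), IsAdmissible σ κ L Γ Ω K → meshSize Γ K ≤ h₀ →
          NeighborEstimate k Γ n K c₀ C := by
  obtain ⟨c₀, δ, τ, hc₀, hδ, hτ, hτ', hgeo⟩ := exists_hasVerticalNeighbor hσ hκ
  refine ⟨c₀, hc₀, fun Γ n hs k => ?_⟩
  obtain ⟨ρ₀, M, hρ₀, hM, hf⟩ := hs.exists_uniformlyFlat
  obtain ⟨C, hC, hCest⟩ := exists_eLpNorm_gradient_le k hδ
  have hM' : 0 ≤ 3 * M * κ := by positivity
  refine ⟨C * (1 + 3 * M * κ), by positivity, fun Ω hΩ hΓΩ => ?_⟩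
  obtain ⟨r, hr, hrΩ⟩ := hs.isCompact.exists_thickening_subset_open hΩ hΓΩ
  refine ⟨min (ρ₀ / 4) (min (τ / (4 * M)) (r / 4)), by positivity, fun L K hK hle T hT' => ?_⟩
  have hfin := hK.triangulation.finite
  have hpos := hK.shapeRegular.meshSize_pos hfin hT'
  set h := meshSize Γ K with hh
  have h1 : 4 * h ≤ ρ₀ := by linarith [hle.trans (min_le_left _ _)]
  have h2 : 4 * M * h ≤ τ := by
    have := hle.trans ((min_le_right _ _).trans (min_le_left _ _))
    rw [le_div_iff₀ (by positivity)] at this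
    linarith
  have h3 : 4 * h ≤ r := by
    linarith [hle.trans ((min_le_right _ _).trans (min_le_right _ _))]
  obtain ⟨x₀, hx₀T, hx₀⟩ := hT'.2
  obtain ⟨ψ, hflat⟩ := hf.exists_flatSetting hσ hκ hτ.le hτ' hK hx₀ hh hpos h1 h2
    ((Metric.ball_subset_ball h3).trans ((Metric.ball_subset_thickening hx₀ r).trans hrΩ))
  obtain ⟨n₁, hn₁, T', hT'n, harea, w, t, ht0, hth, hw1, hw2, hcol⟩ := hgeo hflat hT' hx₀T hx₀
  have hTh := fun T (hT' : T ∈ cutTets Γ K) => hT_le_meshSize hfin hT'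
  refine ⟨T', ⟨hT'n, hT'n.1, le_trans (ENNReal.ofReal_le_ofReal ?_) harea⟩, fun q hq => ?_⟩
  · exact mul_le_mul_of_nonneg_left (pow_le_pow_left₀ (hT_nonneg _) (hTh _ hT'n.1) 2) hc₀.le
  set S := region (nbrs Γ K T) with hS
  have hSm : MeasurableSet S := ((cutTets_finite hfin).subset nbrs_subset_cutTets).measurableSet_biUnion
    fun T _ => (isCompact_tet T).measurableSet
  have e1 := hCest hpos hfin hT' (hTh _ hT') hT'n ht0 hth hw1 hw2 hcol q hq
  have e2 := eLpNorm_inner_le hs hSm hn₁ (by positivity : 0 ≤ 3 * M * h)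
    (fun x hx => norm_normalExt_sub_le hs hM.le hf (by linarith) hTh hT' hx₀T hx₀ hx) q
  have e3 := e1.trans (mul_le_mul_right (add_le_add_right e2 _) _)
  have hA := eLpNorm_gradient_tet_ne_top hq hT'n.1
  have hB := eLpNorm_normalDeriv_ne_top hs hq hfin (nbrs_subset_cutTets (T := T))
  have hG := eLpNorm_gradient_ne_top hq hfin (nbrs_subset_cutTets (T := T))
  have hne := ENNReal.mul_ne_top (ENNReal.ofReal_ne_top (r := 3 * M * h)) hG
  have e4 := ENNReal.toReal_mono (ENNReal.mul_ne_top ENNReal.ofReal_ne_top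
    (ENNReal.add_ne_top.2 ⟨hA, ENNReal.add_ne_top.2 ⟨hB, hne⟩⟩)) e3
  rw [ENNReal.toReal_mul, ENNReal.toReal_add hA (ENNReal.add_ne_top.2 ⟨hB, hne⟩),
    ENNReal.toReal_add hB hne, ENNReal.toReal_mul, ENNReal.toReal_ofReal hC.le,
    ENNReal.toReal_ofReal (by positivity), ← l2norm_eq (measurable_gradient q).aestronglyMeasurable,
    ← l2norm_eq (measurable_gradient q).aestronglyMeasurable,
    ← l2norm_eq (measurable_gradient q).aestronglyMeasurable,
    ← l2norm_eq (hs.aestronglyMeasurable_normalDeriv q).restrict] at e4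
  refine e4.trans ?_
  rw [mul_assoc C]
  refine mul_le_mul_of_nonneg_left ?_ hC.le
  have hq1 := hK.quasiUniform T hT'
  have p1 := l2norm_nonneg (tet T') (gradient q)
  have p2 := l2norm_nonneg S (normalDeriv Γ n q)
  have p3 := l2norm_nonneg S (gradient q)
  have p4 := mul_nonneg (hT_nonneg T) p3
  have p5 : 3 * M * h * l2norm S (gradient q) ≤ 3 * M * κ * (hT T * l2norm S (gradient q)) := by
    have : 3 * M * h ≤ 3 * M * (κ * hT T) := by gcongr
    calc _ ≤ 3 * M * (κ * hT T) * l2norm S (gradient q) := by gcongr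
      _ = _ := by ring
  have p6 := mul_nonneg hM' p1
  have p7 := mul_nonneg hM' p2
  linarith

end TraceFEM

namespace TraceFEM

/-! ### Regular neighbors on arbitrary meshes -/

theorem exists_bary_ge {K : Mesh} {T : Finset E3} (hT' : T ∈ tets K) {x : E3} (hx : x ∈ tet T) :
    ∃ v ∈ T, 1 / 4 ≤ bary T v x := by
  classical
  have hsum : ∑ v ∈ T, bary T v x = 1 := by
    have happ : ∀ y, (∑ v ∈ T, bary T v : E3 →ᵃ[ℝ] ℝ) y = ∑ v ∈ T, bary T v y := fun y => by
      generalize bary T = f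
      clear hT' hx
      induction T using Finset.induction_on with
      | empty => simp
      | insert w S hw ih => rw [Finset.sum_insert hw, Finset.sum_insert hw, AffineMap.coe_add, Pi.add_apply, ih]
    have := affine_convex_induction (S := (T : Set E3)) (∑ v ∈ T, bary T v)
      (convex_singleton (1 : ℝ)) (fun w hw => ?_) hx
    · rw [← happ]
      exact this
    · rw [mem_singleton_iff, happ, Finset.sum_congr rfl fun v _ => bary_apply hT' v hw,
        Finset.sum_ite_eq, if_pos (Finset.mem_coe.1 hw)]
  by_contra! h
  have hne : T.Nonempty := Finset.card_pos.1 (by rw [hT'.2]; norm_num)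
  have := Finset.sum_lt_sum_of_nonempty hne h
  rw [hsum, Finset.sum_const, hT'.2] at this
  norm_num at this

/-- A surface that is almost flat in a ball contains a Lipschitz graph over each horizontal
segment through the center. -/
theorem exists_lipschitz_path {Γ : Set E3} {x₀ n₀ e : E3} {ψ : E3 → ℝ} {ρ : ℝ} (hρ : 0 < ρ)
    (hn : ‖n₀‖ = 1)
    (he : ‖e‖ = 1) (hen : inner ℝ n₀ e = (0 : ℝ)) (hψ : ∀ y ∈ Metric.ball x₀ ρ, y ∈ Γ ↔ ψ y = 0)
    (hx₀ : ψ x₀ = 0) (hflat : ∀ x ∈ Metric.ball x₀ ρ, ∀ y ∈ Metric.ball x₀ ρ,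
      |ψ x - ψ y - inner ℝ n₀ (x - y)| ≤ 1 / 2 * ‖x - y‖) :
    ∃ s : ℝ → ℝ, s 0 = 0 ∧ (∀ t, 0 ≤ t → 2 * t < ρ →
      x₀ + t • e + s t • n₀ ∈ Γ ∩ Metric.ball x₀ ρ) ∧
      ∀ t r, 0 ≤ t → 2 * t < ρ → 0 ≤ r → 2 * r < ρ → |s t - s r| ≤ |t - r| := by
  have hnn : inner ℝ n₀ n₀ = (1 : ℝ) := by rw [real_inner_self_eq_norm_sq, hn, one_pow]
  have hball : ∀ t a : ℝ, 0 ≤ t → 2 * t < ρ → |a| ≤ t → x₀ + t • e + a • n₀ ∈ Metric.ball x₀ ρ := by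
    intro t a ht htρ ha
    rw [Metric.mem_ball, dist_eq_norm]
    have h1 : x₀ + t • e + a • n₀ - x₀ = t • e + a • n₀ := by abel
    rw [h1]
    refine (norm_add_le _ _).trans_lt ?_
    rw [norm_smul, norm_smul, he, hn, Real.norm_of_nonneg ht, Real.norm_eq_abs]
    linarith
  have hex : ∀ t : ℝ, 0 ≤ t → 2 * t < ρ → ∃ a : ℝ, |a| ≤ t ∧ ψ (x₀ + t • e + a • n₀) = 0 := by
    intro t ht htρ
    have hx₀b : x₀ ∈ Metric.ball x₀ ρ := Metric.mem_ball_self (by linarith)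
    have hcont : ContinuousOn (fun a : ℝ => ψ (x₀ + t • e + a • n₀)) (Icc (-t) t) := by
      have hψc : ContinuousOn ψ (Metric.ball x₀ ρ) := by
        refine (LipschitzOnWith.of_dist_le_mul (K := 2) fun x hx y hy => ?_).continuousOn
        have h1 := abs_le.1 (hflat x hx y hy)
        have h2 := abs_le.1 (abs_real_inner_le_norm n₀ (x - y))
        rw [hn, one_mul] at h2
        have h3 := norm_nonneg (x - y)
        rw [Real.dist_eq, dist_eq_norm, abs_le]
        simp only [NNReal.coe_ofNat]
        constructor <;> linarith [h1.1, h1.2, h2.1, h2.2]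
      exact hψc.comp (by fun_prop) fun a ha => hball t a ht htρ (abs_le.2 ha)
    have hval : ∀ a : ℝ, |a| ≤ t → |ψ (x₀ + t • e + a • n₀) - a| ≤ 1 / 2 * ‖t • e + a • n₀‖ := by
      intro a ha
      have h1 := hflat _ (hball t a ht htρ ha) x₀ hx₀b
      have h2 : x₀ + t • e + a • n₀ - x₀ = t • e + a • n₀ := by abel
      rwa [h2, inner_add_right, inner_smul_right, inner_smul_right, hen, hnn, hx₀, mul_zero,
        zero_add, mul_one, sub_zero] at h1
    have hnorm : ∀ a : ℝ, |a| ≤ t → ‖t • e + a • n₀‖ ≤ 2 * t := fun a ha => by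
      refine (norm_add_le _ _).trans ?_
      rw [norm_smul, norm_smul, he, hn, Real.norm_of_nonneg ht, Real.norm_eq_abs]
      linarith
    have ht1 : |t| ≤ t := (abs_of_nonneg ht).le
    have ht2 : |-t| ≤ t := by rwa [abs_neg]
    -- At heights `-t` and `t` the error is at most `t`, so `ψ` has opposite signs, or vanishes, at
    -- the two ends.
    have hlo := (abs_le.1 (hval (-t) ht2)).2
    have hhi := (abs_le.1 (hval t ht1)).1
    have hz : (0 : ℝ) ∈ Icc (ψ (x₀ + t • e + (-t) • n₀)) (ψ (x₀ + t • e + t • n₀)) :=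
      ⟨by linarith [hnorm (-t) ht2], by linarith [hnorm t ht1]⟩
    obtain ⟨a, ha, h0⟩ := intermediate_value_Icc (by linarith) hcont hz
    exact ⟨a, abs_le.2 ha, h0⟩
  choose! s hs using hex
  have hlip : ∀ t r, 0 ≤ t → 2 * t < ρ → 0 ≤ r → 2 * r < ρ → |s t - s r| ≤ |t - r| := by
    intro t r ht htρ hr hrρ
    have h1 := hflat _ (hball t (s t) ht htρ (hs t ht htρ).1) _ (hball r (s r) hr hrρ (hs r hr hrρ).1)
    have h2 : x₀ + t • e + s t • n₀ - (x₀ + r • e + s r • n₀) = (t - r) • e + (s t - s r) • n₀ := by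
      module
    rw [h2, inner_add_right, inner_smul_right, inner_smul_right, hen, hnn, (hs t ht htρ).2,
      (hs r hr hrρ).2, mul_zero, zero_add, mul_one, sub_zero, zero_sub, abs_neg] at h1
    have h3 := norm_add_le ((t - r) • e) ((s t - s r) • n₀)
    rw [norm_smul, norm_smul, he, hn, Real.norm_eq_abs, Real.norm_eq_abs] at h3
    linarith
  refine ⟨s, abs_nonpos_iff.1 (hs 0 le_rfl (by simpa using hρ)).1, fun t ht htρ => ?_, hlip⟩
  have hb := hball t (s t) ht htρ (hs t ht htρ).1
  exact ⟨(hψ _ hb).2 (hs t ht htρ).2, hb⟩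

theorem ShapeRegular.card_le {σ κ h : ℝ} {K : Mesh} (hK : ShapeRegular σ K) (hσ : 0 < σ) (hκ : 0 < κ)
    (hh : 0 < h) {F : Finset (Finset E3)} (hF : ∀ T ∈ F, T ∈ tets K) (hle : ∀ T ∈ F, h ≤ κ * hT T)
    {b : E3} {a : ℝ} (ha : 0 ≤ a) (hFb : ∀ T ∈ F, tet T ⊆ Metric.closedBall b (a * h)) :
    (F.card : ℝ) ≤ (a * (κ * σ)) ^ 3 := by
  have h1 := hK.card_mul_le hσ hF (div_pos hh hκ)
    (fun T hT' => by rw [div_le_iff₀ hκ, mul_comm]; exact hle T hT') (mul_nonneg ha hh.le) hFb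
  have h2 : (F.card : ℝ) * (h / κ / σ) ^ 3 = F.card / (κ * σ) ^ 3 * h ^ 3 := by field_simp
  have h3 : (a * h) ^ 3 = a ^ 3 * h ^ 3 := by ring
  rw [h2, h3] at h1
  have h4 := le_of_mul_le_mul_right h1 (by positivity)
  rw [div_le_iff₀ (by positivity)] at h4
  rw [mul_pow]
  exact h4

theorem exists_area_ge_of_subset_iUnion {S : Set E3} {F : Finset (Finset E3)} (Γ : Set E3)
    (hS : S ⊆ ⋃ T ∈ F, tet T ∩ Γ) {N A : ℝ} (hN : (F.card : ℝ) ≤ N) (hN0 : 0 < N) (hA : 0 < A)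
    (hSA : ENNReal.ofReal A ≤ area S) : ∃ T ∈ F, ENNReal.ofReal (A / N) ≤ area (tet T ∩ Γ) := by
  by_contra! h
  have h1 : area S ≤ ∑ T ∈ F, area (tet T ∩ Γ) :=
    (measure_mono hS).trans (measure_biUnion_finset_le _ _)
  have hne : F.Nonempty := by
    by_contra hF
    rw [Finset.not_nonempty_iff_eq_empty] at hF
    rw [hF, Finset.sum_empty] at h1
    have := hSA.trans h1
    rw [nonpos_iff_eq_zero, ENNReal.ofReal_eq_zero] at this
    linarith
  have h2 : ∑ T ∈ F, area (tet T ∩ Γ) < ∑ T ∈ F, ENNReal.ofReal (A / N) :=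
    ENNReal.sum_lt_sum_of_nonempty hne h
  rw [Finset.sum_const, nsmul_eq_mul, ← ENNReal.ofReal_natCast,
    ← ENNReal.ofReal_mul (Nat.cast_nonneg _)] at h2
  have h3 : (F.card : ℝ) * (A / N) ≤ A := by
    rw [mul_div_assoc', div_le_iff₀ hN0]
    nlinarith
  exact absurd ((hSA.trans h1).trans_lt h2) (not_lt.2 (ENNReal.ofReal_le_ofReal h3))

/-- Along the surface one stays for a while in the cut tetrahedra around a vertex, so one of them is
regular with a threshold that depends on the ratio of the scales of surface and mesh. -/
theorem exists_mem_nbrs_regTets {σ κ L : ℝ} (hσ : 2 ≤ σ) (hκ : 1 ≤ κ) {Γ Ω : Set E3} {n : E3 → E3}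
    {ρ₀ M : ℝ} (hf : UniformlyFlat Γ n univ ρ₀ M) {ρ : ℝ} (hρ : 0 < ρ) (hρρ₀ : ρ ≤ ρ₀)
    (hMρ : M * ρ ≤ 1 / 2) (hΩ : ∀ x₀ ∈ Γ, Metric.ball x₀ ρ ⊆ Ω) {K : Mesh}
    (hK : IsAdmissible σ κ L Γ Ω K) {a : ℝ} (ha : 0 < a) (ha₁ : a * (8 * (σ * κ)) ≤ 1)
    (ha₂ : a * meshSize Γ K * 4 ≤ ρ) {T : Finset E3} (hT' : T ∈ cutTets Γ K) :
    ∃ T' ∈ nbrs Γ K T, T' ∈ regTets ((a / 2) ^ 2 / (1 * (κ * σ)) ^ 3) Γ K := by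
  have hfin := hK.triangulation.finite
  have hpos := hK.shapeRegular.meshSize_pos hfin hT'
  set h := meshSize Γ K with hh
  have hTh := fun T (hT' : T ∈ cutTets Γ K) => hT_le_meshSize hfin hT'
  obtain ⟨x₀, hx₀T, hx₀⟩ := hT'.2
  obtain ⟨hn, -, ψ, hψ, hflat⟩ := hf x₀ ⟨hx₀, mem_univ _⟩
  have hψρ : ∀ y ∈ Metric.ball x₀ ρ, y ∈ Γ ↔ ψ y = 0 := fun y hy =>
    hψ y (Metric.ball_subset_ball hρρ₀ hy)
  have hx₀ψ := (hψρ x₀ (Metric.mem_ball_self hρ)).1 hx₀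
  have hflat' : ∀ x ∈ Metric.ball x₀ ρ, ∀ y ∈ Metric.ball x₀ ρ,
      |ψ x - ψ y - inner ℝ (n x₀) (x - y)| ≤ 1 / 2 * ‖x - y‖ := fun x hx y hy =>
    (hflat ρ hρρ₀ x hx y hy).trans (mul_le_mul_of_nonneg_right hMρ (norm_nonneg _))
  -- One vertex with coordinate at least `1 / 4` at `x₀` now plays the role of `S`.
  obtain ⟨v, hvT, hv⟩ := exists_bary_ge hT'.1 hx₀T
  set G : Set (Finset E3) := {T₁ ∈ cutTets Γ K | v ∈ T₁} with hG
  have hGfin : G.Finite := (cutTets_finite hfin).subset fun _ h => h.1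
  have hGn : G ⊆ nbrs Γ K T := fun T₁ h1 => ⟨h1.1, v, subset_tet _ h1.2, subset_tet _ hvT⟩
  have hslope : ∀ T₁ ∈ G, ∀ v x y, |bary T₁ v x - bary T₁ v y| ≤ σ * κ / (2 * h) * ‖x - y‖ := by
    intro T₁ hT₁ v x y
    refine (hK.shapeRegular.abs_bary_sub_le hT₁.1.1 v x y).trans ?_
    have h1 := hK.shapeRegular.hT_pos hT₁.1.1
    have h2 := hK.quasiUniform T₁ hT₁.1
    refine mul_le_mul_of_nonneg_right ?_ (norm_nonneg _)
    rw [div_le_div_iff₀ (by positivity) (by positivity)]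
    have : σ * (2 * h) ≤ σ * (2 * (κ * hT T₁)) := by gcongr
    linarith
  -- A path of speed at most `2` and duration `l` loses at most `1 / 16` of the coordinate at `v`,
  -- by `ha₁`.
  set l := a * h / 2 with hl
  have hl0 : 0 < l := by positivity
  have hpath : ∀ u : E3, inner ℝ (n x₀) u = (0 : ℝ) → ‖u‖ ≤ l →
      ∃ t : ℝ, x₀ + u + t • n x₀ ∈ ⋃ T₁ ∈ hGfin.toFinset, tet T₁ ∩ Γ := by
    intro u hu hul
    have huse : ∀ e : E3, ‖e‖ = 1 → inner ℝ (n x₀) e = (0 : ℝ) → ∀ t ∈ Icc 0 l,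
        ∃ s : ℝ, x₀ + t • e + s • n x₀ ∈ ⋃ T₁ ∈ hGfin.toFinset, tet T₁ ∩ Γ := by
      intro e he hen t ht
      obtain ⟨s, hs0, hsΓ, hslip⟩ := exists_lipschitz_path hρ hn he hen hψρ hx₀ψ hflat'
      have hlρ : ∀ t ∈ Icc 0 l, 2 * t < ρ := fun t ht => by
        have := ht.2
        rw [hl] at this
        linarith
      have hstar := exists_mem_star_of_path (S := {v}) (γ := fun t => x₀ + t • e + s t • n x₀) (l := l)
        (m := 2) (c := 1 / 4) hfin (fun T₁ hT₁ => hT₁.1.1) hslope (by positivity)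
        (fun r hr t ht => by
          have h1 : x₀ + r • e + s r • n x₀ - (x₀ + t • e + s t • n x₀) =
              (r - t) • e + (s r - s t) • n x₀ := by module
          rw [h1]
          refine (norm_add_le _ _).trans ?_
          rw [norm_smul, norm_smul, he, hn, Real.norm_eq_abs, Real.norm_eq_abs]
          linarith [hslip r t hr.1 (hlρ r hr) ht.1 (hlρ t ht)])
        (fun t ht => by
          have h1 : x₀ + t • e + s t • n x₀ ∈ ⋃ T ∈ tets K, tet T := by
            rw [hK.triangulation.covers]
            exact subset_closure (hΩ x₀ hx₀ (hsΓ t ht.1 (hlρ t ht)).2)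
          simpa using h1)
        ⟨T, ⟨hT', hvT⟩, by simpa [hs0] using hx₀T, fun w hw => by
          rw [Finset.mem_singleton.1 hw]
          simpa [hs0] using hv⟩ (by norm_num)
        (by
          rw [hl]
          have h1 : σ * κ / (2 * h) * (2 * (a * h / 2)) = a * (8 * (σ * κ)) / 16 := by
            field_simp
            norm_num
          rw [h1]
          linarith)
        -- The path lies on `Γ`, so every element it meets is active.
        (fun t ht T₁ _ _ T₂ hT₂ hvT₂ htT₂ =>
          ⟨⟨hT₂, _, htT₂, (hsΓ t ht.1 (hlρ t (Ico_subset_Icc_self ht))).1⟩, hvT₂ (by simp)⟩)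
      obtain ⟨T₁, hT₁, hmem⟩ := hstar t ht
      exact ⟨s t, mem_biUnion (hGfin.mem_toFinset.2 hT₁) ⟨hmem, (hsΓ t ht.1 (hlρ t ht)).1⟩⟩
    by_cases hu0 : u = 0
    · refine ⟨0, mem_biUnion (hGfin.mem_toFinset.2 ⟨hT', hvT⟩) ?_⟩
      simpa [hu0] using And.intro hx₀T hx₀
    · have hun : ‖u‖ ≠ 0 := norm_ne_zero_iff.2 hu0
      obtain ⟨s, hs⟩ := huse (‖u‖⁻¹ • u) (by rw [norm_smul, norm_inv, norm_norm, inv_mul_cancel₀ hun])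
        (by rw [inner_smul_right, hu, mul_zero]) ‖u‖ ⟨norm_nonneg _, hul⟩
      rw [smul_smul, mul_inv_cancel₀ hun, one_smul] at hs
      exact ⟨s, hs⟩
  have harea := area_mono_of_projection hn hl0.le hpath
  have hcard := hK.shapeRegular.card_le (κ := κ) (h := h) (F := hGfin.toFinset) (b := v) (a := 1)
    (by linarith) (by linarith) hpos (fun T₁ hT₁ => ((hGfin.mem_toFinset.1 hT₁).1).1)
    (fun T₁ hT₁ => hK.quasiUniform T₁ (hGfin.mem_toFinset.1 hT₁).1) zero_le_one
    (fun T₁ hT₁ x hx => by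
      have h1 := hGfin.mem_toFinset.1 hT₁
      rw [Metric.mem_closedBall, dist_eq_norm, one_mul]
      exact (norm_sub_le_hT hx (subset_tet _ h1.2)).trans (hTh _ h1.1))
  obtain ⟨T', hT'G, hT'area⟩ := exists_area_ge_of_subset_iUnion Γ subset_rfl hcard (by positivity)
    (by positivity) harea
  have hT'1 := hGfin.mem_toFinset.1 hT'G
  refine ⟨T', hGn hT'1, hT'1.1, (ENNReal.ofReal_le_ofReal ?_).trans hT'area⟩
  have h1 : (a / 2) ^ 2 / (1 * (κ * σ)) ^ 3 * hT T' ^ 2 ≤ (a / 2) ^ 2 / (1 * (κ * σ)) ^ 3 * h ^ 2 :=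
    mul_le_mul_of_nonneg_left (pow_le_pow_left₀ (hT_nonneg _) (hTh _ hT'1.1) 2) (by positivity)
  refine h1.trans (le_of_eq ?_)
  rw [hl]
  ring

/-- The estimate on elements, without restriction on the mesh size. -/
theorem exists_neighborEstimate_of_domain {σ κ : ℝ} (hσ : 2 ≤ σ) (hκ : 1 ≤ κ) {Γ : Set E3}
    {n : E3 → E3} (hs : IsClosedSurface Γ n) (k : ℕ) {Ω : Set E3} (hΩ : IsOpen Ω) (hΓΩ : Γ ⊆ Ω) :
    ∃ c C : ℝ, 0 < c ∧ 0 < C ∧ ∀ (L : ℝ) (K : Mesh), IsAdmissible σ κ L Γ Ω K →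
      NeighborEstimate k Γ n K c C := by
  obtain ⟨c₀, hc₀, hsmall⟩ := exists_neighborEstimate hσ hκ
  obtain ⟨C₀, hC₀, hsmall⟩ := hsmall Γ n hs k
  obtain ⟨h₀, hh₀, hsmall⟩ := hsmall Ω hΩ hΓΩ
  obtain ⟨ρ₀, M, hρ₀, hM, hf⟩ := hs.exists_uniformlyFlat
  obtain ⟨r, hr, hrΩ⟩ := hs.isCompact.exists_thickening_subset_open hΩ hΓΩ
  set ρ := min ρ₀ (min (1 / (2 * M)) r) with hρ
  have hρ0 : 0 < ρ := by positivity
  have hMρ : M * ρ ≤ 1 / 2 := by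
    have : ρ ≤ 1 / (2 * M) := (min_le_right _ _).trans (min_le_left _ _)
    rw [le_div_iff₀ (by positivity)] at this
    linarith
  -- An upper bound for every mesh size, positive because of the added `1`; it makes the ratio `a`
  -- independent of the mesh.
  set D := Metric.diam (closure Ω) + 1 with hD
  have hD0 : 0 < D := by
    have := Metric.diam_nonneg (s := closure Ω)
    linarith
  have hσκ : 0 < σ * κ := by positivity
  set a := min (1 / (8 * (σ * κ))) (ρ / (4 * D)) with ha
  have ha0 : 0 < a := by positivity
  refine ⟨min c₀ ((a / 2) ^ 2 / (1 * (κ * σ)) ^ 3), max C₀ (κ / h₀), by positivity,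
    lt_max_of_lt_left hC₀, fun L K hK => ?_⟩
  have hfin := hK.triangulation.finite
  rcases le_or_gt (meshSize Γ K) h₀ with hle | hgt
  · exact (hsmall L K hK hle).mono (min_le_left _ _) (le_max_left _ _)
  intro T hT'
  have hmD : meshSize Γ K ≤ D := by
    have hbdd : Bornology.IsBounded (closure Ω) := by
      rw [← hK.triangulation.covers]
      exact ((hfin.subset fun _ h => h.1).isCompact_biUnion fun T _ => isCompact_tet T).isBounded
    refine csSup_le ⟨_, mem_image_of_mem hT hT'⟩ ?_
    rintro _ ⟨T₁, hT₁, rfl⟩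
    have hsub : tet T₁ ⊆ closure Ω := by
      rw [← hK.triangulation.covers]
      exact subset_biUnion_of_mem (u := fun T => tet T) hT₁.1
    have := Metric.diam_mono hsub hbdd
    rw [hT]
    linarith
  obtain ⟨T', hT'n, hT'r⟩ := exists_mem_nbrs_regTets hσ hκ hf hρ0 (min_le_left _ _) hMρ
    (fun x₀ hx₀ => (Metric.ball_subset_ball ((min_le_right _ _).trans (min_le_right _ _))).trans
      ((Metric.ball_subset_thickening hx₀ r).trans hrΩ)) hK ha0
    (by
      have : a ≤ 1 / (8 * (σ * κ)) := min_le_left _ _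
      rwa [le_div_iff₀ (by positivity)] at this)
    (by
      have h1 : a ≤ ρ / (4 * D) := min_le_right _ _
      rw [le_div_iff₀ (by positivity)] at h1
      have h2 : a * meshSize Γ K ≤ a * D := by gcongr
      linarith) hT'
  refine ⟨T', ⟨hT'n, regTets_anti (min_le_right _ _) Γ K hT'r⟩, fun q hq => ?_⟩
  set S := region (nbrs Γ K T) with hS
  have p0 : l2norm (tet T) (gradient q) ≤ l2norm S (gradient q) :=
    l2norm_gradient_mono hq hfin nbrs_subset_cutTets (tet_subset_region (mem_nbrs_self hT'))
  have p1 := l2norm_nonneg (tet T') (gradient q)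
  have p2 := l2norm_nonneg S (normalDeriv Γ n q)
  have p3 := l2norm_nonneg S (gradient q)
  have hq1 := hK.quasiUniform T hT'
  -- On a coarse mesh the weight `hT T` is bounded below, so the last term alone controls the left
  -- side, since `T` belongs to its own neighborhood.
  have p4 : 1 ≤ κ / h₀ * hT T := by
    rw [div_mul_eq_mul_div, le_div_iff₀ hh₀]
    linarith
  have p5 : l2norm S (gradient q) ≤ κ / h₀ * hT T * l2norm S (gradient q) :=
    le_mul_of_one_le_left p3 p4
  have p6 : κ / h₀ * (hT T * l2norm S (gradient q)) ≤
      max C₀ (κ / h₀) * (l2norm (tet T') (gradient q) + l2norm S (normalDeriv Γ n q) +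
        hT T * l2norm S (gradient q)) := by
    have := mul_nonneg (hT_nonneg T) p3
    gcongr
    · exact le_max_right _ _
    · linarith
  linarith

end TraceFEM

namespace TraceFEM

/-! ### The global estimate -/

theorem region_ae_eq_iUnion_interior {F : Set (Finset E3)} (hF : F.Finite) :
    region F =ᵐ[volume] ⋃ T ∈ F, interior (tet T) := by
  have hsub : (⋃ T ∈ F, interior (tet T)) ⊆ region F :=
    iUnion₂_mono fun _ _ => interior_subset
  refine Filter.EventuallyLE.antisymm ?_ (LE.le.eventuallyLE hsub)
  rw [ae_le_set]
  refine measure_mono_null (t := ⋃ T ∈ F, frontier (tet T)) ?_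
    ((measure_biUnion_null_iff hF.countable).2 fun T _ => (convex_tet T).addHaar_frontier _)
  rintro x ⟨hx, hxi⟩
  obtain ⟨T, hT, hxT⟩ := mem_iUnion₂.1 hx
  exact mem_biUnion hT ⟨subset_closure hxT, fun h => hxi (mem_biUnion hT h)⟩

theorem setIntegral_region {K : Mesh} {F : Set (Finset E3)} (hF : F.Finite) (hFK : F ⊆ tets K)
    {f : E3 → ℝ} (hf : IntegrableOn f (region F)) :
    ∫ x in region F, f x = ∑ T ∈ hF.toFinset, ∫ x in tet T, f x := by
  rw [setIntegral_congr_set (region_ae_eq_iUnion_interior hF)]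
  have h1 : (⋃ T ∈ F, interior (tet T)) = ⋃ T ∈ hF.toFinset, interior (tet T) := by simp
  rw [h1, integral_biUnion_finset _ (fun _ _ => isOpen_interior.measurableSet)
    (fun T₁ h₁ T₂ h₂ hne => disjoint_interior_tet (hFK (hF.mem_toFinset.1 h₁))
      (hFK (hF.mem_toFinset.1 h₂)) hne)
    (fun T hT => hf.mono_set (interior_subset.trans (tet_subset_region (hF.mem_toFinset.1 hT))))]
  exact Finset.sum_congr rfl fun T _ => by rw [restrict_tet]

theorem setIntegral_region_le_activeDomain {Γ : Set E3} {K : Mesh} (hfin : K.faces.Finite)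
    {f : E3 → ℝ} (hf0 : ∀ x, 0 ≤ f x) (hf : IntegrableOn f (region (cutTets Γ K))) :
    ∫ x in region (cutTets Γ K), f x ≤ ∫ x in activeDomain Γ K, f x := by
  rw [setIntegral_congr_set (region_ae_eq_iUnion_interior (cutTets_finite hfin))]
  refine setIntegral_mono_set (hf.mono_set interior_subset)
    (Filter.Eventually.of_forall hf0) (LE.le.eventuallyLE ?_)
  refine interior_maximal (iUnion₂_mono fun _ _ => interior_subset) ?_
  exact isOpen_biUnion fun _ _ => isOpen_interior

theorem _root_.Finset.sum_sum_filter_le {α : Type*} {F F' : Finset α} {R : α → α → Prop}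
    [DecidableRel R] {N : ℝ} {g : α → ℝ} (hg : ∀ b, 0 ≤ g b)
    (hN : ∀ b ∈ F', ((F.filter fun a => R a b).card : ℝ) ≤ N) :
    ∑ a ∈ F, ∑ b ∈ F' with R a b, g b ≤ N * ∑ b ∈ F', g b := by
  simp only [Finset.sum_filter]
  rw [Finset.sum_comm, Finset.mul_sum]
  refine Finset.sum_le_sum fun b hb => ?_
  rw [← Finset.sum_filter, Finset.sum_const, nsmul_eq_mul]
  exact mul_le_mul_of_nonneg_right (hN b hb) (hg b)

/-- Elements touching `T'` lie in a ball of radius `2 * h`; packing bounds the overlap of the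
neighborhoods. -/
theorem card_filter_nbrs_le {σ κ : ℝ} (hσ : 0 < σ) (hκ : 0 < κ) {Γ : Set E3} {K : Mesh}
    (hfin : K.faces.Finite) (hK : ShapeRegular σ K) (hq : QuasiUniform κ Γ K) {T' : Finset E3}
    (hT' : T' ∈ cutTets Γ K) [DecidablePred fun T => T' ∈ nbrs Γ K T] :
    (((cutTets_finite (Γ := Γ) hfin).toFinset.filter fun T => T' ∈ nbrs Γ K T).card : ℝ) ≤
      (2 * (κ * σ)) ^ 3 := by
  obtain ⟨y, hy, -⟩ := hT'.2
  refine hK.card_le hσ hκ (hK.meshSize_pos hfin hT') (b := y) (fun T hT => ?_) (fun T hT => ?_)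
    zero_le_two fun T hT x hx => ?_
  · exact ((cutTets_finite hfin).mem_toFinset.1 (Finset.mem_filter.1 hT).1).1
  · exact hq T ((cutTets_finite hfin).mem_toFinset.1 (Finset.mem_filter.1 hT).1)
  · obtain ⟨h1, h2⟩ := Finset.mem_filter.1 hT
    obtain ⟨z, hzT', hzT⟩ := h2.2
    have h3 := (norm_sub_le_hT hx hzT).trans
      (hT_le_meshSize hfin ((cutTets_finite hfin).mem_toFinset.1 h1))
    have h4 := (norm_sub_le_hT hzT' hy).trans (hT_le_meshSize hfin hT')
    rw [Metric.mem_closedBall, dist_eq_norm]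
    have h5 := norm_add_le (x - z) (z - y)
    rw [sub_add_sub_cancel] at h5
    linarith

theorem l2norm_region_nbrs_sq {F : Type*} [NormedAddCommGroup F] {Γ : Set E3} {K : Mesh}
    (hfin : K.faces.Finite) {f : E3 → F}
    (hf : IntegrableOn (fun x => ‖f x‖ ^ 2) (region (cutTets Γ K))) (T : Finset E3)
    [DecidablePred fun T' => T' ∈ nbrs Γ K T] :
    l2norm (region (nbrs Γ K T)) f ^ 2 =
      ∑ T' ∈ (cutTets_finite (Γ := Γ) hfin).toFinset with T' ∈ nbrs Γ K T, l2norm (tet T') f ^ 2 := by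
  have hnfin := (cutTets_finite hfin).subset (nbrs_subset_cutTets (Γ := Γ) (K := K) (T := T))
  have h1 : hnfin.toFinset = (cutTets_finite (Γ := Γ) hfin).toFinset.filter fun T' => T' ∈ nbrs Γ K T := by
    ext T'
    simp only [Finite.mem_toFinset, Finset.mem_filter]
    exact ⟨fun h => ⟨h.1, h⟩, fun h => h.2⟩
  rw [l2norm_sq, setIntegral_region hnfin (K := K) (fun _ h => h.1.1)
    (hf.mono_set (region_mono nbrs_subset_cutTets)), h1]
  exact Finset.sum_congr rfl fun T _ => (l2norm_sq _ _).symm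

/-- The local estimates are squared, weighted by `hT T` and summed. Each element is counted at most
`N` times, and `hh` makes the gradient remainder at most half of the left side. -/
theorem norm1h_sq_le {σ κ : ℝ} (hσ : 0 < σ) (hκ : 0 < κ) {Γ : Set E3} {n : E3 → E3}
    (hs : IsClosedSurface Γ n) {k : ℕ} {K : Mesh} (hfin : K.faces.Finite) (hK : ShapeRegular σ K)
    (hqu : QuasiUniform κ Γ K) {c C cp N : ℝ} (hcp : 0 < cp) (hN : N = (2 * (κ * σ)) ^ 3)
    (hE : NeighborEstimate k Γ n K c C)
    (hh : 6 * C ^ 2 * κ * N * meshSize Γ K ^ 2 ≤ 1) {q : E3 → ℝ} (hq : q ∈ pressureSpace k Γ K) :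
    norm1h Γ K q ^ 2 ≤ 6 * C ^ 2 * N * (κ + 1 / cp) * (norm1reg c Γ K q ^ 2 + stab cp Γ n K q q) := by
  classical
  have hcfin := cutTets_finite (Γ := Γ) hfin
  have hrfin : (regTets c Γ K).Finite := hcfin.subset fun _ h => h.1
  have hN0 : 0 ≤ N := by rw [hN]; positivity
  set h := meshSize Γ K with hhdef
  set α : Finset E3 → ℝ := fun T => l2norm (tet T) (gradient q) ^ 2 with hα
  set β : Finset E3 → ℝ := fun T => l2norm (tet T) (normalDeriv Γ n q) ^ 2 with hβ
  have hα0 : ∀ T, 0 ≤ α T := fun _ => sq_nonneg _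
  have hβ0 : ∀ T, 0 ≤ β T := fun _ => sq_nonneg _
  have hg0 : ∀ T, 0 ≤ hT T * α T := fun T => mul_nonneg (hT_nonneg T) (hα0 T)
  have hGint := integrableOn_gradient_sq hq hfin (subset_refl (cutTets Γ K))
  have hBint := integrableOn_normalDeriv_sq hs hq hfin (subset_refl (cutTets Γ K))
  have hX : norm1h Γ K q ^ 2 = ∑ T ∈ hcfin.toFinset, hT T * α T := by
    rw [norm1h, finsum_mem_eq_finite_toFinset_sum _ hcfin,
      Real.sq_sqrt (Finset.sum_nonneg fun T _ => hg0 T)]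
  have hY : norm1reg c Γ K q ^ 2 = ∑ T ∈ hrfin.toFinset, hT T * α T := by
    rw [norm1reg, finsum_mem_eq_finite_toFinset_sum _ hrfin,
      Real.sq_sqrt (Finset.sum_nonneg fun T _ => hg0 T)]
  have hTh : ∀ T ∈ hcfin.toFinset, hT T ≤ h := fun T hT' =>
    hT_le_meshSize hfin (hcfin.mem_toFinset.1 hT')
  have hh0 : 0 ≤ h := Real.sSup_nonneg (by rintro _ ⟨T, -, rfl⟩; exact hT_nonneg T)
  have hZ : h * ∑ T ∈ hcfin.toFinset, β T ≤ 1 / cp * stab cp Γ n K q q := by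
    have h1 := setIntegral_region_le_activeDomain hfin (fun x => by positivity) hBint
    rw [setIntegral_region hcfin (K := K) (fun _ h => h.1) hBint] at h1
    have h2 : ∀ x, ‖normalDeriv Γ n q x‖ ^ 2 = normalDeriv Γ n q x * normalDeriv Γ n q x := fun x => by
      rw [Real.norm_eq_abs, sq_abs, sq]
    have h3 : ∑ T ∈ hcfin.toFinset, β T =
        ∑ T ∈ hcfin.toFinset, ∫ x in tet T, ‖normalDeriv Γ n q x‖ ^ 2 :=
      Finset.sum_congr rfl fun T _ => l2norm_sq _ _
    rw [← h3] at h1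
    simp only [h2] at h1
    calc _ ≤ h * ∫ x in activeDomain Γ K, normalDeriv Γ n q x * normalDeriv Γ n q x := by gcongr
      _ = _ := by
          rw [stab, ← mul_assoc, ← mul_assoc, one_div_mul_cancel hcp.ne', one_mul]
  have hcard : ∀ T' ∈ hcfin.toFinset,
      ((hcfin.toFinset.filter fun T => T' ∈ nbrs Γ K T).card : ℝ) ≤ N := fun T' hT' => by
    rw [hN]
    exact card_filter_nbrs_le hσ hκ hfin hK hqu (hcfin.mem_toFinset.1 hT')
  have hreg : ∀ T ∈ hrfin.toFinset, T ∈ hcfin.toFinset := fun T hT' =>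
    hcfin.mem_toFinset.2 (hrfin.mem_toFinset.1 hT').1
  have hloc : ∀ T ∈ hcfin.toFinset, hT T * α T ≤ 3 * C ^ 2 *
      (κ * (∑ T' ∈ hrfin.toFinset with T' ∈ nbrs Γ K T, hT T' * α T') +
        h * (∑ T' ∈ hcfin.toFinset with T' ∈ nbrs Γ K T, β T') +
        κ * h ^ 2 * ∑ T' ∈ hcfin.toFinset with T' ∈ nbrs Γ K T, hT T' * α T') := by
    intro T hT'
    obtain ⟨T', ⟨hn, hr⟩, hle⟩ := hE T (hcfin.mem_toFinset.1 hT')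
    have h1 := pow_le_pow_left₀ (l2norm_nonneg _ _) (hle q hq) 2
    have hsq : ∀ a b c : ℝ, (a + b + c) ^ 2 ≤ 3 * (a ^ 2 + b ^ 2 + c ^ 2) := fun a b c => by
      nlinarith [sq_nonneg (a - b), sq_nonneg (b - c), sq_nonneg (a - c)]
    rw [mul_pow] at h1
    have h2 := h1.trans (mul_le_mul_of_nonneg_left (hsq _ _ _) (sq_nonneg C))
    rw [mul_pow (hT T), l2norm_region_nbrs_sq hfin hGint, l2norm_region_nbrs_sq hfin hBint] at h2
    have hκT : ∀ T' ∈ nbrs Γ K T, hT T ≤ κ * hT T' := fun T' hn =>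
      (hTh T hT').trans (hqu T' hn.1)
    have h3 : hT T * α T' ≤ κ * ∑ T' ∈ hrfin.toFinset with T' ∈ nbrs Γ K T, hT T' * α T' := by
      have h4 : hT T' * α T' ≤ ∑ T' ∈ hrfin.toFinset with T' ∈ nbrs Γ K T, hT T' * α T' :=
        Finset.single_le_sum (f := fun T' => hT T' * α T') (fun T _ => hg0 T)
          (Finset.mem_filter.2 ⟨hrfin.mem_toFinset.2 hr, hn⟩)
      calc hT T * α T' ≤ κ * hT T' * α T' := by exact mul_le_mul_of_nonneg_right (hκT T' hn) (hα0 _)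
        _ = κ * (hT T' * α T') := by ring
        _ ≤ _ := by gcongr
    have h5 : hT T * ∑ T' ∈ hcfin.toFinset with T' ∈ nbrs Γ K T, β T' ≤
        h * ∑ T' ∈ hcfin.toFinset with T' ∈ nbrs Γ K T, β T' :=
      mul_le_mul_of_nonneg_right (hTh T hT') (Finset.sum_nonneg fun T _ => hβ0 T)
    have h6 : hT T * (hT T ^ 2 * ∑ T' ∈ hcfin.toFinset with T' ∈ nbrs Γ K T, α T') ≤
        κ * h ^ 2 * ∑ T' ∈ hcfin.toFinset with T' ∈ nbrs Γ K T, hT T' * α T' := by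
      rw [Finset.mul_sum, Finset.mul_sum, Finset.mul_sum]
      refine Finset.sum_le_sum fun T' hT'n => ?_
      have h7 := hκT T' (Finset.mem_filter.1 hT'n).2
      have h8 : hT T ^ 2 ≤ h ^ 2 := pow_le_pow_left₀ (hT_nonneg T) (hTh T hT') 2
      have h9 := hT_nonneg T
      have h10 := hα0 T'
      have h11 := h9.trans h7
      calc hT T * (hT T ^ 2 * α T') ≤ (κ * hT T') * (h ^ 2 * α T') := by gcongr
        _ = _ := by ring
    calc hT T * α T ≤ hT T * (C ^ 2 * (3 * (α T' +
          (∑ T' ∈ hcfin.toFinset with T' ∈ nbrs Γ K T, β T') +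
          hT T ^ 2 * ∑ T' ∈ hcfin.toFinset with T' ∈ nbrs Γ K T, α T'))) :=
          mul_le_mul_of_nonneg_left h2 (hT_nonneg T)
      _ = 3 * C ^ 2 * (hT T * α T' + hT T * (∑ T' ∈ hcfin.toFinset with T' ∈ nbrs Γ K T, β T') +
          hT T * (hT T ^ 2 * ∑ T' ∈ hcfin.toFinset with T' ∈ nbrs Γ K T, α T')) := by ring
      _ ≤ _ := by gcongr
  have hsum := Finset.sum_le_sum hloc
  rw [← Finset.mul_sum, Finset.sum_add_distrib, Finset.sum_add_distrib, ← Finset.mul_sum,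
    ← Finset.mul_sum, ← Finset.mul_sum] at hsum
  have s1 := Finset.sum_sum_filter_le (R := fun T T' => T' ∈ nbrs Γ K T) hg0
    fun T' hT' => hcard T' (hreg T' hT')
  have s2 := Finset.sum_sum_filter_le (R := fun T T' => T' ∈ nbrs Γ K T) hβ0 hcard
  have s3 := Finset.sum_sum_filter_le (R := fun T T' => T' ∈ nbrs Γ K T) hg0 hcard
  rw [← hX] at hsum s3
  rw [← hY] at s1
  set X := norm1h Γ K q ^ 2
  set Y := norm1reg c Γ K q ^ 2
  set Z := stab cp Γ n K q q
  have hX0 : 0 ≤ X := sq_nonneg _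
  have hY0 : 0 ≤ Y := sq_nonneg _
  have hZ0 : 0 ≤ 1 / cp * Z :=
    (mul_nonneg hh0 (Finset.sum_nonneg fun T _ => hβ0 T)).trans hZ
  have hZ1 : 0 ≤ Z := by
    have := mul_nonneg hcp.le hZ0
    rwa [← mul_assoc, mul_one_div_cancel hcp.ne', one_mul] at this
  have t1 : X ≤ 3 * C ^ 2 * (κ * (N * Y) + N * (1 / cp * Z) + κ * h ^ 2 * (N * X)) := by
    refine hsum.trans ?_
    have s4 : h * ∑ T ∈ hcfin.toFinset, ∑ T' ∈ hcfin.toFinset with T' ∈ nbrs Γ K T, β T' ≤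
        N * (1 / cp * Z) := by
      calc _ ≤ h * (N * ∑ T ∈ hcfin.toFinset, β T) := by gcongr
        _ = N * (h * ∑ T ∈ hcfin.toFinset, β T) := by ring
        _ ≤ _ := by gcongr
    gcongr
  -- The term absorbed into the left side; this doubles the constant from `3` to `6`.
  have t2 : 3 * C ^ 2 * (κ * h ^ 2 * (N * X)) ≤ X / 2 := by
    have := mul_le_mul_of_nonneg_right hh hX0
    linarith
  have t3 : 0 ≤ 6 * C ^ 2 * N * κ * Z := by positivity
  have t4 : 0 ≤ 6 * C ^ 2 * N * (1 / cp) * Y := by positivity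
  linarith

end TraceFEM

/-! ### The theorem. -/

theorem corollary4p6 (σ κ : ℝ) :
    -- the regularity threshold depends only on shape regularity and quasi-uniformity
    ∃ c₀ : ℝ, 0 < c₀ ∧
      ∀ (Γ : Set TraceFEM.E3) (n : TraceFEM.E3 → TraceFEM.E3), TraceFEM.IsClosedSurface Γ n →
      ∀ (k : ℕ), 1 ≤ k → ∀ L : ℝ,
      -- the estimate on elements, for small mesh sizes and every threshold up to `c₀`
      (∃ C : ℝ, 0 < C ∧
        ∀ Ω : Set TraceFEM.E3, IsOpen Ω → IsConnected Ω → Γ ⊆ Ω → ∃ h₀ : ℝ, 0 < h₀ ∧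
        ∀ c : ℝ, 0 < c → c ≤ c₀ →
        ∀ K : TraceFEM.Mesh, TraceFEM.IsAdmissible σ κ L Γ Ω K → TraceFEM.meshSize Γ K ≤ h₀ →
          TraceFEM.NeighborEstimate k Γ n K c C) ∧
      -- the estimate on elements, without restriction on the mesh size
      (∀ Ω : Set TraceFEM.E3, IsOpen Ω → IsConnected Ω → Γ ⊆ Ω →
        ∃ c₁ C : ℝ, 0 < c₁ ∧ 0 < C ∧
        ∀ c : ℝ, 0 < c → c ≤ c₁ →
        ∀ K : TraceFEM.Mesh, TraceFEM.IsAdmissible σ κ L Γ Ω K →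
          TraceFEM.NeighborEstimate k Γ n K c C) ∧
      -- the global estimate, for small mesh sizes and every threshold up to `c₀`
      (∀ cp : ℝ, 0 < cp → ∃ C : ℝ, 0 < C ∧
        ∀ Ω : Set TraceFEM.E3, IsOpen Ω → IsConnected Ω → Γ ⊆ Ω → ∃ h₀ : ℝ, 0 < h₀ ∧
        ∀ c : ℝ, 0 < c → c ≤ c₀ →
        ∀ K : TraceFEM.Mesh, TraceFEM.IsAdmissible σ κ L Γ Ω K → TraceFEM.meshSize Γ K ≤ h₀ →
          ∀ q ∈ TraceFEM.pressureSpace k Γ K,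
            TraceFEM.norm1h Γ K q ^ 2 ≤
              C * (TraceFEM.norm1reg c Γ K q ^ 2 + TraceFEM.stab cp Γ n K q q)) := by
  -- Enlarging `σ` and `κ` only weakens admissibility, so they may be taken at least `2` and `1`.
  obtain ⟨c₀, hc₀, hmain⟩ := TraceFEM.exists_neighborEstimate
    (le_max_right σ 2) (le_max_right κ 1)
  have hσ : 0 < max σ 2 := lt_max_of_lt_right two_pos
  have hκ : 0 < max κ 1 := lt_max_of_lt_right one_pos
  refine ⟨c₀, hc₀, fun Γ n hs k _ L => ⟨?_, ?_, ?_⟩⟩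
  · obtain ⟨C, hC, h⟩ := hmain Γ n hs k
    refine ⟨C, hC, fun Ω hΩ _ hΓ => ?_⟩
    obtain ⟨h₀, hh₀, h⟩ := h Ω hΩ hΓ
    exact ⟨h₀, hh₀, fun c _ hc K hK hle =>
      (h L K (hK.mono (le_max_left _ _) (le_max_left _ _)) hle).mono hc le_rfl⟩
  · intro Ω hΩ _ hΓ
    obtain ⟨c₁, C, hc₁, hC, h⟩ := TraceFEM.exists_neighborEstimate_of_domain
      (le_max_right σ 2) (le_max_right κ 1) hs k hΩ hΓ
    exact ⟨c₁, C, hc₁, hC, fun c _ hc K hK =>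
      (h L K (hK.mono (le_max_left _ _) (le_max_left _ _))).mono hc le_rfl⟩
  · intro cp hcp
    obtain ⟨C, hC, h⟩ := hmain Γ n hs k
    set N : ℝ := (2 * (max κ 1 * max σ 2)) ^ 3 with hN
    have hN0 : 0 < N := by positivity
    refine ⟨6 * C ^ 2 * N * (max κ 1 + 1 / cp), by positivity, fun Ω hΩ _ hΓ => ?_⟩
    obtain ⟨h₀, hh₀, h⟩ := h Ω hΩ hΓ
    set A := 6 * C ^ 2 * max κ 1 * N with hA
    have hA0 : 0 < A := by positivity
    -- With `h ≤ 1` and `h ≤ 1 / A` one has `A * h ^ 2 ≤ A * h ≤ 1`, the condition for absorption.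
    refine ⟨min h₀ (min 1 (1 / A)), by positivity, fun c _ hc K hK hle q hq => ?_⟩
    have hK' := hK.mono (le_max_left σ 2) (le_max_left κ 1)
    refine TraceFEM.norm1h_sq_le hσ hκ hs hK'.triangulation.finite hK'.shapeRegular
      hK'.quasiUniform hcp hN ((h L K hK' (hle.trans (min_le_left _ _))).mono hc le_rfl) ?_ hq
    have h0 : 0 ≤ TraceFEM.meshSize Γ K :=
      Real.sSup_nonneg (by rintro _ ⟨T, -, rfl⟩; exact TraceFEM.hT_nonneg T)
    have h1 := hle.trans ((min_le_right _ _).trans (min_le_left _ _))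
    have h2 := hle.trans ((min_le_right _ _).trans (min_le_right _ _))
    rw [le_div_iff₀ hA0] at h2
    rw [← hA]
    nlinarith
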